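/- Let $n\ge 0$, let $G=Sp(2n+2,\mathbb R)$ be the group of linear automorphisms of $\mathbb R^{2n+2}$ preserving the symplectic form with matrix $$\Omega=\begin{pmatrix}0&0&1\\0&\mathbb J&0\\-1&0&0\end{pmatrix},\qquad \mathbb J=\begin{pmatrix}0&I_n\\-I_n&0\end{pmatrix}$$ (blocks of sizes $1,2n,1$), and let $\tilde G=SL(2n+2,\mathbb R)\supset G$. Let $P\subset G$ and $\tilde P\subset\tilde G$ be the stabilizers of the ray spanned by the first standard basis vector, so $P=G\cap\tilde P$. Grade $\mathfrak g=\mathfrak{sp}(2n+2,\mathbb R)=\mathfrak g_{-2}\oplus\dots\oplus\mathfrak g_2$ by the blocks of sizes $1,2n,1$ and $\tilde{\mathfrak g}=\mathfrak{sl}(2n+2,\mathbb R)=\tilde{\mathfrak g}_{-1}\oplus\tilde{\mathfrak g}_0\oplus\tilde{\mathfrak g}_1$ by the blocks of sizes $1,2n+1$, an entry in block row $a$ and block column $b$ having degree $b-a$. Let $(\mathcal G\to M,\omega)$ be any smooth Cartan geometry of type $(G,P)$. Let $\tilde{\mathcal G}=\mathcal G\times_P\tilde P\to M$ be the principal $\tilde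 P$-bundle obtained by extension of the structure group, let $j:\mathcal G\to\tilde{\mathcal G}$, $j(u)=[u,e]$, be the natural map, and let $\tilde\omega\in\Omega^1(\tilde{\mathcal G},\tilde{\mathfrak g})$ be the Cartan connection of type $(\tilde G,\tilde P)$ with $j^*\tilde\omega=\omega$. The geometry $(\tilde{\mathcal G}\to M,\tilde\omega)$ determines a projective structure on $M$: over an open set $U\subset M$ it consists of the linear connections $\nabla$ on $TU$ for which there is a smooth section $s:U\to\tilde{\mathcal G}$ with $$\theta(\nabla_\xi Y)=d(\theta(Y))(\xi)+[(s^*\tilde\omega_0)(\xi),\theta(Y)],\qquad \theta=s^*\tilde\omega_{-1},$$ where $\tilde\omega_i$ is the $\tilde{\mathfrak g}_i$-component of $\tilde\omega$. A path of this projective structure is a smooth regular curve $\gamma:J\to M$ (with $J\subset\mathbb R$ open) that near each $t_0\in J$ is, up to parametrization, a geodesic of such a connection, i.e. $\nabla_{\gamma'}\gamma'$ is proportional to $\gamma'$. Then the paths are, as unparametrized curves, exactly the projections to $M$ of the flow lines of the constant vector fields $\omega^{-1}(X)\in\mathfrak X(\mathcal G)$ with $0\ne X\in\mathfrak g_{-1}\cup\mathfrak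 g_{-2}$. That is, for every open $J\subset\mathbb R$, a map $\gamma:J\to M$ is a path if and only if for each $t_0\in J$ there are a nonzero $X\in\mathfrak g_{-1}\cup\mathfrak g_{-2}$, a smooth change of parameter $\varphi$ near $t_0$ with $\varphi'(t_0)\neq0$, and a flow line $c$ of $\omega^{-1}(X)$ defined near $\varphi(t_0)$, such that $\gamma=p\circ c\circ\varphi$ near $t_0$, where $p:\mathcal G\to M$ is the projection. -/

import Mathlib

open scoped Manifold ContDiff Topology Matrix.Norms.L2Operator

/-! ## The two Lie groups, their parabolic subgroups and the gradings

Rows and columns of the `(2n+2) × (2n+2)` matrices are indexed by three consecutive blocks of sizes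
`1`, `2n = n + n` and `1`; the last two together form the block of size `m = 2n+1`. -/

namespace CartanPaths

/-- The index set `1 + ((n + n) + 1)` of the standard basis of `ℝ^(2n+2)`. -/
abbrev Idx (n : ℕ) : Type := Unit ⊕ ((Fin n ⊕ Fin n) ⊕ Unit)

/-- Real `(2n+2) × (2n+2)` matrices. -/
abbrev Mat (n : ℕ) : Type := Matrix (Idx n) (Idx n) ℝ

/-- The matrix of the standard symplectic form: in blocks of sizes `1`, `2n`, `1` it is
`(0, 0, 1; 0, 𝕁, 0; -1, 0, 0)` with `𝕁 = (0, 1; -1, 0)`. -/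
def sympForm (n : ℕ) : Mat n :=
  Matrix.fromBlocks 0 (Matrix.of fun _ j => Sum.elim (fun _ => (0 : ℝ)) (fun _ => 1) j)
    (Matrix.of fun i _ => Sum.elim (fun _ => (0 : ℝ)) (fun _ => -1) i)
    (Matrix.fromBlocks (Matrix.fromBlocks 0 1 (-1) 0) 0 0 0)

/-- The group `G = Sp(2n+2, ℝ)`, as a subgroup of `GL(2n+2, ℝ)`. -/
def spGroup (n : ℕ) : Subgroup (GL (Idx n) ℝ) where
  carrier := {A | (A : Mat n).transpose * sympForm n * (A : Mat n) = sympForm n}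
  one_mem' := by simp
  mul_mem' := by
    intro A B hA hB
    simp only [Set.mem_ofPred_eq, Units.val_mul, Matrix.transpose_mul] at *
    calc (B : Mat n).transpose * (A : Mat n).transpose * sympForm n * ((A : Mat n) * (B : Mat n))
        = (B : Mat n).transpose * ((A : Mat n).transpose * sympForm n * (A : Mat n))
            * (B : Mat n) := by simp only [Matrix.mul_assoc]
      _ = sympForm n := by rw [hA, hB]
  inv_mem' := by
    intro A hA
    simp only [Set.mem_ofPred_eq] at *
    have h1 : (A : Mat n) * ((A⁻¹ : GL (Idx n) ℝ) : Mat n) = 1 := by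
      rw [← Units.val_mul, mul_inv_cancel, Units.val_one]
    have h2 : ((A⁻¹ : GL (Idx n) ℝ) : Mat n).transpose * (A : Mat n).transpose = 1 := by
      rw [← Matrix.transpose_mul, h1, Matrix.transpose_one]
    calc ((A⁻¹ : GL (Idx n) ℝ) : Mat n).transpose * sympForm n * ((A⁻¹ : GL (Idx n) ℝ) : Mat n)
        = ((A⁻¹ : GL (Idx n) ℝ) : Mat n).transpose
            * ((A : Mat n).transpose * sympForm n * (A : Mat n))
            * ((A⁻¹ : GL (Idx n) ℝ) : Mat n) := by rw [hA]
      _ = (((A⁻¹ : GL (Idx n) ℝ) : Mat n).transpose * (A : Mat n).transpose) * sympForm n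
            * ((A : Mat n) * ((A⁻¹ : GL (Idx n) ℝ) : Mat n)) := by simp only [Matrix.mul_assoc]
      _ = sympForm n := by rw [h1, h2, Matrix.one_mul, Matrix.mul_one]

/-- The group `G̃ = SL(2n+2, ℝ)`, as a subgroup of `GL(2n+2, ℝ)`. -/
def slGroup (n : ℕ) : Subgroup (GL (Idx n) ℝ) := (Matrix.GeneralLinearGroup.det).ker

/-- The first vector of the standard basis. -/
def firstVec (n : ℕ) : Idx n → ℝ := Pi.single (Sum.inl ()) 1

/-- The stabilizer in `GL(2n+2, ℝ)` of the ray spanned by the first standard basis vector. -/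
def rayStabilizer (n : ℕ) : Subgroup (GL (Idx n) ℝ) where
  carrier := {A | ∃ a : ℝ, 0 < a ∧ (A : Mat n).mulVec (firstVec n) = a • firstVec n}
  one_mem' := ⟨1, one_pos, by simp⟩
  mul_mem' := by
    rintro A B ⟨a, ha, hA⟩ ⟨b, hb, hB⟩
    refine ⟨b * a, mul_pos hb ha, ?_⟩
    rw [Units.val_mul, ← Matrix.mulVec_mulVec, hB, Matrix.mulVec_smul, hA, smul_smul]
  inv_mem' := by
    rintro A ⟨a, ha, hA⟩
    refine ⟨a⁻¹, inv_pos.mpr ha, ?_⟩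
    have h1 : ((A⁻¹ : GL (Idx n) ℝ) : Mat n) * (A : Mat n) = 1 := by
      rw [← Units.val_mul, inv_mul_cancel, Units.val_one]
    have h2 : firstVec n = a⁻¹ • (A : Mat n).mulVec (firstVec n) := by
      rw [hA, smul_smul, inv_mul_cancel₀ ha.ne', one_smul]
    conv_lhs => rw [h2]
    rw [Matrix.mulVec_smul, Matrix.mulVec_mulVec, h1, Matrix.one_mulVec]

/-- The parabolic subgroup `P ⊆ Sp(2n+2, ℝ)`, the stabilizer of the ray. -/
def parSp (n : ℕ) : Subgroup (GL (Idx n) ℝ) := spGroup n ⊓ rayStabilizer n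

/-- The parabolic subgroup `P̃ ⊆ SL(2n+2, ℝ)`, the stabilizer of the ray. -/
def parSl (n : ℕ) : Subgroup (GL (Idx n) ℝ) := slGroup n ⊓ rayStabilizer n

/-- The reordering of the basis that brings the symplectic form to Mathlib's standard shape. -/
def reorder (n : ℕ) : Idx n ≃ (Unit ⊕ Fin n) ⊕ (Unit ⊕ Fin n) where
  toFun
    | Sum.inl _ => Sum.inl (Sum.inl ())
    | Sum.inr (Sum.inl (Sum.inl i)) => Sum.inl (Sum.inr i)
    | Sum.inr (Sum.inl (Sum.inr i)) => Sum.inr (Sum.inr i)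
    | Sum.inr (Sum.inr _) => Sum.inr (Sum.inl ())
  invFun
    | Sum.inl (Sum.inl _) => Sum.inl ()
    | Sum.inl (Sum.inr i) => Sum.inr (Sum.inl (Sum.inl i))
    | Sum.inr (Sum.inr i) => Sum.inr (Sum.inl (Sum.inr i))
    | Sum.inr (Sum.inl _) => Sum.inr (Sum.inr ())
  left_inv := by rintro (_ | (_ | _) | _) <;> rfl
  right_inv := by rintro ((_ | _) | (_ | _)) <;> rfl

theorem sympForm_eq (n : ℕ) :
    sympForm n = (-Matrix.J (Unit ⊕ Fin n) ℝ).submatrix (reorder n) (reorder n) := by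
  ext i j
  rcases i with (_ | (_ | _) | _) <;> rcases j with (_ | (_ | _) | _) <;>
    simp [sympForm, reorder, Matrix.J, Matrix.one_apply]

theorem spGroup_le_slGroup (n : ℕ) : spGroup n ≤ slGroup n := by
  intro A hA
  have hA' : (A : Mat n).transpose * sympForm n * (A : Mat n) = sympForm n := hA
  set B := (A : Mat n).submatrix (reorder n).symm (reorder n).symm with hB
  have hAB : (A : Mat n) = B.submatrix (reorder n) (reorder n) := by simp [hB]
  have hJ : B.transpose * Matrix.J (Unit ⊕ Fin n) ℝ * B = Matrix.J (Unit ⊕ Fin n) ℝ := by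
    rw [sympForm_eq, hAB, Matrix.transpose_submatrix, Matrix.submatrix_mul_equiv,
      Matrix.submatrix_mul_equiv] at hA'
    have := congrArg (fun C => C.submatrix (reorder n).symm (reorder n).symm) hA'
    simpa using this
  have hdet : B.det = 1 := SymplecticGroup.det_eq_one (SymplecticGroup.mem_iff'.mpr hJ)
  rw [slGroup, MonoidHom.mem_ker]
  ext
  rw [Matrix.GeneralLinearGroup.val_det_apply, hAB, Matrix.det_submatrix_equiv_self, hdet,
    Units.val_one]

/-- The inclusion `P ⊆ P̃` induced by `Sp(2n+2, ℝ) ⊆ SL(2n+2, ℝ)`. -/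
theorem parSp_le_parSl (n : ℕ) : parSp n ≤ parSl n :=
  inf_le_inf_right _ (spGroup_le_slGroup n)

/-- The Lie algebra `𝔤 = 𝔰𝔭(2n+2, ℝ)`, all `X` with `Xᵀ Ω + Ω X = 0`. -/
def spAlg (n : ℕ) : Submodule ℝ (Mat n) where
  carrier := {X | X.transpose * sympForm n + sympForm n * X = 0}
  zero_mem' := by simp
  add_mem' := by
    intro X Y hX hY
    simp only [Set.mem_ofPred_eq] at *
    calc (X + Y).transpose * sympForm n + sympForm n * (X + Y)
        = (X.transpose * sympForm n + sympForm n * X)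
            + (Y.transpose * sympForm n + sympForm n * Y) := by
          rw [Matrix.transpose_add, Matrix.add_mul, Matrix.mul_add]; abel
      _ = 0 := by rw [hX, hY, add_zero]
  smul_mem' := by
    intro r X hX
    simp only [Set.mem_ofPred_eq] at *
    rw [Matrix.transpose_smul, Matrix.smul_mul, Matrix.mul_smul, ← smul_add, hX, smul_zero]

/-- The Lie algebra `𝔤̃ = 𝔰𝔩(2n+2, ℝ)` of trace-free matrices. -/
def slAlg (n : ℕ) : Submodule ℝ (Mat n) := LinearMap.ker (Matrix.traceLinearMap (Idx n) ℝ ℝ)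

/-- The block (numbered `0`, `1`, `2`) of sizes `1`, `2n`, `1` that an index belongs to. -/
def spLevel {n : ℕ} : Idx n → ℤ
  | Sum.inl _ => 0
  | Sum.inr (Sum.inl _) => 1
  | Sum.inr (Sum.inr _) => 2

/-- The block (numbered `0`, `1`) of sizes `1`, `2n+1` that an index belongs to. -/
def slLevel {n : ℕ} : Idx n → ℤ
  | Sum.inl _ => 0
  | Sum.inr _ => 1

/-- The degree `k` part of a matrix, with respect to the decomposition into blocks given by
`level`: entries in block row `a` and block column `b` have degree `b - a`. -/
def gradedPart {n : ℕ} (level : Idx n → ℤ) (k : ℤ) (X : Mat n) : Mat n :=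
  Matrix.of fun i j => if level j - level i = k then X i j else 0

/-- The grading component `𝔤_k` of `𝔤 = 𝔰𝔭(2n+2, ℝ) = 𝔤₋₂ ⊕ 𝔤₋₁ ⊕ 𝔤₀ ⊕ 𝔤₁ ⊕ 𝔤₂`. -/
def spGrade (n : ℕ) (k : ℤ) : Set (Mat n) := {X | X ∈ spAlg n ∧ gradedPart spLevel k X = X}

end CartanPaths

/-! ## Principal bundles, Cartan geometries, extension of the structure group -/

namespace CartanPaths

/-- A smooth principal bundle `T → M` whose structure group is a closed subgroup `H` of
`GL(2n+2, ℝ)`. Since `H` is an embedded submanifold of the space of matrices, smoothness of maps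
from and to `H` is expressed through that space of matrices. -/
structure PrincipalBundle {n : ℕ} (H : Subgroup (GL (Idx n) ℝ))
    {EM ET : Type*} [NormedAddCommGroup EM] [NormedSpace ℝ EM]
    [NormedAddCommGroup ET] [NormedSpace ℝ ET]
    (M : Type*) [TopologicalSpace M] [ChartedSpace EM M]
    (T : Type*) [TopologicalSpace T] [ChartedSpace ET T] where
  /-- the bundle projection -/
  proj : T → M
  /-- the principal right action `(u, h) ↦ u · h` -/
  act : T → H → T
  contMDiff_proj : ContMDiff 𝓘(ℝ, ET) 𝓘(ℝ, EM) ∞ proj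
  surjective_proj : Function.Surjective proj
  act_one : ∀ u, act u 1 = u
  act_mul : ∀ u g h, act u (g * h) = act (act u g) h
  /-- the action `T × H → T` is smooth -/
  smooth_act : ∃ F : T × Mat n → T,
    ContMDiffOn (𝓘(ℝ, ET).prod 𝓘(ℝ, Mat n)) 𝓘(ℝ, ET) ∞ F
      (Set.univ ×ˢ {A | ∃ h : H, ((h : GL (Idx n) ℝ) : Mat n) = A}) ∧
    ∀ (u : T) (h : H), F (u, ((h : GL (Idx n) ℝ) : Mat n)) = act u h
  proj_act : ∀ u h, proj (act u h) = proj u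
  /-- `H` acts freely and transitively on each fibre -/
  existsUnique_act : ∀ u v, proj u = proj v → ∃! h : H, act u h = v
  /-- local triviality: there are smooth local sections `s : U → T`, and the map
  `τ : proj⁻¹(U) → H` with `u = s (proj u) · τ u` is smooth -/
  locally_trivial : ∀ x : M, ∃ (U : Set M) (s : M → T) (τ : T → Mat n),
    IsOpen U ∧ x ∈ U ∧
    ContMDiffOn 𝓘(ℝ, EM) 𝓘(ℝ, ET) ∞ s U ∧ (∀ y ∈ U, proj (s y) = y) ∧
    ContMDiffOn 𝓘(ℝ, ET) 𝓘(ℝ, Mat n) ∞ τ (proj ⁻¹' U) ∧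
    ∀ u, proj u ∈ U → ∃ h : H, ((h : GL (Idx n) ℝ) : Mat n) = τ u ∧ act (s (proj u)) h = u

/-- A Cartan geometry `(T → M, form)` of type `(K, H)`, where `K` is a Lie group of matrices with
Lie algebra `𝔨` and `H` is a closed subgroup of `K`. -/
structure CartanGeometry {n : ℕ} (𝔨 : Submodule ℝ (Mat n)) (H : Subgroup (GL (Idx n) ℝ))
    {EM ET : Type*} [NormedAddCommGroup EM] [NormedSpace ℝ EM]
    [NormedAddCommGroup ET] [NormedSpace ℝ ET]
    (M : Type*) [TopologicalSpace M] [ChartedSpace EM M]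
    (T : Type*) [TopologicalSpace T] [ChartedSpace ET T] [IsManifold 𝓘(ℝ, ET) ∞ T]
    extends PrincipalBundle H (EM := EM) (ET := ET) M T where
  /-- the Cartan connection, a one-form on `T` -/
  form : ∀ u : T, TangentSpace 𝓘(ℝ, ET) u →L[ℝ] Mat n
  /-- the one-form is smooth -/
  contMDiff_form : ContMDiff (𝓘(ℝ, ET).tangent) 𝓘(ℝ, Mat n) ∞
    (fun v : TangentBundle 𝓘(ℝ, ET) T => form v.proj v.snd)
  /-- each `form u` is a linear isomorphism from the tangent space onto `𝔨` -/
  injective_form : ∀ u, Function.Injective (form u)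
  range_form : ∀ u, Set.range (form u) = (𝔨 : Set (Mat n))
  /-- equivariance `(r^h)^* form = Ad(h⁻¹) ∘ form` -/
  form_act : ∀ (u : T) (h : H) (ξ : TangentSpace 𝓘(ℝ, ET) u),
    form (act u h) (mfderiv 𝓘(ℝ, ET) 𝓘(ℝ, ET) (fun v => act v h) u ξ) =
      (((h : GL (Idx n) ℝ)⁻¹ : GL (Idx n) ℝ) : Mat n) * form u ξ * ((h : GL (Idx n) ℝ) : Mat n)
  /-- `form` reproduces the generators of fundamental vector fields: if `h` is a curve in `H` with
  `h 0 = 1` and velocity `A` at `0`, then `form` maps the velocity of `t ↦ u · h t` to `A` -/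
  form_fundamental : ∀ (u : T) (h : ℝ → H) (A : Mat n), h 0 = 1 →
    HasDerivAt (fun t => ((h t : GL (Idx n) ℝ) : Mat n)) A 0 →
    form (act u (h 0)) (mfderiv 𝓘(ℝ, ℝ) 𝓘(ℝ, ET) (fun t => act u (h t)) 0 (1 : ℝ)) = A

section Constructions

variable {n : ℕ} {H : Subgroup (GL (Idx n) ℝ)} {𝔨 : Submodule ℝ (Mat n)}
  {EM ET : Type*} [NormedAddCommGroup EM] [NormedSpace ℝ EM]
  [NormedAddCommGroup ET] [NormedSpace ℝ ET]
  {M : Type*} [TopologicalSpace M] [ChartedSpace EM M]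
  {T : Type*} [TopologicalSpace T] [ChartedSpace ET T]

/-- The constant vector field `ω⁻¹(X)`. -/
noncomputable def CartanGeometry.constantField [IsManifold 𝓘(ℝ, ET) ∞ T]
    (C : CartanGeometry 𝔨 H (EM := EM) (ET := ET) M T) (X : Mat n) :
    ∀ u : T, TangentSpace 𝓘(ℝ, ET) u :=
  fun u => Function.invFun (C.form u) X

/-- The equivalence relation on `T × H'` whose classes are the orbits of `H`:
`(u, g) ∼ (u · p, p⁻¹ g)`. -/
def PrincipalBundle.extSetoid (B : PrincipalBundle H (EM := EM) (ET := ET) M T)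
    {H' : Subgroup (GL (Idx n) ℝ)} (hle : H ≤ H') : Setoid (T × H') where
  r a b := ∃ p : H, b.1 = B.act a.1 p ∧ b.2 = (Subgroup.inclusion hle p)⁻¹ * a.2
  iseqv :=
    { refl := fun a => ⟨1, by rw [B.act_one], by simp⟩
      symm := by
        rintro a b ⟨p, h1, h2⟩
        refine ⟨p⁻¹, ?_, ?_⟩
        · rw [h1, ← B.act_mul, mul_inv_cancel, B.act_one]
        · rw [h2, map_inv, inv_inv, mul_inv_cancel_left]
      trans := by
        rintro a b c ⟨p, h1, h2⟩ ⟨q, h3, h4⟩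
        refine ⟨p * q, ?_, ?_⟩
        · rw [h3, h1, ← B.act_mul]
        · rw [h4, h2, map_mul, mul_inv_rev, mul_assoc] }

/-- The total space `T ×_H H'` of the extension of the structure group along `H ⊆ H'`. -/
def PrincipalBundle.Ext (B : PrincipalBundle H (EM := EM) (ET := ET) M T)
    {H' : Subgroup (GL (Idx n) ℝ)} (hle : H ≤ H') :=
  Quotient (B.extSetoid hle)

variable (B : PrincipalBundle H (EM := EM) (ET := ET) M T)
  {H' : Subgroup (GL (Idx n) ℝ)} (hle : H ≤ H')

/-- The quotient topology on `T ×_H H'`. -/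
instance : TopologicalSpace (B.Ext hle) :=
  inferInstanceAs (TopologicalSpace (Quotient (B.extSetoid hle)))

/-- The projection `T ×_H H' → M`, `[u, g] ↦ proj u`. -/
def PrincipalBundle.extProj : B.Ext hle → M :=
  Quotient.lift (s := B.extSetoid hle) (fun a => B.proj a.1) (by
    rintro a b ⟨p, h1, -⟩
    simp only [h1, B.proj_act])

/-- The right action of `H'` on `T ×_H H'`, `[u, g] · h = [u, g h]`. -/
def PrincipalBundle.extAct : B.Ext hle → H' → B.Ext hle := fun c h =>
  Quotient.map (sa := B.extSetoid hle) (sb := B.extSetoid hle) (fun a => (a.1, a.2 * h)) (by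
    rintro a b ⟨p, h1, h2⟩
    exact ⟨p, h1, by simp only [h2, mul_assoc]⟩) c

/-- The natural map `j : T → T ×_H H'`, `j u = [u, 1]`. -/
def PrincipalBundle.extIncl : T → B.Ext hle := fun u =>
  Quotient.mk (B.extSetoid hle) (u, 1)

end Constructions

/-- The Fefferman-type extension. Starting from a Cartan geometry `C = (T → M, ω)` of type
`(Sp(2n+2, ℝ), P)`, the total space is `T ×_P P̃` with its natural projection to `M` and its natural
right action of `P̃`. Its smooth structure is the one for which it is a principal bundle and the
natural map `j : T → T ×_P P̃` is smooth (these two conditions determine it), and the Cartan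
connection `ω̃` is the one with `j^* ω̃ = ω`. -/
structure IsFeffermanExtension {n : ℕ}
    {EM ET ET' : Type*} [NormedAddCommGroup EM] [NormedSpace ℝ EM]
    [NormedAddCommGroup ET] [NormedSpace ℝ ET] [NormedAddCommGroup ET'] [NormedSpace ℝ ET']
    {M : Type*} [TopologicalSpace M] [ChartedSpace EM M]
    {T : Type*} [TopologicalSpace T] [ChartedSpace ET T] [IsManifold 𝓘(ℝ, ET) ∞ T]
    (C : CartanGeometry (spAlg n) (parSp n) (EM := EM) (ET := ET) M T)
    [ChartedSpace ET' (C.Ext (parSp_le_parSl n))]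
    [IsManifold 𝓘(ℝ, ET') ∞ (C.Ext (parSp_le_parSl n))]
    (C' : CartanGeometry (slAlg n) (parSl n) (EM := EM) (ET := ET') M
      (C.Ext (parSp_le_parSl n))) : Prop where
  proj_eq : C'.proj = C.extProj (parSp_le_parSl n)
  act_eq : C'.act = C.extAct (parSp_le_parSl n)
  contMDiff_incl : ContMDiff 𝓘(ℝ, ET) 𝓘(ℝ, ET') ∞ (C.extIncl (parSp_le_parSl n))
  pullback_form : ∀ (u : T) (ξ : TangentSpace 𝓘(ℝ, ET) u),
    C'.form (C.extIncl (parSp_le_parSl n) u)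
      (mfderiv 𝓘(ℝ, ET) 𝓘(ℝ, ET') (C.extIncl (parSp_le_parSl n)) u ξ) = C.form u ξ

end CartanPaths

/-! ## Paths of the projective structure and projections of flow lines -/

namespace CartanPaths

section Paths

variable {n : ℕ} {EM ET : Type*} [NormedAddCommGroup EM] [NormedSpace ℝ EM]
  [NormedAddCommGroup ET] [NormedSpace ℝ ET]
  {M : Type*} [TopologicalSpace M] [ChartedSpace EM M]
  {T : Type*} [TopologicalSpace T] [ChartedSpace ET T]

/-- The velocity `γ'(t)` of a curve in a manifold. -/
noncomputable def velocity (γ : ℝ → M) (t : ℝ) : TangentSpace 𝓘(ℝ, EM) (γ t) :=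
  mfderiv 𝓘(ℝ, ℝ) 𝓘(ℝ, EM) γ t (1 : ℝ)

/-- `γ` is, near the time `t₀`, a geodesic up to parametrization of the linear connection `cov`
on the tangent bundle: `∇_{γ'} γ'` is proportional to `γ'`, where `∇_{γ'} γ'` is computed from an
extension of `γ'` to a smooth vector field. (Mathlib writes `cov Y x ξ` for `(∇_ξ Y)(x)`.) -/
def IsUnparametrizedGeodesicAt [IsManifold 𝓘(ℝ, EM) ∞ M]
    (cov : (Π x : M, TangentSpace 𝓘(ℝ, EM) x) →
      (Π x : M, TangentSpace 𝓘(ℝ, EM) x →L[ℝ] TangentSpace 𝓘(ℝ, EM) x))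
    (γ : ℝ → M) (t₀ : ℝ) : Prop :=
  ∃ (V : Set M) (Y : Π x : M, TangentSpace 𝓘(ℝ, EM) x),
    IsOpen V ∧ γ t₀ ∈ V ∧
    ContMDiffOn 𝓘(ℝ, EM) 𝓘(ℝ, EM).tangent ∞
      (fun x => (⟨x, Y x⟩ : TangentBundle 𝓘(ℝ, EM) M)) V ∧
    ∀ᶠ t in 𝓝 t₀, Y (γ t) = velocity γ t ∧
      ∃ f : ℝ, cov Y (γ t) (velocity γ t) = f • velocity γ t

/-- The coframe `s^* ω̃₋₁` on `M` given by a local section `s` of the Cartan bundle, with values in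
`𝔤̃₋₁`. -/
noncomputable def coframe [IsManifold 𝓘(ℝ, ET) ∞ T]
    (C : CartanGeometry (slAlg n) (parSl n) (EM := EM) (ET := ET) M T) (s : M → T) (x : M)
    (ξ : TangentSpace 𝓘(ℝ, EM) x) : Mat n :=
  gradedPart slLevel (-1) (C.form (s x) (mfderiv 𝓘(ℝ, EM) 𝓘(ℝ, ET) s x ξ))

/-- The connection form `s^* ω̃₀` given by a local section `s` of the Cartan bundle, with values in
`𝔤̃₀`. -/
noncomputable def connForm [IsManifold 𝓘(ℝ, ET) ∞ T]
    (C : CartanGeometry (slAlg n) (parSl n) (EM := EM) (ET := ET) M T) (s : M → T) (x : M)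
    (ξ : TangentSpace 𝓘(ℝ, EM) x) : Mat n :=
  gradedPart slLevel 0 (C.form (s x) (mfderiv 𝓘(ℝ, EM) 𝓘(ℝ, ET) s x ξ))

/-- The class of linear connections on `TM` over an open set `U` that is determined by a Cartan
geometry of type `(SL(2n+2, ℝ), P̃)`, i.e. its projective structure over `U`. Its elements are the
connections obtained by pulling back the component `ω̃₀` of the Cartan connection along a smooth
section `s : U → T`: in terms of the coframe `θ = s^* ω̃₋₁`, the connection is given by
`θ(∇_ξ Y) = d(θ(Y))(ξ) + [s^*ω̃₀(ξ), θ(Y)]`. (Two sections that differ by a function with values in the block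
diagonal subgroup `G̃₀` give the same connection, and sections that differ by a function with values
in `exp(𝔤̃₁)` give projectively equivalent connections.) -/
def projectiveClassOn [IsManifold 𝓘(ℝ, EM) ∞ M] [IsManifold 𝓘(ℝ, ET) ∞ T]
    (C : CartanGeometry (slAlg n) (parSl n) (EM := EM) (ET := ET) M T) (U : Set M) :
    Set ((Π x : M, TangentSpace 𝓘(ℝ, EM) x) →
      (Π x : M, TangentSpace 𝓘(ℝ, EM) x →L[ℝ] TangentSpace 𝓘(ℝ, EM) x)) :=
  {cov | IsCovariantDerivativeOn EM cov U ∧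
    ∃ s : M → T, ContMDiffOn 𝓘(ℝ, EM) 𝓘(ℝ, ET) ∞ s U ∧ (∀ x ∈ U, C.proj (s x) = x) ∧
      ∀ x ∈ U, ∀ Y : Π x : M, TangentSpace 𝓘(ℝ, EM) x,
        MDifferentiableAt 𝓘(ℝ, EM) 𝓘(ℝ, EM).tangent
          (fun y => (⟨y, Y y⟩ : TangentBundle 𝓘(ℝ, EM) M)) x →
        ∀ ξ : TangentSpace 𝓘(ℝ, EM) x,
          coframe C s x (cov Y x ξ) =
            mvfderiv 𝓘(ℝ, EM) (fun y => coframe C s y (Y y)) x ξ +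
              (connForm C s x ξ * coframe C s x (Y x) - coframe C s x (Y x) * connForm C s x ξ)}

/-- `γ : J → M` is a path of the projective structure determined by the Cartan geometry `C`: a
smooth regular curve which locally is a geodesic, up to parametrization, of a connection in the
projective class. -/
structure IsProjectivePath [IsManifold 𝓘(ℝ, EM) ∞ M] [IsManifold 𝓘(ℝ, ET) ∞ T]
    (C : CartanGeometry (slAlg n) (parSl n) (EM := EM) (ET := ET) M T)
    (γ : ℝ → M) (J : Set ℝ) : Prop where
  smooth : ContMDiffOn 𝓘(ℝ, ℝ) 𝓘(ℝ, EM) ∞ γ J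
  regular : ∀ t ∈ J, velocity (EM := EM) γ t ≠ 0
  geodesic : ∀ t ∈ J, ∃ U : Set M, IsOpen U ∧ γ t ∈ U ∧
    ∃ cov ∈ projectiveClassOn C U, IsUnparametrizedGeodesicAt cov γ t

/-- `γ : J → M` is, as an unparametrized curve, a projection of flow lines of constant vector
fields: near each time it is obtained by a regular smooth change of parameter `φ` from the
projection of a flow line `c` of a constant vector field `ω⁻¹(X)` with `0 ≠ X ∈ S`. -/
def IsFlowLineProjection [IsManifold 𝓘(ℝ, ET) ∞ T] {𝔨 : Submodule ℝ (Mat n)}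
    {H : Subgroup (GL (Idx n) ℝ)} (C : CartanGeometry 𝔨 H (EM := EM) (ET := ET) M T)
    (S : Set (Mat n)) (γ : ℝ → M) (J : Set ℝ) : Prop :=
  ∀ t₀ ∈ J, ∃ X ∈ S, X ≠ 0 ∧ ∃ (c : ℝ → T) (φ : ℝ → ℝ),
    ContDiffAt ℝ ∞ φ t₀ ∧ deriv φ t₀ ≠ 0 ∧
    IsMIntegralCurveAt (I := 𝓘(ℝ, ET)) c (C.constantField X) (φ t₀) ∧
    ∀ᶠ t in 𝓝 t₀, γ t = C.proj (c (φ t))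

end Paths

end CartanPaths

/-! Everything is read off from logarithmic derivatives. Lift a regular curve γ to the Cartan bundle
by a section s and put A = ω̃((s∘γ)'). With e₀ the first basis vector, the connection attached to s
satisfies θ(∇_{γ'}γ') = (A' + A² − 2A₀₀A)₋₁ (`coframe_covariant_acceleration`), so γ is an
unparametrized geodesic exactly when (A' + A²)e₀ lies in the span of e₀ and Ae₀. If g' = gA, this
says that y = ge₀ satisfies y'' = αy + βy': the development of γ stays in a plane, that is, on a
projective line.

From flow lines to paths: every X in 𝔤₋₁ ∪ 𝔤₋₂ has X² = 0 (`mul_self_of_mem_spGrade`). Since j^*ω̃ =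
ω, j carries a flow line of ω⁻¹(X) to a curve with constant logarithmic derivative X. For a section
extending that curve, A = φ'X, so A² = 0, A₀₀ = 0 and ∇_{γ'}γ' = (φ''/φ')γ'.

From paths to flow lines: if y = ae₀ + bXe₀, put φ = b/a. The gauge transformation h = g⁻¹(1 + φX) =
g⁻¹exp(φX) takes values in P̃ and turns A into φ'X (`exists_straightening`), so γ is a
reparametrized projection of a flow line of ω̃⁻¹(X). The value of h at one time may be prescribed,
provided that X represents the initial direction there. By `exists_parSp_spGrade`, P moves every
nonzero direction to one represented by 𝔤₋₁ ∪ 𝔤₋₂. Hence the flow line can be made to start in the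
image of j, and by uniqueness of integral curves it is then the j-image of a flow line of ω⁻¹(X).

Only logarithmic derivatives along curves occur, so no curvature condition enters. -/

namespace CartanPaths

/-! ## Determinants along curves -/

section Det

variable {ι : Type*} [Fintype ι] [DecidableEq ι]

theorem differentiable_det : Differentiable ℝ (fun A : Matrix ι ι ℝ => A.det) := by
  have hentry : ∀ i j, ContDiff ℝ 1 (fun A : Matrix ι ι ℝ => A i j) := fun i j =>
    (LinearMap.toContinuousLinearMap (Matrix.entryLinearMap ℝ ℝ i j)).contDiff
  simp_rw [Matrix.det_apply]
  refine Differentiable.fun_sum fun σ _ => ?_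
  have : Differentiable ℝ (fun A : Matrix ι ι ℝ => ∏ i, A (σ i) i) :=
    (contDiff_prod (n := 1) fun i _ => hentry (σ i) i).differentiable one_ne_zero
  simpa [Units.smul_def] using this.const_mul (((Equiv.Perm.sign σ : ℤ) : ℝ))

theorem hasDerivAt_det_one_add_smul (B : Matrix ι ι ℝ) :
    HasDerivAt (fun t : ℝ => (1 + t • B).det) B.trace 0 := by
  rw [funext fun t : ℝ => Matrix.det_one_add_smul t B]
  -- What remains of the polynomial det(1 + tB) after its constant and linear terms: det(1 + tB) = 1
  -- + t tr B + t² q(t).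
  set q := (Matrix.det (1 + (Polynomial.X : Polynomial ℝ) • B.map Polynomial.C)).divX.divX
  have h := (((hasDerivAt_id (0 : ℝ)).const_mul B.trace).const_add 1).add
    ((q.hasDerivAt 0).mul ((hasDerivAt_id (0 : ℝ)).pow 2))
  exact h.congr_deriv (by simp)

theorem hasDerivAt_det_of_eq_one {g : ℝ → Matrix ι ι ℝ} {B : Matrix ι ι ℝ} {t : ℝ}
    (hg : HasDerivAt g B t) (h1 : g t = 1) : HasDerivAt (fun s => (g s).det) B.trace t := by
  have hd : HasFDerivAt (fun A : Matrix ι ι ℝ => A.det)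
      (fderiv ℝ (fun A : Matrix ι ι ℝ => A.det) 1) 1 := (differentiable_det 1).hasFDerivAt
  have h2 : HasDerivAt (fun t : ℝ => (1 : Matrix ι ι ℝ) + t • B) B 0 := by
    simpa using ((hasDerivAt_id (0 : ℝ)).smul_const B).const_add (1 : Matrix ι ι ℝ)
  have hd0 : HasFDerivAt (fun A : Matrix ι ι ℝ => A.det)
      (fderiv ℝ (fun A : Matrix ι ι ℝ => A.det) 1) ((1 : Matrix ι ι ℝ) + (0 : ℝ) • B) := by
    simpa using hd
  have h3 := (hd0.comp_hasDerivAt (0 : ℝ) h2).unique (hasDerivAt_det_one_add_smul B)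
  rw [← h1] at hd
  have h4 := hd.comp_hasDerivAt t hg
  rw [h1, h3] at h4
  exact h4

/-- Liouville's formula for trace-free coefficients. -/
theorem hasDerivAt_det_of_trace_eq_zero {g : ℝ → Matrix ι ι ℝ} {A : Matrix ι ι ℝ} {t : ℝ}
    (hg : HasDerivAt g (g t * A) t) (hA : A.trace = 0) (hdet : (g t).det ≠ 0) :
    HasDerivAt (fun s => (g s).det) 0 t := by
  have hu : IsUnit (g t).det := isUnit_iff_ne_zero.mpr hdet
  -- Translating by (g t)⁻¹ gives a curve that passes through 1 at time t with velocity A.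
  have h1 : HasDerivAt (fun s => (g t)⁻¹ * g s) ((g t)⁻¹ * (g t * A)) t := hg.const_mul _
  rw [← Matrix.mul_assoc, Matrix.nonsing_inv_mul _ hu, Matrix.one_mul] at h1
  have h2 := (hasDerivAt_det_of_eq_one h1 (Matrix.nonsing_inv_mul _ hu)).const_mul (g t).det
  rw [hA, mul_zero] at h2
  refine h2.congr_of_eventuallyEq (Filter.Eventually.of_forall fun s => ?_)
  simp only
  rw [← Matrix.det_mul, ← Matrix.mul_assoc, Matrix.mul_nonsing_inv _ hu, Matrix.one_mul]

end Det

/-! ## Membership in the matrix groups -/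

theorem mem_parSl_iff {n : ℕ} (A : GL (Idx n) ℝ) : A ∈ parSl n ↔ (A : Mat n).det = 1 ∧
    ∃ a : ℝ, 0 < a ∧ (A : Mat n).mulVec (firstVec n) = a • firstVec n := by
  refine and_congr ?_ Iff.rfl
  change Matrix.GeneralLinearGroup.det A = 1 ↔ _
  rw [Units.ext_iff, Matrix.GeneralLinearGroup.val_det_apply, Units.val_one]

theorem exists_mem_parSl {n : ℕ} {A : Mat n} {a : ℝ} (h1 : A.det = 1) (ha : 0 < a)
    (hA : A.mulVec (firstVec n) = a • firstVec n) :
    ∃ h : parSl n, ((h : GL (Idx n) ℝ) : Mat n) = A :=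
  ⟨⟨Matrix.GeneralLinearGroup.mkOfDetNeZero A (by simp [h1]),
    (mem_parSl_iff _).mpr ⟨h1, a, ha, hA⟩⟩, rfl⟩

theorem firstVec_inl {n : ℕ} (u : Unit) : firstVec n (Sum.inl u) = 1 := by simp [firstVec]

theorem firstVec_inr {n : ℕ} (i : (Fin n ⊕ Fin n) ⊕ Unit) : firstVec n (Sum.inr i) = 0 := by
  simp [firstVec]

theorem mulVec_firstVec {n : ℕ} (A : Mat n) (i : Idx n) :
    A.mulVec (firstVec n) i = A i (Sum.inl ()) := by
  simp [firstVec]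

/-- Applied to the first column of a trace-free matrix, this is the test for membership in the Lie
algebra of P̃. -/
theorem mem_span_firstVec {n : ℕ} (v : Idx n → ℝ) :
    (∃ c : ℝ, v = c • firstVec n) ↔ ∀ i, v (Sum.inr i) = 0 := by
  constructor
  · rintro ⟨c, rfl⟩ i
    simp [firstVec_inr]
  · intro h
    refine ⟨v (Sum.inl ()), ?_⟩
    ext (i | i)
    · simp [firstVec_inl]
    · simp [firstVec_inr, h]

/-- Every element of the Lie algebra of `P̃` is the velocity of a curve in `P̃`. -/
theorem exists_curve_parSl {n : ℕ} {B : Mat n} (hB : B ∈ slAlg n) {b : ℝ}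
    (hb : B.mulVec (firstVec n) = b • firstVec n) :
    ∃ h : ℝ → parSl n, h 0 = 1 ∧
      HasDerivAt (fun t => ((h t : GL (Idx n) ℝ) : Mat n)) B 0 := by
  set D : ℝ → Mat n := fun t => 1 + t • B with hD
  set N : ℕ := Fintype.card (Idx n) with hN
  have hN0 : N ≠ 0 := Fintype.card_ne_zero
  have hdet : HasDerivAt (fun t => (D t).det) 0 0 := by
    have h := hasDerivAt_det_one_add_smul B
    rwa [show B.trace = 0 from hB] at h
  set r : ℝ → ℝ := fun t => (D t).det ^ (-(1 / N : ℝ)) with hr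
  have hD0 : D 0 = 1 := by simp [hD]
  have hr0 : r 0 = 1 := by simp [hr, hD0]
  have hrd : HasDerivAt r 0 0 := by
    have := hdet.rpow_const (p := -(1 / N : ℝ)) (Or.inl (by simp [hD0]))
    exact this.congr_deriv (by simp)
  have hDd : HasDerivAt D B 0 := by
    exact (((hasDerivAt_id (0 : ℝ)).smul_const B).const_add (1 : Mat n)).congr_deriv (by simp)
  have hA : HasDerivAt (fun t => r t • D t) B 0 := by
    have h := hrd.smul hDd
    exact h.congr_deriv (by rw [hr0]; simp)
  have hpos : ∀ᶠ t in 𝓝 (0 : ℝ), 0 < (D t).det ∧ 0 < 1 + t * b := by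
    refine (hdet.continuousAt.eventually_mem (isOpen_Ioi.mem_nhds (by simp [hD0]))).and ?_
    have : ContinuousAt (fun t : ℝ => 1 + t * b) 0 := by fun_prop
    exact this.eventually_mem (isOpen_Ioi.mem_nhds (by simp))
  have hmem : ∀ t, ∃ h : parSl n, (0 < (D t).det ∧ 0 < 1 + t * b) →
      ((h : GL (Idx n) ℝ) : Mat n) = r t • D t := by
    intro t
    by_cases ht : 0 < (D t).det ∧ 0 < 1 + t * b
    · obtain ⟨h, hh⟩ := exists_mem_parSl (A := r t • D t) (a := r t * (1 + t * b)) (by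
        rw [Matrix.det_smul, ← hN, hr]
        simp only
        rw [← Real.rpow_natCast, ← Real.rpow_mul ht.1.le]
        have : -(1 / (N : ℝ)) * N = -1 := by field_simp
        rw [this, Real.rpow_neg_one, inv_mul_cancel₀ ht.1.ne'])
        (mul_pos (Real.rpow_pos_of_pos ht.1 _) ht.2) (by
          rw [Matrix.smul_mulVec, hD]
          simp only
          rw [Matrix.add_mulVec, Matrix.one_mulVec, Matrix.smul_mulVec, hb]
          module)
      exact ⟨h, fun _ => hh⟩
    · exact ⟨1, fun h => absurd h ht⟩
  choose h hh using hmem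
  refine ⟨h, ?_, ?_⟩
  · ext1
    ext1
    rw [hh 0 (by simp [hD0])]
    simp [hr0, hD0]
  · exact hA.congr_of_eventuallyEq (hpos.mono fun t ht => hh t ht)

/-! ## The graded pieces of a matrix -/

theorem gradedPart_add {n : ℕ} (l : Idx n → ℤ) (k : ℤ) (A B : Mat n) :
    gradedPart l k (A + B) = gradedPart l k A + gradedPart l k B := by
  ext i j
  by_cases h : l j - l i = k <;> simp [gradedPart, h]

theorem gradedPart_smul {n : ℕ} (l : Idx n → ℤ) (k : ℤ) (c : ℝ) (A : Mat n) :
    gradedPart l k (c • A) = c • gradedPart l k A := by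
  ext i j
  by_cases h : l j - l i = k <;> simp [gradedPart, h]

/-- The projection of matrices onto their part of degree `k`, as a continuous linear map. -/
noncomputable def gradedProj {n : ℕ} (l : Idx n → ℤ) (k : ℤ) : Mat n →L[ℝ] Mat n :=
  LinearMap.toContinuousLinearMap
    { toFun := gradedPart l k
      map_add' := gradedPart_add l k
      map_smul' := gradedPart_smul l k }

/-- A matrix entry, as a continuous linear form. -/
noncomputable def entryL {n : ℕ} (i j : Idx n) : Mat n →L[ℝ] ℝ :=
  LinearMap.toContinuousLinearMap (Matrix.entryLinearMap ℝ ℝ i j)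

theorem gradedPart_neg_one_apply {n : ℕ} (A : Mat n) (i : (Fin n ⊕ Fin n) ⊕ Unit) (u : Unit) :
    gradedPart slLevel (-1) A (Sum.inr i) (Sum.inl u) = A (Sum.inr i) (Sum.inl u) := by
  simp [gradedPart, slLevel]

/-- This links the kernel of the coframe to the Lie algebra of P̃, and thereby to vertical vectors.
-/
theorem gradedPart_neg_one_eq_zero_iff {n : ℕ} (A : Mat n) :
    gradedPart slLevel (-1) A = 0 ↔ ∃ c : ℝ, A.mulVec (firstVec n) = c • firstVec n := by
  rw [mem_span_firstVec]
  simp only [mulVec_firstVec]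
  constructor
  · intro h i
    rw [← gradedPart_neg_one_apply A i (), h]
    rfl
  · intro h
    ext (i | i) (j | j)
    · simp [gradedPart, slLevel]
    · simp [gradedPart, slLevel]
    · rw [gradedPart_neg_one_apply]
      exact h i
    · simp [gradedPart, slLevel]

/-- The bracket of the parts of degree `0` and `-1` of a matrix. -/
theorem gradedPart_commutator {n : ℕ} (A : Mat n) :
    gradedPart slLevel 0 A * gradedPart slLevel (-1) A
      - gradedPart slLevel (-1) A * gradedPart slLevel 0 A =
    gradedPart slLevel (-1) (A * A - (2 * A (Sum.inl ()) (Sum.inl ())) • A) := by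
  -- Only the lower-left block matters. With A = (a, *; v, D) both sides are Dv − av there, as A²
  -- contributes va + Dv.
  ext (i | i) (j | j) <;>
    simp [gradedPart, slLevel, Matrix.mul_apply]
  ring

/-- Degrees add under brackets. This keeps the right-hand side of the connection formula in the
range of the coframe. -/
theorem gradedPart_neg_one_bracket {n : ℕ} (A B : Mat n) :
    gradedPart slLevel (-1) (gradedPart slLevel 0 A * gradedPart slLevel (-1) B
      - gradedPart slLevel (-1) B * gradedPart slLevel 0 A) =
    gradedPart slLevel 0 A * gradedPart slLevel (-1) B
      - gradedPart slLevel (-1) B * gradedPart slLevel 0 A := by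
  ext (i | i) (j | j) <;>
    simp [gradedPart, slLevel, Matrix.mul_apply]

theorem gradedPart_neg_one_gradedPart {n : ℕ} (A : Mat n) :
    gradedPart slLevel (-1) (gradedPart slLevel (-1) A) = gradedPart slLevel (-1) A := by
  ext i j
  by_cases h : slLevel j - slLevel i = -1 <;> simp [gradedPart, h]

theorem gradedPart_neg_one_mem_slAlg {n : ℕ} (A : Mat n) :
    gradedPart slLevel (-1) A ∈ slAlg n := by
  change Matrix.trace (gradedPart slLevel (-1) A) = 0
  simp [Matrix.trace, gradedPart]

/-! ## Elements of degree `-1` and `-2` in the symplectic Lie algebra -/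

theorem apply_eq_zero_of_gradedPart_eq {n : ℕ} {l : Idx n → ℤ} {k : ℤ} {X : Mat n}
    (hX : gradedPart l k X = X) {i j : Idx n} (h : l j - l i ≠ k) : X i j = 0 := by
  rw [← hX]
  simp [gradedPart, h]

/-- This is one entry of XᵀΩ + ΩX = 0: the last row of X is the symplectic dual of its first column.
-/
theorem sympForm_mul_row {n : ℕ} {X : Mat n} (hX : X ∈ spAlg n) (i : Fin n ⊕ Fin n) :
    X (Sum.inr (Sum.inr ())) (Sum.inr (Sum.inl i)) =
      Sum.elim (fun a => X (Sum.inr (Sum.inl (Sum.inr a))) (Sum.inl ()))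
        (fun a => -X (Sum.inr (Sum.inl (Sum.inl a))) (Sum.inl ())) i := by
  have h : X.transpose * sympForm n + sympForm n * X = 0 := hX
  have h1 := congrFun (congrFun h (Sum.inr (Sum.inl i))) (Sum.inl ())
  rcases i with i | i <;>
    simp [sympForm, Matrix.mul_apply, Matrix.fromBlocks, Matrix.one_apply] at h1 ⊢ <;> linarith

/-- For degree −2 the square has degree −4, hence vanishes. For degree −1 the square has degree −2,
and its single possible entry is the symplectic form evaluated on (y, y), with y the middle part of
the first column. Consequently exp(sX) = 1 + sX. -/
theorem mul_self_of_mem_spGrade {n : ℕ} {X : Mat n}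
    (hX : X ∈ spGrade n (-1) ∪ spGrade n (-2)) : X * X = 0 := by
  ext i j
  rw [Matrix.mul_apply, Matrix.zero_apply]
  rcases hX with ⟨hs, hX⟩ | ⟨hs, hX⟩
  · rcases i with i | i | i
    · refine Finset.sum_eq_zero fun l _ => ?_
      rw [apply_eq_zero_of_gradedPart_eq hX (i := Sum.inl i), zero_mul]
      rcases l with l | l | l <;> simp [spLevel]
    · refine Finset.sum_eq_zero fun l _ => ?_
      rcases l with l | l | l
      · rw [apply_eq_zero_of_gradedPart_eq hX (i := Sum.inl l), mul_zero]
        rcases j with j | j | j <;> simp [spLevel]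
      · rw [apply_eq_zero_of_gradedPart_eq hX (i := Sum.inr (Sum.inl i)), zero_mul]
        simp [spLevel]
      · rw [apply_eq_zero_of_gradedPart_eq hX (i := Sum.inr (Sum.inl i)), zero_mul]
        simp [spLevel]
    · rcases j with j | j
      -- The corner entry is the only one not excluded by degree; the two halves of the middle block
      -- cancel.
      · rw [Fintype.sum_sum_type, Fintype.sum_sum_type]
        have h0 : X (Sum.inl ()) (Sum.inl ()) = 0 :=
          apply_eq_zero_of_gradedPart_eq hX (by simp [spLevel])
        have h2 : X (Sum.inr (Sum.inr ())) (Sum.inr (Sum.inr ())) = 0 :=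
          apply_eq_zero_of_gradedPart_eq hX (by simp [spLevel])
        simp only [Finset.univ_unique, PUnit.default_eq_unit, Finset.sum_singleton, h0, h2,
          mul_zero, zero_mul, zero_add, add_zero, sympForm_mul_row hs, Fintype.sum_sum_type,
          Sum.elim_inl, Sum.elim_inr]
        rw [← Finset.sum_add_distrib]
        exact Finset.sum_eq_zero fun a _ => by ring
      · refine Finset.sum_eq_zero fun l _ => ?_
        rcases l with l | l | l
        · rw [apply_eq_zero_of_gradedPart_eq hX (i := Sum.inl l), mul_zero]
          rcases j with j | j <;> simp [spLevel]
        · rw [apply_eq_zero_of_gradedPart_eq hX (i := Sum.inr (Sum.inl l)), mul_zero]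
          rcases j with j | j <;> simp [spLevel]
        · rw [apply_eq_zero_of_gradedPart_eq hX (i := Sum.inr (Sum.inr i)), zero_mul]
          simp [spLevel]
  · refine Finset.sum_eq_zero fun l _ => ?_
    rcases l with l | l
    · rw [apply_eq_zero_of_gradedPart_eq hX (i := Sum.inl l), mul_zero]
      rcases j with j | j | j <;> simp [spLevel]
    · rw [apply_eq_zero_of_gradedPart_eq hX (j := Sum.inr l), zero_mul]
      rcases l with l | l <;> rcases i with i | i | i <;> simp [spLevel]

theorem mulVec_firstVec_inl_of_mem_spGrade {n : ℕ} {X : Mat n}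
    (hX : X ∈ spGrade n (-1) ∪ spGrade n (-2)) : X.mulVec (firstVec n) (Sum.inl ()) = 0 := by
  rw [mulVec_firstVec]
  rcases hX with ⟨-, hX⟩ | ⟨-, hX⟩ <;>
    exact apply_eq_zero_of_gradedPart_eq hX (by simp [spLevel])

/-- The first column determines such an X, its last row being dual to that column in degree −1. So a
nonzero X is transversal to the Lie algebra of P̃. -/
theorem exists_mulVec_firstVec_ne_zero {n : ℕ} {X : Mat n}
    (hX : X ∈ spGrade n (-1) ∪ spGrade n (-2)) (h0 : X ≠ 0) :
    ∃ i, X.mulVec (firstVec n) (Sum.inr i) ≠ 0 := by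
  simp only [mulVec_firstVec]
  by_contra! h
  refine h0 ?_
  ext i j
  rw [Matrix.zero_apply]
  rcases hX with ⟨hs, hX⟩ | ⟨hs, hX⟩
  · by_cases hij : spLevel j - spLevel i = -1
    · rcases i with i | i | i <;> rcases j with j | j | j <;> try simp [spLevel] at hij
      · exact h _
      · rw [sympForm_mul_row hs]
        rcases j with j | j <;> simp [h]
    · exact apply_eq_zero_of_gradedPart_eq hX hij
  · rcases j with j | j
    · rcases i with i | i
      · exact apply_eq_zero_of_gradedPart_eq hX (by simp [spLevel])
      · exact h i
    · refine apply_eq_zero_of_gradedPart_eq hX ?_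
      rcases j with j | j <;> rcases i with i | i | i <;> simp [spLevel]

theorem mem_spAlg_of_mem_spGrade {n : ℕ} {X : Mat n}
    (hX : X ∈ spGrade n (-1) ∪ spGrade n (-2)) : X ∈ spAlg n := by
  rcases hX with hX | hX <;> exact hX.1

theorem mem_slAlg_of_mem_spGrade {n : ℕ} {X : Mat n}
    (hX : X ∈ spGrade n (-1) ∪ spGrade n (-2)) : X ∈ slAlg n := by
  change Matrix.trace X = 0
  refine Finset.sum_eq_zero fun i _ => ?_
  rcases hX with ⟨-, hX⟩ | ⟨-, hX⟩ <;> exact apply_eq_zero_of_gradedPart_eq hX (by simp)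

theorem one_add_smul_mul_one_sub_smul {n : ℕ} {X : Mat n} (h2 : X * X = 0) (s : ℝ) :
    (1 + s • X) * (1 - s • X) = 1 := by
  simp [Matrix.add_mul, Matrix.mul_sub, h2]

theorem one_sub_smul_mul_one_add_smul {n : ℕ} {X : Mat n} (h2 : X * X = 0) (s : ℝ) :
    (1 - s • X) * (1 + s • X) = 1 := by
  simpa [sub_eq_add_neg] using one_add_smul_mul_one_sub_smul h2 (-s)

/-- The exponential `1 + s X` of a square-zero element of the symplectic Lie algebra lies in the
symplectic group. -/
theorem exists_mem_spGroup {n : ℕ} {X : Mat n} (hX : X ∈ spAlg n) (h2 : X * X = 0)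
    (s : ℝ) : ∃ A ∈ spGroup n, (A : Mat n) = 1 + s • X := by
  have hs : X.transpose * sympForm n + sympForm n * X = 0 := hX
  have h3 : X.transpose * sympForm n = -(sympForm n * X) := eq_neg_of_add_eq_zero_left hs
  refine ⟨⟨1 + s • X, 1 - s • X, one_add_smul_mul_one_sub_smul h2 s,
    one_sub_smul_mul_one_add_smul h2 s⟩, ?_, rfl⟩
  change (1 + s • X).transpose * sympForm n * (1 + s • X) = sympForm n
  rw [Matrix.transpose_add, Matrix.transpose_one, Matrix.transpose_smul, Matrix.add_mul,
    Matrix.one_mul, Matrix.smul_mul, h3]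
  -- Moving the transposed factor across Ω turns it into 1 − sX, the inverse of 1 + sX.
  calc (sympForm n + s • -(sympForm n * X)) * (1 + s • X)
      = sympForm n * ((1 - s • X) * (1 + s • X)) := by
        simp only [Matrix.add_mul, Matrix.mul_add, Matrix.mul_one, Matrix.sub_mul, Matrix.one_mul,
          Matrix.smul_mul, Matrix.mul_smul, Matrix.neg_mul, Matrix.mul_assoc,
          Matrix.mul_sub, smul_neg, smul_sub, smul_add]
        abel
    _ = sympForm n := by rw [one_sub_smul_mul_one_add_smul h2 s, Matrix.mul_one]

theorem det_one_add_smul_of_mem_spAlg {n : ℕ} {X : Mat n} (hX : X ∈ spAlg n) (h2 : X * X = 0)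
    (s : ℝ) : (1 + s • X).det = 1 := by
  obtain ⟨A, hA, hAX⟩ := exists_mem_spGroup hX h2 s
  have h5 := spGroup_le_slGroup n hA
  change Matrix.GeneralLinearGroup.det A = 1 at h5
  rw [Units.ext_iff, Matrix.GeneralLinearGroup.val_det_apply, Units.val_one, hAX] at h5
  exact h5

/-- The symplectic dual of a vector of the middle block. -/
def sympDual {n : ℕ} (y : Fin n ⊕ Fin n → ℝ) : Fin n ⊕ Fin n → ℝ :=
  Sum.elim (fun a => y (Sum.inr a)) (fun a => -y (Sum.inl a))

/-- Skew-symmetry of the symplectic form; it is what makes `positiveElement y` square to zero. -/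
theorem sympDual_dotProduct {n : ℕ} (y : Fin n ⊕ Fin n → ℝ) : ∑ i, sympDual y i * y i = 0 := by
  rw [Fintype.sum_sum_type, ← Finset.sum_add_distrib]
  exact Finset.sum_eq_zero fun a _ => by simp [sympDual]; ring

/-- The element of `𝔤₁` that maps the last basis vector to the vector `y` of the middle block. -/
def positiveElement {n : ℕ} (y : Fin n ⊕ Fin n → ℝ) : Mat n :=
  Matrix.of fun
    | Sum.inl _, Sum.inr (Sum.inl j) => -sympDual y j
    | Sum.inr (Sum.inl i), Sum.inr (Sum.inr _) => y i
    | _, _ => 0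

/-- The element of `𝔤₋₁` that maps the first basis vector to the vector `y` of the middle block. -/
def negativeElement {n : ℕ} (y : Fin n ⊕ Fin n → ℝ) : Mat n :=
  Matrix.of fun
    | Sum.inr (Sum.inl i), Sum.inl _ => y i
    | Sum.inr (Sum.inr _), Sum.inr (Sum.inl j) => sympDual y j
    | _, _ => 0

/-- The element of `𝔤₋₂` that maps the first basis vector to `z` times the last one. -/
def lowestElement {n : ℕ} (z : ℝ) : Mat n :=
  Matrix.of fun
    | Sum.inr (Sum.inr _), Sum.inl _ => z
    | _, _ => 0

theorem positiveElement_mem {n : ℕ} (y : Fin n ⊕ Fin n → ℝ) : positiveElement y ∈ spAlg n := by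
  change (positiveElement y).transpose * sympForm n + sympForm n * positiveElement y = 0
  ext i j
  rcases i with i | (i | i) | i <;> rcases j with j | (j | j) | j <;>
    simp [sympForm, Matrix.mul_apply, Matrix.fromBlocks, Matrix.one_apply, positiveElement,
      sympDual]

theorem positiveElement_mul_self {n : ℕ} (y : Fin n ⊕ Fin n → ℝ) :
    positiveElement y * positiveElement y = 0 := by
  have h := sympDual_dotProduct y
  rw [Fintype.sum_sum_type] at h
  ext i j
  rcases i with i | i | i <;> rcases j with j | j | j <;>
    simp [Matrix.mul_apply, positiveElement]
  linarith

theorem negativeElement_mem {n : ℕ} (y : Fin n ⊕ Fin n → ℝ) :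
    negativeElement y ∈ spGrade n (-1) := by
  constructor
  · change (negativeElement y).transpose * sympForm n + sympForm n * negativeElement y = 0
    ext i j
    rcases i with i | (i | i) | i <;> rcases j with j | (j | j) | j <;>
      simp [sympForm, Matrix.mul_apply, Matrix.fromBlocks, Matrix.one_apply, negativeElement,
        sympDual]
  · ext i j
    rcases i with i | i | i <;> rcases j with j | j | j <;>
      simp [gradedPart, spLevel, negativeElement]

theorem lowestElement_mem {n : ℕ} (z : ℝ) : lowestElement (n := n) z ∈ spGrade n (-2) := by
  constructor
  · change (lowestElement z).transpose * sympForm n + sympForm n * lowestElement z = 0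
    ext i j
    rcases i with i | (i | i) | i <;> rcases j with j | (j | j) | j <;>
      simp [sympForm, Matrix.mul_apply, Matrix.fromBlocks, lowestElement]
  · ext i j
    rcases i with i | i | i <;> rcases j with j | j | j <;>
      simp [gradedPart, spLevel, lowestElement]

/-- Up to the action of `P`, every tangent direction is represented by an element of degree `-1`
or `-2`. -/
theorem exists_parSp_spGrade {n : ℕ} {v : Idx n → ℝ} (hv : ∃ i, v (Sum.inr i) ≠ 0) :
    ∃ p : parSp n, ∃ X ∈ spGrade n (-1) ∪ spGrade n (-2), X ≠ 0 ∧
      ((p : GL (Idx n) ℝ) : Mat n).mulVec (firstVec n) = firstVec n ∧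
      ∃ c : ℝ, ((p : GL (Idx n) ℝ) : Mat n).mulVec (X.mulVec (firstVec n)) =
        v + c • firstVec n := by
  -- A direction without last component is represented in 𝔤₋₁ without any correction; otherwise an
  -- element of P moves a direction of 𝔤₋₂ onto it.
  by_cases hz : v (Sum.inr (Sum.inr ())) = 0
  · refine ⟨1, negativeElement fun i => v (Sum.inr (Sum.inl i)), Or.inl (negativeElement_mem _),
      ?_, by simp, -v (Sum.inl ()), ?_⟩
    · rintro h
      obtain ⟨i | i, hi⟩ := hv
      · exact hi (congrFun (congrFun h (Sum.inr (Sum.inl i))) (Sum.inl ()))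
      · exact hi hz
    · ext i
      rw [Subgroup.coe_one, Units.val_one, Matrix.one_mulVec, mulVec_firstVec]
      rcases i with i | i | i
      · simp [negativeElement, firstVec_inl]
      · simp [negativeElement, firstVec_inr]
      · simp [negativeElement, firstVec_inr, hz]
  · set z := v (Sum.inr (Sum.inr ())) with hzdef
    -- With Y the element of 𝔤₁ given by y, 1 + Y fixes e₀ and sends z times the last basis vector
    -- to that vector plus zy. The factor z⁻¹ makes zy the middle part of v.
    set y : Fin n ⊕ Fin n → ℝ := fun i => z⁻¹ * v (Sum.inr (Sum.inl i)) with hy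
    obtain ⟨p, hp, hpy⟩ := exists_mem_spGroup (positiveElement_mem y)
      (positiveElement_mul_self y) 1
    rw [one_smul] at hpy
    have hp0 : (p : Mat n).mulVec (firstVec n) = firstVec n := by
      ext i
      rw [mulVec_firstVec, hpy]
      rcases i with i | i | i <;>
        simp [positiveElement, firstVec_inl, firstVec_inr]
    refine ⟨⟨p, hp, 1, one_pos, by rw [hp0, one_smul]⟩, lowestElement z,
      Or.inr (lowestElement_mem z), ?_, hp0, -v (Sum.inl ()), ?_⟩
    · intro h
      exact hz (congrFun (congrFun h (Sum.inr (Sum.inr ()))) (Sum.inl ()))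
    · rw [Matrix.mulVec_mulVec]
      ext i
      rw [mulVec_firstVec, hpy]
      rcases i with i | i | i
      · simp [Matrix.mul_apply, lowestElement, positiveElement, firstVec_inl]
      · simp [Matrix.mul_apply, lowestElement, positiveElement, firstVec_inr, hy]
        field_simp
      · simp [Matrix.mul_apply, lowestElement, positiveElement, firstVec_inr,
          ← hzdef]

/-! ## Ordinary differential equations and local inverses -/

section Calculus

variable {E F : Type*} [NormedAddCommGroup E] [NormedSpace ℝ E]
  [NormedAddCommGroup F] [NormedSpace ℝ F]

/-- Solutions of a smooth autonomous differential equation are smooth. -/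
theorem contDiffOn_of_hasDerivAt_comp {y : ℝ → E} {V : E → E} {I : Set ℝ} {W : Set E}
    (hI : IsOpen I) (hV : ContDiffOn ℝ ∞ V W) (hW : Set.MapsTo y I W)
    (hy : ∀ t ∈ I, HasDerivAt y (V (y t)) t) : ContDiffOn ℝ ∞ y I := by
  rw [contDiffOn_infty]
  intro k
  -- Bootstrapping: if y is C^k, then so is y' = V ∘ y, hence y is C^(k+1).
  induction k with
  | zero =>
    exact contDiffOn_zero.mpr fun t ht => (hy t ht).continuousAt.continuousWithinAt
  | succ k ih =>
    have hk : ((k + 1 : ℕ) : WithTop ℕ∞) = (k : WithTop ℕ∞) + 1 := by norm_cast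
    rw [hk, contDiffOn_succ_iff_deriv_of_isOpen hI]
    refine ⟨fun t ht => (hy t ht).differentiableAt.differentiableWithinAt, by simp, ?_⟩
    refine ContDiffOn.congr (f := V ∘ y) ?_ fun t ht => (hy t ht).deriv
    exact (hV.of_le (by exact_mod_cast le_top)).comp ih hW

/-- Local solvability of linear matrix differential equations with smooth coefficients. -/
theorem exists_linear_ode_solution {ι : Type*} [Fintype ι] [DecidableEq ι]
    {A : ℝ → Matrix ι ι ℝ} {I : Set ℝ} (hI : IsOpen I) (hA : ContDiffOn ℝ ∞ A I)
    {t₀ : ℝ} (ht₀ : t₀ ∈ I) (g₀ : Matrix ι ι ℝ) :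
    ∃ g : ℝ → Matrix ι ι ℝ, g t₀ = g₀ ∧ ∃ I' ⊆ I, IsOpen I' ∧ t₀ ∈ I' ∧
      ContDiffOn ℝ ∞ g I' ∧ ∀ t ∈ I', HasDerivAt g (g t * A t) t := by
  -- Time is added as a first coordinate to make the equation autonomous; `hfst` then identifies
  -- that coordinate with t.
  set V : ℝ × Matrix ι ι ℝ → ℝ × Matrix ι ι ℝ := fun z => (1, z.2 * A z.1) with hVdef
  set W : Set (ℝ × Matrix ι ι ℝ) := Prod.fst ⁻¹' I with hW
  have hWo : IsOpen W := hI.preimage continuous_fst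
  have hV : ContDiffOn ℝ ∞ V W :=
    contDiffOn_const.prodMk (contDiffOn_snd.mul (hA.comp contDiffOn_fst fun z hz => hz))
  have hV0 : ContDiffAt ℝ 1 V (t₀, g₀) :=
    (hV.contDiffAt (hWo.mem_nhds ht₀)).of_le (by exact_mod_cast le_top)
  obtain ⟨y, hy0, ε, hε, hy⟩ :=
    hV0.exists_forall_mem_closedBall_exists_eq_forall_mem_Ioo_hasDerivAt₀ t₀
  have hfst : ∀ t ∈ Set.Ioo (t₀ - ε) (t₀ + ε), (y t).1 = t := by
    have h1 : ∀ t ∈ Set.Ioo (t₀ - ε) (t₀ + ε), HasDerivAt (fun t => (y t).1 - t) 0 t := by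
      intro t ht
      have := ((hasFDerivAt_fst (𝕜 := ℝ) (p := y t)).comp_hasDerivAt t (hy t ht)).sub
        (hasDerivAt_id t)
      exact this.congr_deriv (by simp [hVdef])
    intro t ht
    have h2 := isOpen_Ioo.is_const_of_deriv_eq_zero isPreconnected_Ioo
      (fun t ht => (h1 t ht).differentiableAt.differentiableWithinAt)
      (fun t ht => (h1 t ht).deriv) ht (show t₀ ∈ Set.Ioo (t₀ - ε) (t₀ + ε) by
        constructor <;> linarith)
    simp only [hy0, sub_self] at h2
    linarith
  obtain ⟨δ, hδ, hδI⟩ := Metric.isOpen_iff.mp hI t₀ ht₀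
  rw [Real.ball_eq_Ioo] at hδI
  set η := min ε δ with hη
  have hη0 : 0 < η := lt_min hε hδ
  have hsub : Set.Ioo (t₀ - η) (t₀ + η) ⊆ Set.Ioo (t₀ - ε) (t₀ + ε) :=
    Set.Ioo_subset_Ioo (by linarith [min_le_left ε δ]) (by linarith [min_le_left ε δ])
  have hsub' : Set.Ioo (t₀ - η) (t₀ + η) ⊆ I := fun t ht =>
    hδI (Set.Ioo_subset_Ioo (by linarith [min_le_right ε δ]) (by linarith [min_le_right ε δ]) ht)
  have hys : ContDiffOn ℝ ∞ y (Set.Ioo (t₀ - η) (t₀ + η)) :=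
    contDiffOn_of_hasDerivAt_comp isOpen_Ioo hV (W := W)
      (fun t ht => by
        change (y t).1 ∈ I
        rw [hfst t (hsub ht)]
        exact hsub' ht)
      (fun t ht => hy t (hsub ht))
  refine ⟨fun t => (y t).2, by simp [hy0], _, hsub', isOpen_Ioo,
    by constructor <;> linarith, contDiff_snd.comp_contDiffOn hys, fun t ht => ?_⟩
  have := (hasFDerivAt_snd (𝕜 := ℝ) (p := y t)).comp_hasDerivAt t (hy t (hsub ht))
  exact this.congr_deriv (by simp [hVdef, hfst t (hsub ht)])

/-- A curve that satisfies `y'' = α y + β y'` stays in every subspace that contains its initial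
position and velocity. -/
theorem eventually_map_eq_zero_of_second_order (L : E →L[ℝ] F) {y y' : ℝ → E} {α β : ℝ → ℝ}
    {t₀ : ℝ} (hy : ∀ᶠ t in 𝓝 t₀, HasDerivAt y (y' t) t)
    (hy' : ∀ᶠ t in 𝓝 t₀, HasDerivAt y' (α t • y t + β t • y' t) t)
    (hα : ContinuousAt α t₀) (hβ : ContinuousAt β t₀) (h0 : L (y t₀) = 0) (h1 : L (y' t₀) = 0) :
    ∀ᶠ t in 𝓝 t₀, L (y t) = 0 := by
  -- The pair (Ly, Ly') solves the same linear system with zero initial data. Continuity of α and β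
  -- at t₀ alone gives a Lipschitz constant near t₀, so uniqueness applies.
  set v : ℝ → F × F → F × F := fun t z => (z.2, α t • z.1 + β t • z.2) with hv
  set K : ℝ := max 1 (|α t₀| + |β t₀| + 1) with hK
  have hK0 : 0 ≤ K := le_trans zero_le_one (le_max_left _ _)
  have hbound : ∀ᶠ t in 𝓝 t₀, |α t| + |β t| ≤ K := by
    have : ContinuousAt (fun t => |α t| + |β t|) t₀ := hα.abs.add hβ.abs
    filter_upwards [this.eventually_lt (continuousAt_const (y := K))
      (lt_of_lt_of_le (by linarith) (le_max_right _ _))] with t ht using ht.le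
  have hlip : ∀ᶠ t in 𝓝 t₀, LipschitzOnWith ⟨K, hK0⟩ (v t) Set.univ := by
    filter_upwards [hbound] with t ht
    refine LipschitzOnWith.of_dist_le_mul fun z _ w _ => ?_
    rw [dist_eq_norm, dist_eq_norm]
    change _ ≤ K * _
    have hz : v t z - v t w = v t (z - w) := by
      simp only [hv, Prod.mk_sub_mk, Prod.fst_sub, Prod.snd_sub]
      congr 1
      module
    rw [hz]
    set u := z - w
    have hu1 : ‖u.1‖ ≤ ‖u‖ := norm_fst_le u
    have hu2 : ‖u.2‖ ≤ ‖u‖ := norm_snd_le u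
    have hu0 : 0 ≤ ‖u‖ := norm_nonneg u
    refine (Prod.norm_def _).le.trans (max_le ?_ ?_)
    · calc ‖u.2‖ ≤ 1 * ‖u‖ := by rw [one_mul]; exact hu2
        _ ≤ K * ‖u‖ := by gcongr; exact le_max_left _ _
    · calc ‖α t • u.1 + β t • u.2‖ ≤ |α t| * ‖u.1‖ + |β t| * ‖u.2‖ := by
            refine (norm_add_le _ _).trans ?_
            rw [norm_smul, norm_smul, Real.norm_eq_abs, Real.norm_eq_abs]
        _ ≤ |α t| * ‖u‖ + |β t| * ‖u‖ := by gcongr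
        _ = (|α t| + |β t|) * ‖u‖ := by ring
        _ ≤ K * ‖u‖ := by gcongr
  have key := ODE_solution_unique_of_eventually (v := v) (s := fun _ => Set.univ)
    (f := fun t => (L (y t), L (y' t))) (g := fun _ => (0, 0)) (t₀ := t₀) hlip
    (by
      filter_upwards [hy, hy'] with t h2 h3
      refine ⟨?_, Set.mem_univ _⟩
      have h4 := (L.hasFDerivAt.comp_hasDerivAt t h2).prodMk (L.hasFDerivAt.comp_hasDerivAt t h3)
      exact h4.congr_deriv (by simp [hv]))
    (Filter.Eventually.of_forall fun t =>
      ⟨(hasDerivAt_const t ((0, 0) : F × F)).congr_deriv (by simp [hv]; rfl), Set.mem_univ _⟩)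
    (by simp [h0, h1])
  exact key.mono fun t ht => (Prod.ext_iff.mp ht).1

/-- Smooth local inverse of a function of one variable with nonzero derivative. -/
theorem exists_local_inverse {φ : ℝ → ℝ} {J : Set ℝ} (hJ : IsOpen J) (hφ : ContDiffOn ℝ ∞ φ J)
    {t₀ : ℝ} (ht₀ : t₀ ∈ J) (h0 : deriv φ t₀ ≠ 0) :
    ∃ (κ : ℝ → ℝ) (W : Set ℝ), IsOpen W ∧ φ t₀ ∈ W ∧ ContDiffOn ℝ ∞ κ W ∧ Set.MapsTo κ W J ∧
      κ (φ t₀) = t₀ ∧ (∀ τ ∈ W, φ (κ τ) = τ) ∧ ∀ᶠ t in 𝓝 t₀, κ (φ t) = t := by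
  have hat : ∀ t ∈ J, ContDiffAt ℝ ∞ φ t := fun t ht => hφ.contDiffAt (hJ.mem_nhds ht)
  have hd : ∀ t ∈ J, HasDerivAt φ (deriv φ t) t :=
    fun t ht => ((hat t ht).differentiableAt (by simp)).hasDerivAt
  have hf : ∀ t ∈ J, ∀ h : deriv φ t ≠ 0,
      HasFDerivAt φ (ContinuousLinearEquiv.unitsEquivAut ℝ (Units.mk0 _ h) : ℝ →L[ℝ] ℝ) t := by
    intro t ht h
    refine (hd t ht).hasFDerivAt.congr_fderiv ?_
    ext
    simp
  have hs := (hat t₀ ht₀).hasStrictFDerivAt' (hf t₀ ht₀ h0) (by simp)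
  set e := hs.toOpenPartialHomeomorph φ with he
  have heφ : ∀ t, e t = φ t := fun t => rfl
  have hsrc : t₀ ∈ e.source := hs.mem_toOpenPartialHomeomorph_source
  -- Smoothness of the inverse at each point needs φ' ≠ 0 at the corresponding preimage, not only at
  -- t₀.
  set J' := J ∩ (deriv φ) ⁻¹' {0}ᶜ with hJ'
  have hJ'o : IsOpen J' :=
    (hφ.continuousOn_deriv_of_isOpen hJ (by simp)).isOpen_inter_preimage hJ isOpen_compl_singleton
  refine ⟨e.symm, e.target ∩ e.symm ⁻¹' J', e.isOpen_inter_preimage_symm hJ'o, ?_, ?_, ?_, ?_, ?_,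
    ?_⟩
  · refine ⟨e.map_source hsrc, ?_⟩
    rw [Set.mem_preimage, ← heφ, e.left_inv hsrc]
    exact ⟨ht₀, h0⟩
  · rintro τ ⟨hτ, hτJ, hτ0⟩
    exact (e.contDiffAt_symm hτ (hf _ hτJ hτ0) (hat _ hτJ)).contDiffWithinAt
  · exact fun τ hτ => hτ.2.1
  · rw [← heφ, e.left_inv hsrc]
  · exact fun τ hτ => e.right_inv hτ.1
  · filter_upwards [e.open_source.mem_nhds hsrc] with t ht using e.left_inv ht

end Calculus

/-! ## Curves in manifolds -/

section Curves

variable {E E' : Type*} [NormedAddCommGroup E] [NormedSpace ℝ E]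
  [NormedAddCommGroup E'] [NormedSpace ℝ E']
  {N : Type*} [TopologicalSpace N] [ChartedSpace E N]
  {N' : Type*} [TopologicalSpace N'] [ChartedSpace E' N']

theorem velocity_comp {f : N → N'} {γ : ℝ → N} {t : ℝ}
    (hf : MDifferentiableAt 𝓘(ℝ, E) 𝓘(ℝ, E') f (γ t))
    (hγ : MDifferentiableAt 𝓘(ℝ, ℝ) 𝓘(ℝ, E) γ t) :
    velocity (EM := E') (fun s => f (γ s)) t =
      mfderiv 𝓘(ℝ, E) 𝓘(ℝ, E') f (γ t) (velocity γ t) :=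
  mfderiv_comp_apply t hf hγ 1

theorem velocity_comp_real {γ : ℝ → N} {φ : ℝ → ℝ} {t : ℝ}
    (hγ : MDifferentiableAt 𝓘(ℝ, ℝ) 𝓘(ℝ, E) γ (φ t)) (hφ : DifferentiableAt ℝ φ t) :
    velocity (EM := E) (fun s => γ (φ s)) t = deriv φ t • velocity (EM := E) γ (φ t) := by
  have h := mfderiv_comp_apply t hγ hφ.mdifferentiableAt (1 : ℝ)
  rw [mfderiv_eq_fderiv] at h
  have h2 : fderiv ℝ φ t 1 = (deriv φ t : ℝ) • (1 : ℝ) := by simp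
  refine h.trans ?_
  refine (congrArg (mfderiv 𝓘(ℝ, ℝ) 𝓘(ℝ, E) γ (φ t)) h2).trans ?_
  exact map_smul (mfderiv 𝓘(ℝ, ℝ) 𝓘(ℝ, E) γ (φ t)) (deriv φ t) (1 : ℝ)

/-- The two tangent spaces have base points that agree only propositionally, so the velocities are
compared in the model space. -/
theorem velocity_congr {γ γ' : ℝ → N} {t : ℝ} (h : γ =ᶠ[𝓝 t] γ') :
    (velocity (EM := E) γ t : E) = velocity (EM := E) γ' t := by
  unfold velocity
  rw [h.mfderiv_eq]
  rfl

theorem isMIntegralCurveAt_of_velocity {γ : ℝ → N} {v : ∀ x : N, TangentSpace 𝓘(ℝ, E) x} {t₀ : ℝ}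
    (h : ∀ᶠ t in 𝓝 t₀, MDifferentiableAt 𝓘(ℝ, ℝ) 𝓘(ℝ, E) γ t ∧ velocity γ t = v (γ t)) :
    IsMIntegralCurveAt (I := 𝓘(ℝ, E)) γ v t₀ := by
  filter_upwards [h] with t ht
  refine ht.1.hasMFDerivAt.congr_mfderiv ?_
  ext
  exact ht.2.trans (one_smul ℝ (v (γ t))).symm

theorem velocity_eq_of_hasMFDerivAt {γ : ℝ → N} {t : ℝ} {w : TangentSpace 𝓘(ℝ, E) (γ t)}
    (h : HasMFDerivAt 𝓘(ℝ, ℝ) 𝓘(ℝ, E) γ t ((1 : ℝ →L[ℝ] ℝ).smulRight w)) :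
    velocity (EM := E) γ t = w := by
  unfold velocity
  rw [h.mfderiv]
  exact one_smul ℝ w

/-- A regular curve has a smooth local left inverse. -/
theorem exists_left_inverse_of_velocity_ne_zero [IsManifold 𝓘(ℝ, E) ∞ N] {γ : ℝ → N} {J : Set ℝ}
    (hJ : IsOpen J)
    (hγ : ContMDiffOn 𝓘(ℝ, ℝ) 𝓘(ℝ, E) ∞ γ J) {t₀ : ℝ} (ht₀ : t₀ ∈ J)
    (h0 : velocity (EM := E) γ t₀ ≠ 0) :
    ∃ (r : N → ℝ) (V : Set N), IsOpen V ∧ γ t₀ ∈ V ∧ ContMDiffOn 𝓘(ℝ, E) 𝓘(ℝ, ℝ) ∞ r V ∧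
      Set.MapsTo r V J ∧ ∀ᶠ t in 𝓝 t₀, r (γ t) = t := by
  set e := extChartAt 𝓘(ℝ, E) (γ t₀) with he
  have hsrc : e.source ∈ 𝓝 (γ t₀) := extChartAt_source_mem_nhds _
  set J' := J ∩ γ ⁻¹' e.source with hJ'
  have hJ'o : IsOpen J' := hγ.continuousOn.isOpen_inter_preimage hJ (isOpen_extChartAt_source _)
  have ht₀' : t₀ ∈ J' := ⟨ht₀, Set.mem_preimage.mpr (mem_of_mem_nhds hsrc)⟩
  have hchart : ContMDiffOn 𝓘(ℝ, E) 𝓘(ℝ, E) ∞ e e.source := by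
    rw [he, extChartAt_source]
    exact contMDiffOn_extChartAt
  have hη : ContDiffOn ℝ ∞ (fun t => e (γ t)) J' :=
    contMDiffOn_iff_contDiffOn.mp
      (hchart.comp (hγ.mono Set.inter_subset_left) fun t ht => ht.2)
  have hvel : velocity (EM := E) γ t₀ = deriv (fun t => e (γ t)) t₀ := by
    have hmd : MDifferentiableAt 𝓘(ℝ, ℝ) 𝓘(ℝ, E) γ t₀ :=
      (hγ.contMDiffAt (hJ.mem_nhds ht₀)).mdifferentiableAt (by simp)
    unfold velocity
    rw [hmd.mfderiv]
    simp only [mfld_simps, fderivWithin_univ]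
    rfl
  -- A functional that does not kill the velocity makes ℓ∘e∘γ a real function with nonzero
  -- derivative at t₀; its inverse composed with ℓ∘e is the left inverse.
  obtain ⟨ℓ, hℓ⟩ := SeparatingDual.exists_ne_zero (R := ℝ)
    (show (deriv (fun t => e (γ t)) t₀ : E) ≠ 0 from fun h => h0 (hvel.trans h))
  have hq : ContDiffOn ℝ ∞ (fun t => ℓ (e (γ t))) J' := ℓ.contDiff.comp_contDiffOn hη
  have hqd : deriv (fun t => ℓ (e (γ t))) t₀ ≠ 0 := by
    have h1 : HasDerivAt (fun t => e (γ t)) (deriv (fun t => e (γ t)) t₀) t₀ :=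
      ((hη.contDiffAt (hJ'o.mem_nhds ht₀')).differentiableAt (by simp)).hasDerivAt
    have h2 : HasDerivAt (fun t => ℓ (e (γ t))) _ t₀ := ℓ.hasFDerivAt.comp_hasDerivAt t₀ h1
    rw [h2.deriv]
    exact hℓ
  obtain ⟨κ, W, hW, hW0, hκ, hκJ, -, -, hκφ⟩ := exists_local_inverse hJ'o hq ht₀' hqd
  have hle : ContMDiffOn 𝓘(ℝ, E) 𝓘(ℝ, ℝ) ∞ (fun x => ℓ (e x)) e.source :=
    ℓ.contMDiff.comp_contMDiffOn hchart
  refine ⟨fun x => κ (ℓ (e x)), e.source ∩ (fun x => ℓ (e x)) ⁻¹' W,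
    hle.continuousOn.isOpen_inter_preimage (isOpen_extChartAt_source _) hW,
    ⟨mem_of_mem_nhds hsrc, hW0⟩, ?_, fun x hx => (hκJ hx.2).1, hκφ⟩
  exact hκ.contMDiffOn.comp (hle.mono Set.inter_subset_left) fun x hx => hx.2

variable [IsManifold 𝓘(ℝ, E) ∞ N] [IsManifold 𝓘(ℝ, E') ∞ N']

/-- The velocity is the tangent map of γ applied to the unit vector field of ℝ. -/
theorem contMDiffOn_velocity {γ : ℝ → N} {J : Set ℝ} (hJ : IsOpen J)
    (hγ : ContMDiffOn 𝓘(ℝ, ℝ) 𝓘(ℝ, E) ∞ γ J) :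
    ContMDiffOn 𝓘(ℝ, ℝ) 𝓘(ℝ, E).tangent ∞
      (fun t => (⟨γ t, velocity γ t⟩ : TangentBundle 𝓘(ℝ, E) N)) J := by
  have h1 := hγ.contMDiffOn_tangentMapWithin (m := ∞) (by simp) hJ.uniqueMDiffOn
  have h2 : ContMDiffOn 𝓘(ℝ, ℝ) 𝓘(ℝ, ℝ).tangent ∞
      (fun t : ℝ => (⟨t, (1 : ℝ)⟩ : TangentBundle 𝓘(ℝ, ℝ) ℝ)) J := by
    intro t _
    refine ContMDiffAt.contMDiffWithinAt ?_
    refine (Bundle.contMDiffAt_section t).mpr ?_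
    simp only [mfld_simps]
    exact contMDiffAt_const
  refine (h1.comp h2 fun t ht => ht).congr fun t ht => ?_
  simp only [Function.comp, tangentMapWithin, velocity]
  rw [mfderivWithin_of_isOpen hJ ht]

theorem contMDiffOn_tangentMap {f : N → N'} {U : Set N} (hU : IsOpen U)
    (hf : ContMDiffOn 𝓘(ℝ, E) 𝓘(ℝ, E') ∞ f U) :
    ContMDiffOn 𝓘(ℝ, E).tangent 𝓘(ℝ, E').tangent ∞ (tangentMap 𝓘(ℝ, E) 𝓘(ℝ, E') f)
      (Bundle.TotalSpace.proj ⁻¹' U) := by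
  refine (hf.contMDiffOn_tangentMapWithin (m := ∞) (by simp) hU.uniqueMDiffOn).congr
    fun v hv => ?_
  simp only [tangentMapWithin, tangentMap]
  rw [mfderivWithin_of_isOpen hU hv]

/-- The velocity of a regular curve extends locally to a smooth vector field. -/
theorem exists_extension_velocity {γ : ℝ → N} {J : Set ℝ} (hJ : IsOpen J)
    (hγ : ContMDiffOn 𝓘(ℝ, ℝ) 𝓘(ℝ, E) ∞ γ J) {t₀ : ℝ} (ht₀ : t₀ ∈ J)
    (h0 : velocity (EM := E) γ t₀ ≠ 0) :
    ∃ (V : Set N) (Y : ∀ x : N, TangentSpace 𝓘(ℝ, E) x), IsOpen V ∧ γ t₀ ∈ V ∧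
      ContMDiffOn 𝓘(ℝ, E) 𝓘(ℝ, E).tangent ∞
        (fun x => (⟨x, Y x⟩ : TangentBundle 𝓘(ℝ, E) N)) V ∧
      ∀ᶠ t in 𝓝 t₀, Y (γ t) = velocity γ t := by
  set e := trivializationAt E (TangentSpace 𝓘(ℝ, E)) (γ t₀) with he
  have hbase : γ t₀ ∈ e.baseSet := FiberBundle.mem_baseSet_trivializationAt' (γ t₀)
  set J' := J ∩ γ ⁻¹' e.baseSet with hJ'
  have hJ'o : IsOpen J' := hγ.continuousOn.isOpen_inter_preimage hJ e.open_baseSet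
  obtain ⟨r, V, hV, hV0, hr, hrJ, hrγ⟩ := exists_left_inverse_of_velocity_ne_zero hJ'o
    (hγ.mono Set.inter_subset_left) ⟨ht₀, hbase⟩ h0
  set w : ℝ → E := fun t => (e ⟨γ t, velocity γ t⟩).2 with hw
  have hws : ContMDiffOn 𝓘(ℝ, ℝ) 𝓘(ℝ, E) ∞ w J' := by
    have h1 := (contMDiffOn_velocity hJ hγ).mono (Set.inter_subset_left (t := γ ⁻¹' e.baseSet))
    exact ((e.contMDiffOn_iff fun t ht => e.mem_source.mpr ht.2).mp h1).2
  -- In the trivialization the velocity depends on time only; replacing time by r(x) extends it off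
  -- the curve.
  refine ⟨V ∩ e.baseSet, fun x => e.symm x (w (r x)), hV.inter e.open_baseSet, ⟨hV0, hbase⟩,
    ?_, ?_⟩
  · refine (e.contMDiffOn_section_iff (hV.inter e.open_baseSet) Set.inter_subset_right).mpr ?_
    refine ((hws.comp hr hrJ).mono Set.inter_subset_left).congr fun x hx => ?_
    have h1 := e.apply_mk_symm hx.2 (w (r x))
    exact (Prod.ext_iff.mp h1).2
  · filter_upwards [hrγ, hJ'o.mem_nhds ⟨ht₀, hbase⟩] with t ht htJ
    rw [ht]
    exact e.symm_proj_apply ⟨γ t, velocity γ t⟩ htJ.2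

/-- Integral curves of smooth vector fields are smooth. -/
theorem exists_contMDiffOn_of_isMIntegralCurveAt {v : ∀ x : N, TangentSpace 𝓘(ℝ, E) x}
    (hv : ContMDiff 𝓘(ℝ, E) 𝓘(ℝ, E).tangent ∞
      (fun x => (⟨x, v x⟩ : TangentBundle 𝓘(ℝ, E) N))) {c : ℝ → N} {t₀ : ℝ}
    (hc : IsMIntegralCurveAt (I := 𝓘(ℝ, E)) c v t₀) :
    ∃ I : Set ℝ, IsOpen I ∧ t₀ ∈ I ∧ ContMDiffOn 𝓘(ℝ, ℝ) 𝓘(ℝ, E) ∞ c I ∧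
      ∀ t ∈ I, velocity (EM := E) c t = v (c t) := by
  set x₀ := c t₀ with hx₀
  set e := extChartAt 𝓘(ℝ, E) x₀ with he
  set τ := trivializationAt E (TangentSpace 𝓘(ℝ, E)) x₀ with hτ
  have hbase : τ.baseSet = e.source := by
    rw [he, extChartAt_source]
    rfl
  -- The vector field read in the chart at x₀, where e ∘ c solves an ordinary autonomous equation.
  set V : E → E := fun z => (τ ⟨e.symm z, v (e.symm z)⟩).2 with hV
  have hVs : ContDiffOn ℝ ∞ V e.target := by
    have h1 := (τ.contMDiffOn_section_baseSet_iff (IB := 𝓘(ℝ, E))).mp (hv.contMDiffOn (n := ∞))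
    refine contMDiffOn_iff_contDiffOn.mp (h1.comp (contMDiffOn_extChartAt_symm x₀) fun z hz => ?_)
    rw [hbase]
    exact e.map_target hz
  have h2 : ∀ᶠ t in 𝓝 t₀, HasDerivAt (e ∘ c) (V ((e ∘ c) t)) t ∧ c t ∈ e.source ∧
      HasMFDerivAt 𝓘(ℝ, ℝ) 𝓘(ℝ, E) c t ((1 : ℝ →L[ℝ] ℝ).smulRight (v (c t))) := by
    have hs : ∀ᶠ t in 𝓝 t₀, c t ∈ e.source :=
      hc.continuousAt.preimage_mem_nhds (extChartAt_source_mem_nhds (I := 𝓘(ℝ, E)) x₀)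
    filter_upwards [hc.eventually_hasDerivAt, hs, hc] with t ht hst hct
    refine ⟨ht.congr_deriv ?_, hst, hct⟩
    simp only [hV, Function.comp_apply]
    rw [e.left_inv hst]
    rfl
  obtain ⟨I, hI, hIo, hI0⟩ := eventually_nhds_iff.mp h2
  have hy : ContDiffOn ℝ ∞ (e ∘ c) I :=
    contDiffOn_of_hasDerivAt_comp hIo hVs (fun t ht => e.map_source (hI t ht).2.1)
      fun t ht => (hI t ht).1
  refine ⟨I, hIo, hI0, ?_, fun t ht => velocity_eq_of_hasMFDerivAt (hI t ht).2.2⟩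
  refine ((contMDiffOn_extChartAt_symm (I := 𝓘(ℝ, E)) (n := ∞) x₀).comp hy.contMDiffOn
    fun t ht => e.map_source (hI t ht).2.1).congr fun t ht => ?_
  exact (e.left_inv (hI t ht).2.1).symm

end Curves

/-! ## Calculus on Cartan bundles -/

section CartanCalculus

variable {n : ℕ} {H : Subgroup (GL (Idx n) ℝ)} {𝔨 : Submodule ℝ (Mat n)}
  {EM ET : Type*} [NormedAddCommGroup EM] [NormedSpace ℝ EM]
  [NormedAddCommGroup ET] [NormedSpace ℝ ET]
  {M : Type*} [TopologicalSpace M] [ChartedSpace EM M]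
  {T : Type*} [TopologicalSpace T] [ChartedSpace ET T]

/-! ### Smoothness of the principal action -/

section Action

variable (B : PrincipalBundle H (EM := EM) (ET := ET) M T)
  {EQ : Type*} [NormedAddCommGroup EQ] [NormedSpace ℝ EQ]
  {Q : Type*} [TopologicalSpace Q] [ChartedSpace EQ Q]

theorem PrincipalBundle.contMDiffOn_act {f : Q → T} {h : Q → H} {U : Set Q}
    (hf : ContMDiffOn 𝓘(ℝ, EQ) 𝓘(ℝ, ET) ∞ f U)
    (hh : ContMDiffOn 𝓘(ℝ, EQ) 𝓘(ℝ, Mat n) ∞ (fun q => ((h q : GL (Idx n) ℝ) : Mat n)) U) :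
    ContMDiffOn 𝓘(ℝ, EQ) 𝓘(ℝ, ET) ∞ (fun q => B.act (f q) (h q)) U := by
  obtain ⟨F, hF, hFact⟩ := B.smooth_act
  refine (hF.comp (hf.prodMk hh) fun q _ => ⟨Set.mem_univ _, h q, rfl⟩).congr fun q _ => ?_
  exact (hFact (f q) (h q)).symm

theorem PrincipalBundle.contMDiff_act_right (h : H) :
    ContMDiff 𝓘(ℝ, ET) 𝓘(ℝ, ET) ∞ (fun u => B.act u h) := by
  rw [← contMDiffOn_univ]
  exact B.contMDiffOn_act (h := fun _ => h) contMDiffOn_id contMDiffOn_const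

theorem PrincipalBundle.mdifferentiableAt_proj (u : T) :
    MDifferentiableAt 𝓘(ℝ, ET) 𝓘(ℝ, EM) B.proj u :=
  (B.contMDiff_proj u).mdifferentiableAt (by simp)

end Action

theorem velocity_comp_real_of_eq {E N : Type*} [NormedAddCommGroup E] [NormedSpace ℝ E]
    [TopologicalSpace N] [ChartedSpace E N] {γ : ℝ → N} {φ : ℝ → ℝ} {t τ : ℝ} (hτ : φ t = τ)
    (hγ : MDifferentiableAt 𝓘(ℝ, ℝ) 𝓘(ℝ, E) γ τ) {r : ℝ} (hφ : HasDerivAt φ r t) :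
    (velocity (EM := E) (fun s => γ (φ s)) t : E) = r • (velocity (EM := E) γ τ : E) := by
  subst hτ
  rw [← hφ.deriv]
  exact velocity_comp_real hγ hφ.differentiableAt

/-! ### Logarithmic derivatives of curves -/

variable [IsManifold 𝓘(ℝ, ET) ∞ T] (C : CartanGeometry 𝔨 H (EM := EM) (ET := ET) M T)

/-- The Cartan connection, with tangent spaces identified with the model space. -/
def CartanGeometry.formE (u : T) : ET →L[ℝ] Mat n := C.form u

/-- The logarithmic derivative of a curve in the Cartan bundle. -/
noncomputable def CartanGeometry.dev (c : ℝ → T) (t : ℝ) : Mat n :=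
  C.form (c t) (velocity c t)

theorem CartanGeometry.dev_congr {c c' : ℝ → T} {t : ℝ} (h : c =ᶠ[𝓝 t] c') :
    C.dev c t = C.dev c' t := by
  change C.formE (c t) (velocity (EM := ET) c t : ET) =
    C.formE (c' t) (velocity (EM := ET) c' t : ET)
  rw [h.eq_of_nhds, velocity_congr h]

theorem CartanGeometry.contDiffOn_dev {c : ℝ → T} {J : Set ℝ} (hJ : IsOpen J)
    (hc : ContMDiffOn 𝓘(ℝ, ℝ) 𝓘(ℝ, ET) ∞ c J) : ContDiffOn ℝ ∞ (C.dev c) J :=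
  contMDiffOn_iff_contDiffOn.mp (C.contMDiff_form.comp_contMDiffOn (contMDiffOn_velocity hJ hc))

theorem CartanGeometry.dev_mem (c : ℝ → T) (t : ℝ) : C.dev c t ∈ 𝔨 := by
  have h : C.dev c t ∈ Set.range (C.form (c t)) := ⟨_, rfl⟩
  rwa [C.range_form] at h

theorem CartanGeometry.form_constantField {X : Mat n} (hX : X ∈ 𝔨) (u : T) :
    C.form u (C.constantField X u) = X :=
  Function.invFun_eq (f := C.form u) (b := X) (by
    have h : X ∈ Set.range (C.form u) := by rw [C.range_form]; exact hX
    exact h)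

theorem CartanGeometry.dev_comp_real {c : ℝ → T} {φ : ℝ → ℝ} {t : ℝ}
    (hc : MDifferentiableAt 𝓘(ℝ, ℝ) 𝓘(ℝ, ET) c (φ t)) (hφ : DifferentiableAt ℝ φ t) :
    C.dev (fun s => c (φ s)) t = deriv φ t • C.dev c (φ t) := by
  unfold CartanGeometry.dev
  rw [velocity_comp_real hc hφ, map_smul]

/-- The logarithmic derivative of a product of a curve in the bundle with one in the group. -/
theorem CartanGeometry.dev_act {c : ℝ → T} {h : ℝ → H} {J : Set ℝ} (hJ : IsOpen J)
    (hc : ContMDiffOn 𝓘(ℝ, ℝ) 𝓘(ℝ, ET) ∞ c J)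
    (hh : ContDiffOn ℝ ∞ (fun t => ((h t : GL (Idx n) ℝ) : Mat n)) J) {t : ℝ} (ht : t ∈ J) :
    C.dev (fun s => C.act (c s) (h s)) t =
      (((h t : GL (Idx n) ℝ)⁻¹ : GL (Idx n) ℝ) : Mat n) *
        (C.dev c t * ((h t : GL (Idx n) ℝ) : Mat n) +
          deriv (fun t => ((h t : GL (Idx n) ℝ) : Mat n)) t) := by
  set B := deriv (fun t => ((h t : GL (Idx n) ℝ) : Mat n)) t with hB
  have hhd : HasDerivAt (fun t => ((h t : GL (Idx n) ℝ) : Mat n)) B t :=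
    ((hh.contDiffAt (hJ.mem_nhds ht)).differentiableAt (by simp)).hasDerivAt
  -- Separating the two time variables turns the velocity of the diagonal curve into the sum of two
  -- partial velocities. Equivariance evaluates one, the fundamental vector fields the other.
  set G : ℝ × ℝ → T := fun z => C.act (c z.1) (h z.2) with hG
  have hGs : ContMDiffOn 𝓘(ℝ, ℝ × ℝ) 𝓘(ℝ, ET) ∞ G (J ×ˢ J) :=
    C.contMDiffOn_act (f := fun z : ℝ × ℝ => c z.1) (h := fun z : ℝ × ℝ => h z.2)
      (hc.comp contDiff_fst.contMDiff.contMDiffOn fun z hz => hz.1)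
      (hh.contMDiffOn.comp contDiff_snd.contMDiff.contMDiffOn fun z hz => hz.2)
  have hGd : MDifferentiableAt 𝓘(ℝ, ℝ × ℝ) 𝓘(ℝ, ET) G (t, t) :=
    (hGs.contMDiffAt ((hJ.prod hJ).mem_nhds ⟨ht, ht⟩)).mdifferentiableAt (by simp)
  have hvel : ∀ (q : ℝ → ℝ × ℝ) (w : ℝ × ℝ), q t = (t, t) → HasDerivAt q w t →
      (velocity (EM := ET) (fun s => G (q s)) t : ET) =
        (show ℝ × ℝ →L[ℝ] ET from mfderiv 𝓘(ℝ, ℝ × ℝ) 𝓘(ℝ, ET) G (t, t)) w := by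
    intro q w hq hqd
    have h1 := velocity_comp (f := G) (γ := q) (t := t) (by rw [hq]; exact hGd)
      hqd.differentiableAt.mdifferentiableAt
    rw [hq] at h1
    refine h1.trans ?_
    have h2 : (velocity (EM := ℝ × ℝ) q t : ℝ × ℝ) = w := by
      unfold velocity
      rw [mfderiv_eq_fderiv]
      exact hqd.hasFDerivAt.fderiv ▸ one_smul ℝ w
    exact congrArg _ h2
  have hsum : (velocity (EM := ET) (fun s => C.act (c s) (h s)) t : ET) =
      (velocity (EM := ET) (fun s => C.act (c s) (h t)) t : ET) +
      (velocity (EM := ET) (fun s => C.act (c t) (h s)) t : ET) := by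
    have e1 := hvel (fun s => (s, s)) (1, 1) rfl ((hasDerivAt_id t).prodMk (hasDerivAt_id t))
    have e2 := hvel (fun s => (s, t)) (1, 0) rfl ((hasDerivAt_id t).prodMk (hasDerivAt_const t t))
    have e3 := hvel (fun s => (t, s)) (0, 1) rfl ((hasDerivAt_const t t).prodMk (hasDerivAt_id t))
    refine e1.trans ((?_ : _ = _).trans (congrArg₂ (· + ·) e2 e3).symm)
    refine Eq.trans ?_ (map_add _ _ _)
    congr 1
    simp
  have hfst : C.formE (C.act (c t) (h t)) (velocity (EM := ET) (fun s => C.act (c s) (h t)) t : ET)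
      = (((h t : GL (Idx n) ℝ)⁻¹ : GL (Idx n) ℝ) : Mat n) * C.dev c t *
        ((h t : GL (Idx n) ℝ) : Mat n) := by
    have h1 := velocity_comp (f := fun u => C.act u (h t)) (γ := c) (t := t)
      ((C.contMDiff_act_right (h t) (c t)).mdifferentiableAt (by simp))
      ((hc.contMDiffAt (hJ.mem_nhds ht)).mdifferentiableAt (by simp))
    rw [h1]
    exact C.form_act (c t) (h t) (velocity c t)
  have hsnd : C.formE (C.act (c t) (h t)) (velocity (EM := ET) (fun s => C.act (c t) (h s)) t : ET)
      = (((h t : GL (Idx n) ℝ)⁻¹ : GL (Idx n) ℝ) : Mat n) * B := by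
    set u := C.act (c t) (h t) with hu
    -- Recentred so that k 0 = 1, as `form_fundamental` requires, now at the base point c(t)·h(t).
    set k : ℝ → H := fun r => (h t)⁻¹ * h (t + r) with hk
    have hk0 : k 0 = 1 := by simp [hk]
    have hcoe : ∀ r, ((k r : GL (Idx n) ℝ) : Mat n) =
        (((h t : GL (Idx n) ℝ)⁻¹ : GL (Idx n) ℝ) : Mat n) * ((h (t + r) : GL (Idx n) ℝ) : Mat n) :=
      fun r => by simp [hk]
    have hkd : HasDerivAt (fun r => ((k r : GL (Idx n) ℝ) : Mat n))
        ((((h t : GL (Idx n) ℝ)⁻¹ : GL (Idx n) ℝ) : Mat n) * B) 0 := by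
      simp_rw [hcoe]
      refine HasDerivAt.const_mul _ ?_
      have := HasDerivAt.scomp (𝕜 := ℝ) (𝕜' := ℝ) 0
        (show HasDerivAt (fun t => ((h t : GL (Idx n) ℝ) : Mat n)) B (t + 0) by
          rw [add_zero]; exact hhd) ((hasDerivAt_id (0 : ℝ)).const_add t)
      exact this.congr_deriv (one_smul ℝ B)
    have hks : ContMDiffOn 𝓘(ℝ, ℝ) 𝓘(ℝ, ET) ∞ (fun r => C.act u (k r)) ((fun r => t + r) ⁻¹' J) := by
      refine C.contMDiffOn_act (f := fun _ => u) contMDiffOn_const ?_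
      simp_rw [hcoe]
      refine ContDiffOn.contMDiffOn ?_
      exact contDiffOn_const.mul
        (hh.comp (contDiff_const.add contDiff_id).contDiffOn fun r hr => hr)
    have hkm : MDifferentiableAt 𝓘(ℝ, ℝ) 𝓘(ℝ, ET) (fun r => C.act u (k r)) 0 := by
      refine (hks.contMDiffAt ?_).mdifferentiableAt (by simp)
      exact (hJ.preimage (continuous_const.add continuous_id)).mem_nhds (by simpa using ht)
    have h1 := C.form_fundamental u k _ hk0 hkd
    have h2 : (fun s => C.act (c t) (h s)) = fun s => C.act u (k (s - t)) := by
      funext s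
      rw [hu, ← C.act_mul]
      simp [hk]
    have h3 := velocity_comp_real_of_eq (γ := fun r => C.act u (k r)) (φ := fun s => s - t) (t := t)
      (sub_self t) hkm ((hasDerivAt_id t).sub_const t)
    rw [one_smul] at h3
    rw [h2, h3]
    have h4 : C.act u (k 0) = u := by rw [hk0, C.act_one]
    change C.formE (C.act u (k 0)) (velocity (EM := ET) (fun r => C.act u (k r)) 0 : ET) = _ at h1
    rwa [h4] at h1
  change C.formE (C.act (c t) (h t)) (velocity (EM := ET) (fun s => C.act (c s) (h s)) t : ET) = _
  rw [hsum]
  refine ((C.formE _).map_add _ _).trans ((congrArg₂ (· + ·) hfst hsnd).trans ?_)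
  rw [mul_add, mul_assoc]

end CartanCalculus

/-! ### Local sections and smoothness of constant vector fields -/

section ConstantFields

/-- A map into a space of linear maps on a finite-dimensional space is smooth if all its
evaluations are. -/
theorem contMDiffOn_of_apply {E F G : Type*} [NormedAddCommGroup E] [NormedSpace ℝ E]
    [NormedAddCommGroup F] [NormedSpace ℝ F] [FiniteDimensional ℝ F]
    [NormedAddCommGroup G] [NormedSpace ℝ G] {N : Type*} [TopologicalSpace N] [ChartedSpace E N]
    {f : N → F →L[ℝ] G} {s : Set N}
    (h : ∀ w, ContMDiffOn 𝓘(ℝ, E) 𝓘(ℝ, G) ∞ (fun x => f x w) s) :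
    ContMDiffOn 𝓘(ℝ, E) 𝓘(ℝ, F →L[ℝ] G) ∞ f s := by
  let e₁ := ContinuousLinearEquiv.ofFinrankEq (𝕜 := ℝ) (E := F)
    (F := Fin (Module.finrank ℝ F) → ℝ) (by simp)
  let e₂ := (e₁.arrowCongr (1 : G ≃L[ℝ] G)).trans
    (ContinuousLinearEquiv.piRing (𝕜 := ℝ) (E := G) (Fin (Module.finrank ℝ F)))
  have h1 : ContMDiffOn 𝓘(ℝ, E) 𝓘(ℝ, Fin (Module.finrank ℝ F) → G) ∞ (fun x => e₂ (f x)) s :=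
    contMDiffOn_pi_space.mpr fun i => h _
  refine (e₂.symm.contDiff.contMDiff.comp_contMDiffOn h1).congr fun x _ => ?_
  exact (e₂.symm_apply_apply (f x)).symm

variable {n : ℕ} {H : Subgroup (GL (Idx n) ℝ)} {𝔨 : Submodule ℝ (Mat n)}
  {EM ET : Type*} [NormedAddCommGroup EM] [NormedSpace ℝ EM]
  [NormedAddCommGroup ET] [NormedSpace ℝ ET]
  {M : Type*} [TopologicalSpace M] [ChartedSpace EM M]
  {T : Type*} [TopologicalSpace T] [ChartedSpace ET T]

/-- Around each point there is a smooth local section, and every smooth curve over its domain is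
the product of the section with a smooth curve in the structure group. -/
theorem PrincipalBundle.exists_section (B : PrincipalBundle H (EM := EM) (ET := ET) M T) (x : M) :
    ∃ (U : Set M) (s : M → T), IsOpen U ∧ x ∈ U ∧ ContMDiffOn 𝓘(ℝ, EM) 𝓘(ℝ, ET) ∞ s U ∧
      (∀ y ∈ U, B.proj (s y) = y) ∧ ∀ (c : ℝ → T) (J : Set ℝ),
        ContMDiffOn 𝓘(ℝ, ℝ) 𝓘(ℝ, ET) ∞ c J → (∀ t ∈ J, B.proj (c t) ∈ U) →
        ∃ h : ℝ → H, ContDiffOn ℝ ∞ (fun t => ((h t : GL (Idx n) ℝ) : Mat n)) J ∧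
          ∀ t ∈ J, B.act (s (B.proj (c t))) (h t) = c t := by
  obtain ⟨U, s, τ, hU, hx, hs, hps, hτ, hact⟩ := B.locally_trivial x
  refine ⟨U, s, hU, hx, hs, hps, fun c J hc hcU => ?_⟩
  have hex : ∀ t, ∃ h : H, t ∈ J → ((h : GL (Idx n) ℝ) : Mat n) = τ (c t) ∧
      B.act (s (B.proj (c t))) h = c t := by
    intro t
    by_cases ht : t ∈ J
    · obtain ⟨h, hh⟩ := hact (c t) (hcU t ht)
      exact ⟨h, fun _ => hh⟩
    · exact ⟨1, fun h => absurd h ht⟩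
  choose h hh using hex
  refine ⟨h, ?_, fun t ht => (hh t ht).2⟩
  exact (contMDiffOn_iff_contDiffOn.mp (hτ.comp hc hcU)).congr fun t ht => (hh t ht).1

variable [FiniteDimensional ℝ ET] [IsManifold 𝓘(ℝ, ET) ∞ T]
  (C : CartanGeometry 𝔨 H (EM := EM) (ET := ET) M T)

/-- Constant vector fields are smooth. -/
theorem CartanGeometry.contMDiff_constantField {X : Mat n} (hX : X ∈ 𝔨) :
    ContMDiff 𝓘(ℝ, ET) 𝓘(ℝ, ET).tangent ∞
      (fun u => (⟨u, C.constantField X u⟩ : TangentBundle 𝓘(ℝ, ET) T)) := by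
  intro u₀
  set e := trivializationAt ET (TangentSpace 𝓘(ℝ, ET)) u₀ with he
  have hbase : u₀ ∈ e.baseSet := FiberBundle.mem_baseSet_trivializationAt' u₀
  set Φ : T → ET →L[ℝ] Mat n := fun u => (C.form u).comp (e.symmL ℝ u) with hΦ
  have hΦs : ContMDiffOn 𝓘(ℝ, ET) 𝓘(ℝ, ET →L[ℝ] Mat n) ∞ Φ e.baseSet := by
    refine contMDiffOn_of_apply fun w => ?_
    have h1 : ContMDiffOn 𝓘(ℝ, ET) 𝓘(ℝ, ET).tangent ∞
        (fun u => (⟨u, e.symm u w⟩ : TangentBundle 𝓘(ℝ, ET) T)) e.baseSet := by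
      refine e.contMDiffOn_section_baseSet_iff.mpr ?_
      refine (contMDiffOn_const (c := w)).congr fun u hu => ?_
      exact (Prod.ext_iff.mp (e.apply_mk_symm hu w)).2
    refine (C.contMDiff_form.comp_contMDiffOn h1).congr fun u hu => ?_
    rw [hΦ]
    simp only [ContinuousLinearMap.comp_apply]
    rw [e.symmL_apply hu]
    rfl
  -- The connection maps into all matrices but has range 𝔨 only. Composing with a left inverse at u₀
  -- gives endomorphisms K(u), invertible near u₀, and the constant field is K(u)⁻¹(LX) in the
  -- trivialization.
  obtain ⟨L, hL⟩ : ∃ L : Mat n →L[ℝ] ET, L.comp (Φ u₀) = ContinuousLinearMap.id ℝ ET := by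
    have hinj : Function.Injective (Φ u₀) := by
      refine (C.injective_form u₀).comp ?_
      intro v w hvw
      exact (e.continuousLinearMapAt_symmL hbase v).symm.trans
        ((congrArg (e.continuousLinearMapAt ℝ u₀) hvw).trans
          (e.continuousLinearMapAt_symmL hbase w))
    obtain ⟨L, hL⟩ := LinearMap.exists_leftInverse_of_injective (Φ u₀ : ET →ₗ[ℝ] Mat n)
      (LinearMap.ker_eq_bot.mpr hinj)
    refine ⟨LinearMap.toContinuousLinearMap L, ?_⟩
    ext v
    exact LinearMap.congr_fun hL v
  set K : T → ET →L[ℝ] ET := fun u => L.comp (Φ u) with hK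
  have hKs : ContMDiffOn 𝓘(ℝ, ET) 𝓘(ℝ, ET →L[ℝ] ET) ∞ K e.baseSet :=
    (ContinuousLinearMap.contMDiff (L := ContinuousLinearMap.compL ℝ ET (Mat n) ET L)).comp_contMDiffOn
      hΦs
  have hKat : ContMDiffAt 𝓘(ℝ, ET) 𝓘(ℝ, ET →L[ℝ] ET) ∞ K u₀ :=
    hKs.contMDiffAt (e.open_baseSet.mem_nhds hbase)
  have hunit : ∀ᶠ u in 𝓝 u₀, IsUnit (K u) := by
    have h1 : K u₀ ∈ {A : ET →L[ℝ] ET | IsUnit A} := by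
      rw [hK]
      simp only [hL]
      exact isUnit_one
    exact hKat.continuousAt.eventually_mem (Units.isOpen.mem_nhds h1)
  refine (Bundle.contMDiffAt_section u₀).mpr ?_
  have hinv : ContMDiffAt 𝓘(ℝ, ET) 𝓘(ℝ, ET →L[ℝ] ET) ∞ (fun u => Ring.inverse (K u)) u₀ := by
    obtain ⟨k, hk⟩ := hunit.self_of_nhds
    have h1 := contDiffAt_ringInverse (n := ∞) ℝ k
    rw [hk] at h1
    exact h1.contMDiffAt.comp u₀ hKat
  have happ : ContMDiffAt 𝓘(ℝ, ET) 𝓘(ℝ, ET) ∞ (fun u => Ring.inverse (K u) (L X)) u₀ :=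
    hinv.clm_apply contMDiffAt_const
  refine happ.congr_of_eventuallyEq ?_
  filter_upwards [hunit, e.open_baseSet.mem_nhds hbase] with u hu hub
  set w := (e ⟨u, C.constantField X u⟩).2 with hw
  have h1 : Φ u w = X := by
    have h2 : e.symmL ℝ u w = C.constantField X u := by
      rw [e.symmL_apply hub]
      exact e.symm_proj_apply ⟨u, C.constantField X u⟩ hub
    rw [hΦ]
    simp only [ContinuousLinearMap.comp_apply]
    rw [h2, C.form_constantField hX]
  have h3 : K u w = L X := by
    rw [hK]
    simp only [ContinuousLinearMap.comp_apply]
    rw [h1]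
  rw [← h3]
  have h4 := Ring.inverse_mul_cancel (K u) hu
  exact (DFunLike.congr_fun h4 w).symm

end ConstantFields

section ProjectiveCartan

variable {n : ℕ}
  {EM ET : Type*} [NormedAddCommGroup EM] [NormedSpace ℝ EM]
  [NormedAddCommGroup ET] [NormedSpace ℝ ET]
  {M : Type*} [TopologicalSpace M] [ChartedSpace EM M]
  {T : Type*} [TopologicalSpace T] [ChartedSpace ET T] [IsManifold 𝓘(ℝ, ET) ∞ T]
  (C : CartanGeometry (slAlg n) (parSl n) (EM := EM) (ET := ET) M T)

/-! ## Vertical vectors and the coframe of a section -/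

theorem parSl_mulVec_firstVec (h : parSl n) : ∃ a : ℝ, 0 < a ∧
    ((h : GL (Idx n) ℝ) : Mat n).mulVec (firstVec n) = a • firstVec n :=
  ((mem_parSl_iff _).mp h.2).2

/-- Tangent vectors on which the Cartan connection takes values in the Lie algebra of `P̃` are
vertical. -/
theorem CartanGeometry.mfderiv_proj_eq_zero {u : T} {ξ : TangentSpace 𝓘(ℝ, ET) u} {b : ℝ}
    (hξ : (C.form u ξ).mulVec (firstVec n) = b • firstVec n) :
    mfderiv 𝓘(ℝ, ET) 𝓘(ℝ, EM) C.proj u ξ = 0 := by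
  have hmem : C.form u ξ ∈ slAlg n := by
    have h : C.form u ξ ∈ Set.range (C.form u) := ⟨ξ, rfl⟩
    rwa [C.range_form] at h
  obtain ⟨h, h0, hd⟩ := exists_curve_parSl hmem hξ
  have h1 := C.form_fundamental u h _ h0 hd
  have hu : C.act u (h 0) = u := by rw [h0, C.act_one]
  set f : ℝ → T := fun t => C.act u (h t) with hf
  -- The form is injective, so ξ is the velocity of a curve inside one fibre.
  have hvel : (velocity (EM := ET) f 0 : ET) = ξ := by
    refine C.injective_form u ?_
    refine Eq.trans ?_ h1
    change C.formE u (velocity (EM := ET) f 0 : ET) =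
      C.formE (C.act u (h 0)) (velocity (EM := ET) f 0 : ET)
    rw [hu]
  -- Only a derivative of the matrix curve at 0 is recorded, so differentiability of the orbit curve
  -- is not at hand. Without it, `mfderiv` is zero by convention and `hvel` forces ξ = 0.
  by_cases hm : MDifferentiableAt 𝓘(ℝ, ℝ) 𝓘(ℝ, ET) f 0
  · have h2 := velocity_comp (f := C.proj) (γ := f) (t := 0) (C.mdifferentiableAt_proj _) hm
    have h3 : (fun t => C.proj (f t)) = fun _ => C.proj u := funext fun t => C.proj_act u (h t)
    have h4 : (velocity (EM := EM) (fun t => C.proj (f t)) 0 : EM) = 0 := by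
      rw [h3]
      unfold velocity
      rw [mfderiv_const]
      rfl
    have h5 : ∀ v : T, v = u → (show ET →L[ℝ] EM from mfderiv 𝓘(ℝ, ET) 𝓘(ℝ, EM) C.proj v) ξ =
        (show ET →L[ℝ] EM from mfderiv 𝓘(ℝ, ET) 𝓘(ℝ, EM) C.proj u) ξ := by
      rintro v rfl
      rfl
    refine (h5 (f 0) hu).symm.trans ?_
    refine Eq.trans ?_ (h2.symm.trans h4)
    exact congrArg _ hvel.symm
  · have h6 : (ξ : ET) = 0 := by
      rw [← hvel]
      unfold velocity
      rw [mfderiv_zero_of_not_mdifferentiableAt hm]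
      rfl
    exact (congrArg _ h6).trans (map_zero (mfderiv 𝓘(ℝ, ET) 𝓘(ℝ, EM) C.proj u))

variable [FiniteDimensional ℝ ET]

/-- On vertical tangent vectors the Cartan connection takes values in the Lie algebra of `P̃`. -/
theorem CartanGeometry.form_of_mfderiv_proj_eq_zero {u : T} {ξ : TangentSpace 𝓘(ℝ, ET) u}
    (hξ : mfderiv 𝓘(ℝ, ET) 𝓘(ℝ, EM) C.proj u ξ = 0) :
    ∃ b : ℝ, (C.form u ξ).mulVec (firstVec n) = b • firstVec n := by
  have hX : C.form u ξ ∈ slAlg n := by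
    have h : C.form u ξ ∈ Set.range (C.form u) := ⟨ξ, rfl⟩
    rwa [C.range_form] at h
  have hV := C.contMDiff_constantField hX
  -- A flow line with velocity ξ at u is compared with the section over its projection: c =
  -- s(p∘c)·h.
  obtain ⟨c, hc0, hc⟩ := exists_isMIntegralCurveAt_of_contMDiffAt_boundaryless (I := 𝓘(ℝ, ET)) 0
    ((hV u).of_le (by simp : (1 : WithTop ℕ∞) ≤ ∞))
  obtain ⟨I, hI, h0I, hcs, hcv⟩ := exists_contMDiffOn_of_isMIntegralCurveAt hV hc
  have hcξ : (velocity (EM := ET) c 0 : ET) = ξ := by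
    refine C.injective_form u ?_
    have h1 := C.form_constantField hX (c 0)
    rw [← hcv 0 h0I] at h1
    change C.formE (c 0) (velocity (EM := ET) c 0 : ET) = _ at h1
    rwa [hc0] at h1
  obtain ⟨U, s, hU, huU, hs, hps, hlift⟩ := C.exists_section (C.proj u)
  set J := I ∩ (fun t => C.proj (c t)) ⁻¹' U with hJ
  have hpc : ContMDiffOn 𝓘(ℝ, ℝ) 𝓘(ℝ, EM) ∞ (fun t => C.proj (c t)) I :=
    C.contMDiff_proj.comp_contMDiffOn hcs
  have hJo : IsOpen J := hpc.continuousOn.isOpen_inter_preimage hI hU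
  have h0J : (0 : ℝ) ∈ J := ⟨h0I, by change C.proj (c 0) ∈ U; rwa [hc0]⟩
  obtain ⟨h, hh, hact⟩ := hlift c J (hcs.mono Set.inter_subset_left) fun t ht => ht.2
  have hscs : ContMDiffOn 𝓘(ℝ, ℝ) 𝓘(ℝ, ET) ∞ (fun t => s (C.proj (c t))) J :=
    hs.comp (hpc.mono Set.inter_subset_left) fun t ht => ht.2
  have h2 := C.dev_act hJo hscs hh h0J
  -- As ξ projects to zero, the section contributes nothing at time 0, and the form of ξ is h⁻¹h'
  -- there.
  have h3 : C.dev (fun t => s (C.proj (c t))) 0 = 0 := by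
    have hcd : MDifferentiableAt 𝓘(ℝ, ℝ) 𝓘(ℝ, ET) c 0 :=
      (hcs.contMDiffAt (hI.mem_nhds h0I)).mdifferentiableAt (by simp)
    have hpd : MDifferentiableAt 𝓘(ℝ, ℝ) 𝓘(ℝ, EM) (fun t => C.proj (c t)) 0 :=
      (hpc.contMDiffAt (hI.mem_nhds h0I)).mdifferentiableAt (by simp)
    have h4 : (velocity (EM := EM) (fun t => C.proj (c t)) 0 : EM) = 0 := by
      rw [velocity_comp (C.mdifferentiableAt_proj _) hcd]
      have h5 : ∀ v : T, v = u → (show ET →L[ℝ] EM from mfderiv 𝓘(ℝ, ET) 𝓘(ℝ, EM) C.proj v) ξ =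
          (show ET →L[ℝ] EM from mfderiv 𝓘(ℝ, ET) 𝓘(ℝ, EM) C.proj u) ξ := by
        rintro v rfl
        rfl
      exact (congrArg _ hcξ).trans ((h5 _ hc0).trans hξ)
    unfold CartanGeometry.dev
    rw [velocity_comp (f := s) (γ := fun t => C.proj (c t))
      ((hs.contMDiffAt (hU.mem_nhds h0J.2)).mdifferentiableAt (by simp)) hpd]
    have h6 : mfderiv 𝓘(ℝ, EM) 𝓘(ℝ, ET) s (C.proj (c 0))
        (velocity (EM := EM) (fun t => C.proj (c t)) 0) = 0 :=
      (congrArg _ h4).trans (map_zero _)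
    rw [h6, map_zero]
  have h7 : C.dev (fun t => C.act (s (C.proj (c t))) (h t)) 0 = C.form u ξ := by
    have h8 : (fun t => C.act (s (C.proj (c t))) (h t)) =ᶠ[𝓝 0] c :=
      Filter.eventuallyEq_of_mem (hJo.mem_nhds h0J) hact
    rw [C.dev_congr h8]
    change C.formE (c 0) (velocity (EM := ET) c 0 : ET) = C.formE u ξ
    rw [hc0, hcξ]
  rw [h7, h3, zero_mul, zero_add] at h2
  rw [h2]
  set m : ℝ → Mat n := fun t => ((h t : GL (Idx n) ℝ) : Mat n) with hm
  have hmd : HasDerivAt m (deriv m 0) 0 :=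
    ((hh.contDiffAt (hJo.mem_nhds h0J)).differentiableAt (by simp)).hasDerivAt
  -- The entries below the corner of the first column vanish identically on P̃, hence so do their
  -- derivatives.
  obtain ⟨a', ha'⟩ : ∃ a' : ℝ, (deriv m 0).mulVec (firstVec n) = a' • firstVec n := by
    rw [mem_span_firstVec]
    intro i
    rw [mulVec_firstVec]
    have h9 : HasDerivAt (fun t => m t (Sum.inr i) (Sum.inl ()))
        (deriv m 0 (Sum.inr i) (Sum.inl ())) 0 := by
      have h11 := (entryL (Sum.inr i) (Sum.inl ())).hasFDerivAt.comp_hasDerivAt 0 hmd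
      exact h11
    have h10 : (fun t => m t (Sum.inr i) (Sum.inl ())) = fun _ => 0 := by
      funext t
      obtain ⟨a, -, ha⟩ := parSl_mulVec_firstVec (h t)
      rw [← mulVec_firstVec (m t) (Sum.inr i), hm]
      simp only [ha]
      simp [firstVec_inr]
    rw [h10] at h9
    exact h9.unique (hasDerivAt_const 0 0)
  obtain ⟨a, -, ha⟩ := parSl_mulVec_firstVec (h 0)⁻¹
  refine ⟨a' * a, ?_⟩
  rw [← Matrix.mulVec_mulVec, ha', Matrix.mulVec_smul, mul_smul]
  exact congrArg _ ha

end ProjectiveCartan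

section SectionConnections

variable {n : ℕ}
  {EM ET : Type*} [NormedAddCommGroup EM] [NormedSpace ℝ EM]
  [NormedAddCommGroup ET] [NormedSpace ℝ ET]
  {M : Type*} [TopologicalSpace M] [ChartedSpace EM M]
  {T : Type*} [TopologicalSpace T] [ChartedSpace ET T] [IsManifold 𝓘(ℝ, ET) ∞ T]
  (C : CartanGeometry (slAlg n) (parSl n) (EM := EM) (ET := ET) M T)

/-! ## The connection defined by a section -/

/-- The form `coframe` as a continuous linear map. -/
noncomputable def coframeL (s : M → T) (x : M) : TangentSpace 𝓘(ℝ, EM) x →L[ℝ] Mat n :=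
  (gradedProj slLevel (-1)).comp ((C.form (s x)).comp (mfderiv 𝓘(ℝ, EM) 𝓘(ℝ, ET) s x))

theorem coframeL_apply (s : M → T) (x : M) (ξ : TangentSpace 𝓘(ℝ, EM) x) :
    coframeL C s x ξ = coframe C s x ξ := rfl

/-- The form `connForm` as a continuous linear map. -/
noncomputable def connFormL (s : M → T) (x : M) : TangentSpace 𝓘(ℝ, EM) x →L[ℝ] Mat n :=
  (gradedProj slLevel 0).comp ((C.form (s x)).comp (mfderiv 𝓘(ℝ, EM) 𝓘(ℝ, ET) s x))

variable {C} {s : M → T} {U : Set M}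

theorem mfderiv_proj_section (hU : IsOpen U) (hs : ContMDiffOn 𝓘(ℝ, EM) 𝓘(ℝ, ET) ∞ s U)
    (hps : ∀ x ∈ U, C.proj (s x) = x) {x : M} (hx : x ∈ U) (ξ : TangentSpace 𝓘(ℝ, EM) x) :
    (mfderiv 𝓘(ℝ, ET) 𝓘(ℝ, EM) C.proj (s x) (mfderiv 𝓘(ℝ, EM) 𝓘(ℝ, ET) s x ξ) : EM) = ξ := by
  have h1 := mfderiv_comp_apply (I' := 𝓘(ℝ, ET)) x (C.mdifferentiableAt_proj (s x))
    ((hs.contMDiffAt (hU.mem_nhds hx)).mdifferentiableAt (by simp)) ξ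
  refine h1.symm.trans ?_
  have h2 : (C.proj ∘ s) =ᶠ[𝓝 x] id := Filter.eventuallyEq_of_mem (hU.mem_nhds hx) hps
  rw [h2.mfderiv_eq, mfderiv_id]
  rfl

/-- If ξ is in the kernel, then s_*ξ is vertical, so ξ = p_*s_*ξ = 0. -/
theorem coframe_injective (hU : IsOpen U) (hs : ContMDiffOn 𝓘(ℝ, EM) 𝓘(ℝ, ET) ∞ s U)
    (hps : ∀ x ∈ U, C.proj (s x) = x) {x : M} (hx : x ∈ U) :
    Function.Injective (coframeL C s x) := by
  refine (injective_iff_map_eq_zero _).mpr fun ξ hξ => ?_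
  obtain ⟨b, hb⟩ := (gradedPart_neg_one_eq_zero_iff _).mp hξ
  have h1 := C.mfderiv_proj_eq_zero (u := s x) hb
  exact (mfderiv_proj_section hU hs hps hx ξ).symm.trans h1

theorem coframe_mem (x : M) (ξ : TangentSpace 𝓘(ℝ, EM) x) :
    gradedPart slLevel (-1) (coframe C s x ξ) = coframe C s x ξ :=
  gradedPart_neg_one_gradedPart _

/-- Project the vector ω̃⁻¹(Z) at s(x) to a tangent vector ξ. Then s_*ξ and ω̃⁻¹(Z) differ by a
vertical vector and have the same component of degree −1. -/
theorem coframe_surjective [FiniteDimensional ℝ ET] (hU : IsOpen U)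
    (hs : ContMDiffOn 𝓘(ℝ, EM) 𝓘(ℝ, ET) ∞ s U)
    (hps : ∀ x ∈ U, C.proj (s x) = x) {x : M} (hx : x ∈ U) {Z : Mat n}
    (hZ : gradedPart slLevel (-1) Z = Z) : ∃ ξ, coframe C s x ξ = Z := by
  have hZs : Z ∈ slAlg n := hZ ▸ gradedPart_neg_one_mem_slAlg Z
  set ζ := C.constantField Z (s x) with hζ
  have hform := C.form_constantField hZs (s x)
  let ξ : TangentSpace 𝓘(ℝ, EM) x := (mfderiv 𝓘(ℝ, ET) 𝓘(ℝ, EM) C.proj (s x) ζ : EM)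
  refine ⟨ξ, ?_⟩
  have h1 : mfderiv 𝓘(ℝ, ET) 𝓘(ℝ, EM) C.proj (s x)
      (mfderiv 𝓘(ℝ, EM) 𝓘(ℝ, ET) s x ξ - ζ) = 0 := by
    rw [map_sub]
    exact sub_eq_zero.mpr (mfderiv_proj_section hU hs hps hx ξ)
  have h2 := (gradedPart_neg_one_eq_zero_iff _).mpr (C.form_of_mfderiv_proj_eq_zero h1)
  rw [map_sub, hform] at h2
  change gradedProj slLevel (-1) _ = 0 at h2
  rw [map_sub, sub_eq_zero] at h2
  exact h2.trans hZ

variable [IsManifold 𝓘(ℝ, EM) ∞ M]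

theorem mdifferentiableAt_coframe (hU : IsOpen U) (hs : ContMDiffOn 𝓘(ℝ, EM) 𝓘(ℝ, ET) ∞ s U)
    {x : M} (hx : x ∈ U) {Y : Π x : M, TangentSpace 𝓘(ℝ, EM) x}
    (hY : MDifferentiableAt 𝓘(ℝ, EM) 𝓘(ℝ, EM).tangent
      (fun y => (⟨y, Y y⟩ : TangentBundle 𝓘(ℝ, EM) M)) x) :
    MDifferentiableAt 𝓘(ℝ, EM) 𝓘(ℝ, Mat n) (fun y => coframe C s y (Y y)) x := by
  have h1 : ContMDiffOn 𝓘(ℝ, EM).tangent 𝓘(ℝ, Mat n) ∞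
      (fun v : TangentBundle 𝓘(ℝ, EM) M => coframe C s v.proj v.snd)
      (Bundle.TotalSpace.proj ⁻¹' U) :=
    (gradedProj slLevel (-1)).contMDiff.comp_contMDiffOn
      (C.contMDiff_form.comp_contMDiffOn (contMDiffOn_tangentMap hU hs))
  have hopen : IsOpen (Bundle.TotalSpace.proj ⁻¹' U : Set (TangentBundle 𝓘(ℝ, EM) M)) :=
    hU.preimage (FiberBundle.continuous_proj EM (TangentSpace 𝓘(ℝ, EM)))
  have h2 := (h1.contMDiffAt (x := (⟨x, Y x⟩ : TangentBundle 𝓘(ℝ, EM) M))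
    (hopen.mem_nhds hx)).mdifferentiableAt (by simp)
  exact MDifferentiableAt.comp x (f := fun y => (⟨y, Y y⟩ : TangentBundle 𝓘(ℝ, EM) M)) h2 hY

/-- Every smooth section over an open set defines a linear connection in the projective class. -/
theorem exists_mem_projectiveClassOn [FiniteDimensional ℝ ET] (hU : IsOpen U)
    (hs : ContMDiffOn 𝓘(ℝ, EM) 𝓘(ℝ, ET) ∞ s U) (hps : ∀ x ∈ U, C.proj (s x) = x) :
    ∃ cov ∈ projectiveClassOn C U, ∀ x ∈ U, ∀ Y : Π x : M, TangentSpace 𝓘(ℝ, EM) x,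
        MDifferentiableAt 𝓘(ℝ, EM) 𝓘(ℝ, EM).tangent
          (fun y => (⟨y, Y y⟩ : TangentBundle 𝓘(ℝ, EM) M)) x →
        ∀ ξ : TangentSpace 𝓘(ℝ, EM) x,
          coframe C s x (cov Y x ξ) =
            mvfderiv 𝓘(ℝ, EM) (fun y => coframe C s y (Y y)) x ξ +
              (connForm C s x ξ * coframe C s x (Y x) -
                coframe C s x (Y x) * connForm C s x ξ) := by
  -- The coframe is inverted pointwise, with a junk value off U; the axioms for covariant
  -- derivatives on U ask for no regularity of R in x.
  have hR : ∀ x, ∃ R : Mat n →L[ℝ] TangentSpace 𝓘(ℝ, EM) x, x ∈ U →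
      ∀ ξ, R (coframeL C s x ξ) = ξ := by
    intro x
    by_cases hx : x ∈ U
    · obtain ⟨R, hR⟩ := LinearMap.exists_leftInverse_of_injective
        (coframeL C s x : TangentSpace 𝓘(ℝ, EM) x →ₗ[ℝ] Mat n)
        (LinearMap.ker_eq_bot.mpr (coframe_injective hU hs hps hx))
      exact ⟨LinearMap.toContinuousLinearMap R, fun _ ξ => LinearMap.congr_fun hR ξ⟩
    · exact ⟨0, fun h => absurd h hx⟩
  choose R hR using hR
  set D : (Π x : M, TangentSpace 𝓘(ℝ, EM) x) → Π x : M, TangentSpace 𝓘(ℝ, EM) x →L[ℝ] Mat n :=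
    fun Y x => mvfderiv 𝓘(ℝ, EM) (fun y => coframe C s y (Y y)) x +
      ((ContinuousLinearMap.mul ℝ (Mat n)).flip (coframe C s x (Y x)) -
        ContinuousLinearMap.mul ℝ (Mat n) (coframe C s x (Y x))).comp (connFormL C s x) with hD
  have hDapp : ∀ Y x ξ, D Y x ξ = mvfderiv 𝓘(ℝ, EM) (fun y => coframe C s y (Y y)) x ξ +
      (connForm C s x ξ * coframe C s x (Y x) - coframe C s x (Y x) * connForm C s x ξ) :=
    fun Y x ξ => rfl
  set cov : (Π x : M, TangentSpace 𝓘(ℝ, EM) x) →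
      (Π x : M, TangentSpace 𝓘(ℝ, EM) x →L[ℝ] TangentSpace 𝓘(ℝ, EM) x) :=
    fun Y x => (R x).comp (D Y x) with hcov
  have hformula : ∀ x ∈ U, ∀ Y : Π x : M, TangentSpace 𝓘(ℝ, EM) x,
        MDifferentiableAt 𝓘(ℝ, EM) 𝓘(ℝ, EM).tangent
          (fun y => (⟨y, Y y⟩ : TangentBundle 𝓘(ℝ, EM) M)) x →
        ∀ ξ : TangentSpace 𝓘(ℝ, EM) x,
          coframe C s x (cov Y x ξ) =
            mvfderiv 𝓘(ℝ, EM) (fun y => coframe C s y (Y y)) x ξ +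
              (connForm C s x ξ * coframe C s x (Y x) -
                coframe C s x (Y x) * connForm C s x ξ) := by
    intro x hx Y hY ξ
    have hYd := mdifferentiableAt_coframe (C := C) hU hs hx hY
    rw [← hDapp]
    -- The left inverse recovers the formula only if its right-hand side is in the range of the
    -- coframe, that is, has degree −1. The derivative term has, since the projection is linear and
    -- continuous.
    obtain ⟨η, hη⟩ : ∃ η, coframe C s x η = D Y x ξ := by
      refine coframe_surjective hU hs hps hx ?_
      rw [hDapp, gradedPart_add]
      congr 1
      · have h1 : (fun y => gradedProj slLevel (-1) (coframe C s y (Y y))) =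
            fun y => coframe C s y (Y y) := funext fun y => coframe_mem y (Y y)
        have h2 := mfderiv_comp_apply (I' := 𝓘(ℝ, Mat n)) x
          (gradedProj (n := n) slLevel (-1)).mdifferentiableAt hYd ξ
        rw [ContinuousLinearMap.mfderiv_eq] at h2
        refine Eq.trans h2.symm ?_
        change mfderiv 𝓘(ℝ, EM) 𝓘(ℝ, Mat n)
          (fun y => gradedProj slLevel (-1) (coframe C s y (Y y))) x ξ = _
        rw [h1]
        rfl
      · exact gradedPart_neg_one_bracket _ _
    have h3 : cov Y x ξ = η := by
      change R x (D Y x ξ) = η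
      rw [← hη]
      exact hR x hx η
    rw [h3, hη]
  refine ⟨cov, ⟨⟨?_, ?_⟩, s, hs, hps, hformula⟩, hformula⟩
  · intro σ σ' x hσ hσ' hx
    have h1 := mdifferentiableAt_coframe (C := C) hU hs hx hσ
    have h2 := mdifferentiableAt_coframe (C := C) hU hs hx hσ'
    have h3 : (fun y => coframe C s y ((σ + σ') y)) =
        (fun y => coframe C s y (σ y)) + fun y => coframe C s y (σ' y) :=
      funext fun y => map_add (coframeL C s y) _ _
    have h4 : D (σ + σ') x = D σ x + D σ' x := by
      ext1 ξ
      change D (σ + σ') x ξ = D σ x ξ + D σ' x ξ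
      rw [hDapp, hDapp, hDapp, h3, mvfderiv_add h1 h2]
      have h5 : coframe C s x ((σ + σ') x) = coframe C s x (σ x) + coframe C s x (σ' x) :=
        map_add (coframeL C s x) _ _
      rw [h5, mul_add, add_mul, add_apply]
      abel
    change (R x).comp (D (σ + σ') x) = (R x).comp (D σ x) + (R x).comp (D σ' x)
    rw [h4, ContinuousLinearMap.comp_add]
  · intro σ g x hσ hg hx
    have h1 := mdifferentiableAt_coframe (C := C) hU hs hx hσ
    have h3 : (fun y => coframe C s y ((g • σ) y)) = g • fun y => coframe C s y (σ y) :=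
      funext fun y => map_smul (coframeL C s y) (g y) (σ y)
    have h4 : D (g • σ) x = g x • D σ x +
        (mvfderiv 𝓘(ℝ, EM) g x).smulRight (coframeL C s x (σ x)) := by
      ext1 ξ
      have h5 : coframe C s x ((g • σ) x) = g x • coframe C s x (σ x) :=
        map_smul (coframeL C s x) (g x) (σ x)
      change D (g • σ) x ξ = g x • D σ x ξ + mvfderiv 𝓘(ℝ, EM) g x ξ • coframe C s x (σ x)
      rw [hDapp, hDapp, h3, h5, mvfderiv_smul hg h1, mul_smul_comm, smul_mul_assoc, add_apply,
        smul_apply, smul_add, smul_sub, ContinuousLinearMap.smulRight_apply]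
      abel
    change (R x).comp (D (g • σ) x) = g x • (R x).comp (D σ x) + _
    rw [h4, ContinuousLinearMap.comp_add, ContinuousLinearMap.comp_smul]
    congr 1
    ext1 ξ
    simp only [ContinuousLinearMap.comp_apply, ContinuousLinearMap.smulRight_apply, map_smul]
    rw [hR x hx]

/-- The covariant acceleration of a curve, expressed through the logarithmic derivative of its lift
along a section. -/
theorem coframe_covariant_acceleration (hU : IsOpen U)
    (hs : ContMDiffOn 𝓘(ℝ, EM) 𝓘(ℝ, ET) ∞ s U)
    {cov : (Π x : M, TangentSpace 𝓘(ℝ, EM) x) →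
      (Π x : M, TangentSpace 𝓘(ℝ, EM) x →L[ℝ] TangentSpace 𝓘(ℝ, EM) x)}
    (hcov : ∀ x ∈ U, ∀ Y : Π x : M, TangentSpace 𝓘(ℝ, EM) x,
        MDifferentiableAt 𝓘(ℝ, EM) 𝓘(ℝ, EM).tangent
          (fun y => (⟨y, Y y⟩ : TangentBundle 𝓘(ℝ, EM) M)) x →
        ∀ ξ : TangentSpace 𝓘(ℝ, EM) x,
          coframe C s x (cov Y x ξ) =
            mvfderiv 𝓘(ℝ, EM) (fun y => coframe C s y (Y y)) x ξ +
              (connForm C s x ξ * coframe C s x (Y x) -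
                coframe C s x (Y x) * connForm C s x ξ))
    {γ : ℝ → M} {J : Set ℝ} (hJ : IsOpen J) (hγ : ContMDiffOn 𝓘(ℝ, ℝ) 𝓘(ℝ, EM) ∞ γ J)
    (hγU : Set.MapsTo γ J U) {t : ℝ} (ht : t ∈ J) {Y : Π x : M, TangentSpace 𝓘(ℝ, EM) x}
    (hY : MDifferentiableAt 𝓘(ℝ, EM) 𝓘(ℝ, EM).tangent
      (fun y => (⟨y, Y y⟩ : TangentBundle 𝓘(ℝ, EM) M)) (γ t))
    (hYγ : ∀ᶠ t' in 𝓝 t, Y (γ t') = velocity γ t') :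
    coframe C s (γ t) (cov Y (γ t) (velocity γ t)) =
      gradedPart slLevel (-1) (deriv (C.dev fun t => s (γ t)) t +
        (C.dev (fun t => s (γ t)) t * C.dev (fun t => s (γ t)) t -
          (2 * C.dev (fun t => s (γ t)) t (Sum.inl ()) (Sum.inl ())) •
            C.dev (fun t => s (γ t)) t)) := by
  have hγd : ∀ t ∈ J, MDifferentiableAt 𝓘(ℝ, ℝ) 𝓘(ℝ, EM) γ t := fun t ht =>
    (hγ.contMDiffAt (hJ.mem_nhds ht)).mdifferentiableAt (by simp)
  have hsd : ∀ x ∈ U, MDifferentiableAt 𝓘(ℝ, EM) 𝓘(ℝ, ET) s x := fun x hx =>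
    (hs.contMDiffAt (hU.mem_nhds hx)).mdifferentiableAt (by simp)
  have hdev : ∀ t ∈ J, C.dev (fun t => s (γ t)) t =
      C.form (s (γ t)) (mfderiv 𝓘(ℝ, EM) 𝓘(ℝ, ET) s (γ t) (velocity γ t)) := by
    intro t ht
    unfold CartanGeometry.dev
    rw [velocity_comp (hsd _ (hγU ht)) (hγd t ht)]
  have hdevs : ContDiffOn ℝ ∞ (C.dev fun t => s (γ t)) J := C.contDiffOn_dev hJ (hs.comp hγ hγU)
  have hdevd : HasDerivAt (C.dev fun t => s (γ t)) (deriv (C.dev fun t => s (γ t)) t) t :=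
    ((hdevs.contDiffAt (hJ.mem_nhds ht)).differentiableAt (by simp)).hasDerivAt
  have h1 : coframe C s (γ t) (velocity γ t) =
      gradedPart slLevel (-1) (C.dev (fun t => s (γ t)) t) := by
    rw [hdev t ht]
    rfl
  have h2 : connForm C s (γ t) (velocity γ t) =
      gradedPart slLevel 0 (C.dev (fun t => s (γ t)) t) := by
    rw [hdev t ht]
    rfl
  rw [hcov (γ t) (hγU ht) Y hY (velocity γ t), hYγ.self_of_nhds, h1, h2, gradedPart_commutator,
    gradedPart_add]
  congr 1
  have h3 := velocity_comp (f := fun y => coframe C s y (Y y)) (γ := γ) (t := t)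
    (mdifferentiableAt_coframe (C := C) hU hs (hγU ht) hY) (hγd t ht)
  refine Eq.trans h3.symm ?_
  -- Along γ the function θ(Y) is the degree −1 part of the logarithmic derivative, so its
  -- derivative does not depend on the extension Y.
  have h4 : (fun t => coframe C s (γ t) (Y (γ t))) =ᶠ[𝓝 t]
      fun t => gradedProj slLevel (-1) (C.dev (fun t => s (γ t)) t) := by
    filter_upwards [hYγ, hJ.mem_nhds ht] with t' h5 h6
    rw [h5, hdev t' h6]
    rfl
  refine (velocity_congr h4).trans ?_
  have h7 := (gradedProj (n := n) slLevel (-1)).hasFDerivAt.comp_hasDerivAt t hdevd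
  unfold velocity
  rw [mfderiv_eq_fderiv]
  exact (congrArg (fun L : ℝ →L[ℝ] Mat n => L 1) h7.hasFDerivAt.fderiv).trans (one_smul ℝ _)

end SectionConnections

/-! ## Straightening a curve in the structure group -/

/-- Evaluation of matrices at the first basis vector. -/
noncomputable def evalFirst (n : ℕ) : Mat n →L[ℝ] (Idx n → ℝ) :=
  LinearMap.toContinuousLinearMap
    { toFun := fun A => A.mulVec (firstVec n)
      map_add' := fun A B => Matrix.add_mulVec A B _
      map_smul' := fun c A => Matrix.smul_mulVec c A _ }

theorem evalFirst_apply {n : ℕ} (A : Mat n) : evalFirst n A = A.mulVec (firstVec n) := rfl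

theorem contDiffOn_matrix_inv {n : ℕ} {g : ℝ → Mat n} {J : Set ℝ} (hg : ContDiffOn ℝ ∞ g J)
    (hdet : ∀ t ∈ J, (g t).det ≠ 0) : ContDiffOn ℝ ∞ (fun t => (g t)⁻¹) J := by
  intro t ht
  have hu : IsUnit (g t) := (Matrix.isUnit_iff_isUnit_det _).mpr (isUnit_iff_ne_zero.mpr (hdet t ht))
  obtain ⟨k, hk⟩ := hu
  have h1 := contDiffAt_ringInverse (n := ∞) ℝ k
  rw [hk] at h1
  have h2 := h1.comp_contDiffWithinAt t (hg t ht)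
  refine h2.congr (fun s _ => ?_) ?_ <;> exact Matrix.nonsing_inv_eq_ringInverse _

/-- The coordinates of a curve that stays in the plane spanned by `e₀` and `X e₀`. -/
theorem exists_plane_coordinates {n : ℕ} {X : Mat n}
    (hX0 : X.mulVec (firstVec n) (Sum.inl ()) = 0)
    {i : (Fin n ⊕ Fin n) ⊕ Unit} (hXi : X.mulVec (firstVec n) (Sum.inr i) ≠ 0) :
    ∃ L : (Idx n → ℝ) →L[ℝ] (Idx n → ℝ), L (firstVec n) = 0 ∧ L (X.mulVec (firstVec n)) = 0 ∧
      ∀ v, L v = 0 → v = v (Sum.inl ()) • firstVec n +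
        (v (Sum.inr i) / X.mulVec (firstVec n) (Sum.inr i)) • X.mulVec (firstVec n) := by
  set x := X.mulVec (firstVec n) with hx
  -- The complement of the projection onto the plane that reads off the coordinates 0 and i; it
  -- kills Xe₀ because the 0-th coordinate of Xe₀ is zero.
  set L : (Idx n → ℝ) →L[ℝ] (Idx n → ℝ) := ContinuousLinearMap.id ℝ _ -
    (ContinuousLinearMap.proj (R := ℝ) (φ := fun _ : Idx n => ℝ) (Sum.inl ())).smulRight
      (firstVec n) -
    (ContinuousLinearMap.proj (R := ℝ) (φ := fun _ : Idx n => ℝ) (Sum.inr i)).smulRight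
      ((x (Sum.inr i))⁻¹ • x) with hL
  have hLv : ∀ v, L v = v - v (Sum.inl ()) • firstVec n - v (Sum.inr i) • (x (Sum.inr i))⁻¹ • x :=
    fun v => rfl
  refine ⟨L, ?_, ?_, ?_⟩
  · rw [hLv, firstVec_inl, firstVec_inr]
    simp
  · rw [hLv, hX0, smul_smul, mul_inv_cancel₀ hXi]
    simp
  · intro v hv
    rw [hLv, sub_sub, sub_eq_zero] at hv
    rw [div_eq_mul_inv, mul_smul]
    exact hv

/-- If the logarithmic derivative `A` of a curve satisfies the equation of geodesics, then a gauge
transformation with values in `P̃` turns it into a multiple of a constant `X`. -/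
theorem exists_straightening {n : ℕ} {A : ℝ → Mat n} {J : Set ℝ} (hJ : IsOpen J)
    (hA : ContDiffOn ℝ ∞ A J) (hAtr : ∀ t ∈ J, A t ∈ slAlg n) {t₀ : ℝ} (ht₀ : t₀ ∈ J)
    {α β : ℝ → ℝ} (hα : ContinuousAt α t₀) (hβ : ContinuousAt β t₀)
    (hgeo : ∀ᶠ t in 𝓝 t₀, (deriv A t + A t * A t).mulVec (firstVec n) =
      α t • firstVec n + β t • (A t).mulVec (firstVec n))
    {X : Mat n} (hX2 : X * X = 0) (hXdet : ∀ s : ℝ, (1 + s • X).det = 1)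
    (hX0 : X.mulVec (firstVec n) (Sum.inl ()) = 0)
    (hXi : ∃ i, X.mulVec (firstVec n) (Sum.inr i) ≠ 0) (h₀ : parSl n) {c : ℝ}
    (hinit : (((h₀ : GL (Idx n) ℝ)⁻¹ : GL (Idx n) ℝ) : Mat n).mulVec
      ((A t₀).mulVec (firstVec n)) = X.mulVec (firstVec n) + c • firstVec n) :
    ∃ (J' : Set ℝ) (φ : ℝ → ℝ) (h : ℝ → parSl n), J' ⊆ J ∧ IsOpen J' ∧ t₀ ∈ J' ∧
      ContDiffOn ℝ ∞ φ J' ∧ φ t₀ = 0 ∧ deriv φ t₀ ≠ 0 ∧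
      ContDiffOn ℝ ∞ (fun t => ((h t : GL (Idx n) ℝ) : Mat n)) J' ∧ h t₀ = h₀ ∧
      ∀ t ∈ J', (((h t : GL (Idx n) ℝ)⁻¹ : GL (Idx n) ℝ) : Mat n) *
        (A t * ((h t : GL (Idx n) ℝ) : Mat n) +
          deriv (fun t => ((h t : GL (Idx n) ℝ) : Mat n)) t) = deriv φ t • X := by
  obtain ⟨i, hi⟩ := hXi
  set x := X.mulVec (firstVec n) with hx
  -- g is the development of the curve. Its initial value h₀⁻¹ makes y = ge₀ start on the ray of e₀
  -- with velocity Xe₀ + ce₀.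
  obtain ⟨g, hg0, I, hIJ, hI, ht₀I, hgs, hgd⟩ := exists_linear_ode_solution hJ hA ht₀
    (((h₀ : GL (Idx n) ℝ)⁻¹ : GL (Idx n) ℝ) : Mat n)
  obtain ⟨a₀, ha₀, hgfirst⟩ := parSl_mulVec_firstVec h₀⁻¹
  have hgdet0 : (g t₀).det = 1 := by
    rw [hg0]
    exact ((mem_parSl_iff _).mp (h₀⁻¹).2).1
  have hdetcont : ContinuousOn (fun t => (g t).det) I :=
    differentiable_det.continuous.comp_continuousOn hgs.continuousOn
  -- the two coordinates of the development
  set y : ℝ → Idx n → ℝ := fun t => evalFirst n (g t) with hy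
  set a : ℝ → ℝ := fun t => y t (Sum.inl ()) with ha
  set b : ℝ → ℝ := fun t => y t (Sum.inr i) / x (Sum.inr i) with hb
  have hys : ContDiffOn ℝ ∞ y I := (evalFirst n).contDiff.comp_contDiffOn hgs
  have has : ContDiffOn ℝ ∞ a I := contDiffOn_pi.mp hys _
  have hbs : ContDiffOn ℝ ∞ b I := (contDiffOn_pi.mp hys _).div_const _
  have hy0 : y t₀ = a₀ • firstVec n := by
    rw [hy]
    simp only
    rw [hg0, evalFirst_apply]
    exact hgfirst
  have ha0 : a t₀ = a₀ := by rw [ha]; simp only; rw [hy0]; simp [firstVec_inl]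
  have hb0 : b t₀ = 0 := by rw [hb]; simp only; rw [hy0]; simp [firstVec_inr]
  have hyd : ∀ t ∈ I, HasDerivAt y (evalFirst n (g t * A t)) t := fun t ht =>
    (evalFirst n).hasFDerivAt.comp_hasDerivAt t (hgd t ht)
  have hyd0 : evalFirst n (g t₀ * A t₀) = x + c • firstVec n := by
    rw [evalFirst_apply, hg0, ← Matrix.mulVec_mulVec, hinit]
  have hAd : ∀ t ∈ J, HasDerivAt A (deriv A t) t := fun t ht =>
    ((hA.contDiffAt (hJ.mem_nhds ht)).differentiableAt (by simp)).hasDerivAt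
  -- Differentiating y' = gAe₀ gives y'' = g(A' + A²)e₀ = αy + βy', which confines y to the plane of
  -- its initial data.
  have hplane : ∀ᶠ t in 𝓝 t₀, y t = a t • firstVec n + b t • x := by
    obtain ⟨L, hL0, hLx, hL⟩ := exists_plane_coordinates hX0 hi
    rw [← hx] at hLx hL
    have h1 := eventually_map_eq_zero_of_second_order L (y := y)
      (y' := fun t => evalFirst n (g t * A t)) (α := α) (β := β) (t₀ := t₀)
      (Filter.eventually_of_mem (hI.mem_nhds ht₀I) hyd)
      (by
        filter_upwards [hgeo, hI.mem_nhds ht₀I] with t ht htI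
        have h2 := (evalFirst n).hasFDerivAt.comp_hasDerivAt t ((hgd t htI).mul (hAd t (hIJ htI)))
        refine h2.congr_deriv ?_
        have h3 : g t * A t * A t + g t * deriv A t = g t * (deriv A t + A t * A t) := by
          rw [mul_add, mul_assoc, add_comm]
        rw [h3, evalFirst_apply, ← Matrix.mulVec_mulVec, ht, Matrix.mulVec_add, Matrix.mulVec_smul,
          Matrix.mulVec_smul, Matrix.mulVec_mulVec]
        rfl)
      hα hβ (by rw [hy0, map_smul, hL0, smul_zero])
      (by simp only [hyd0, map_add, map_smul, hL0, hLx, smul_zero, add_zero])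
    exact h1.mono fun t ht => hL _ ht
  have hapos : ∀ᶠ t in 𝓝 t₀, 0 < a t :=
    ((has.contDiffAt (hI.mem_nhds ht₀I)).continuousAt).eventually_mem
      (isOpen_Ioi.mem_nhds (by rw [ha0]; exact ha₀))
  have hdetne : ∀ᶠ t in 𝓝 t₀, (g t).det ≠ 0 :=
    (hdetcont.continuousAt (hI.mem_nhds ht₀I)).eventually_ne (by rw [hgdet0]; exact one_ne_zero)
  obtain ⟨ε, hε, hball⟩ := Metric.eventually_nhds_iff_ball.mp
    ((hI.eventually_mem ht₀I).and (hplane.and (hapos.and hdetne)))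
  set J' := Metric.ball t₀ ε with hJ'
  have ht₀' : t₀ ∈ J' := Metric.mem_ball_self hε
  have hJ'o : IsOpen J' := Metric.isOpen_ball
  -- Liouville's formula: A is trace-free, so the determinant keeps its initial value.
  have hdet : ∀ t ∈ J', (g t).det = 1 := by
    have hder : ∀ t ∈ J', HasDerivAt (fun s => (g s).det) 0 t := fun t ht =>
      hasDerivAt_det_of_trace_eq_zero (hgd t (hball t ht).1) (hAtr t (hIJ (hball t ht).1))
        (hball t ht).2.2.2
    intro t ht
    have h1 := hJ'o.is_const_of_deriv_eq_zero (convex_ball t₀ ε).isPreconnected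
      (fun t ht => (hder t ht).differentiableAt.differentiableWithinAt)
      (fun t ht => (hder t ht).deriv) ht ht₀'
    rw [h1, hgdet0]
  have hunit : ∀ t ∈ J', IsUnit (g t).det := fun t ht => by rw [hdet t ht]; exact isUnit_one
  set φ : ℝ → ℝ := fun t => b t / a t with hφ
  have hφs : ContDiffOn ℝ ∞ φ J' := (hbs.mono fun t ht => (hball t ht).1).div
    (has.mono fun t ht => (hball t ht).1) fun t ht => (hball t ht).2.2.1.ne'
  -- (1 + φX)e₀ = a⁻¹y = a⁻¹ge₀ by the choice φ = b/a, so m sends e₀ to a⁻¹e₀ with a > 0: m takes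
  -- values in P̃.
  set m : ℝ → Mat n := fun t => (g t)⁻¹ * (1 + φ t • X) with hm
  have hms : ContDiffOn ℝ ∞ m J' :=
    (contDiffOn_matrix_inv (hgs.mono fun t ht => (hball t ht).1)
      fun t ht => (hball t ht).2.2.2).mul (contDiffOn_const.add (hφs.smul contDiffOn_const))
  have hmem : ∀ t, ∃ h : parSl n, t ∈ J' → ((h : GL (Idx n) ℝ) : Mat n) = m t := by
    intro t
    by_cases ht : t ∈ J'
    · obtain ⟨-, hpl, hat, -⟩ := hball t ht
      obtain ⟨h, hh⟩ := exists_mem_parSl (A := m t) (a := (a t)⁻¹)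
        (by rw [hm]; simp only; rw [Matrix.det_mul, hXdet, mul_one, Matrix.det_nonsing_inv, hdet t ht,
              Ring.inverse_one])
        (inv_pos.mpr hat) (by
          have h1 : (1 + φ t • X).mulVec (firstVec n) = (a t)⁻¹ • (g t).mulVec (firstVec n) := by
            rw [Matrix.add_mulVec, Matrix.one_mulVec, Matrix.smul_mulVec]
            change _ = (a t)⁻¹ • y t
            rw [hpl, smul_add, smul_smul, inv_mul_cancel₀ hat.ne', one_smul, smul_smul, hφ]
            simp only
            rw [div_eq_inv_mul]
          rw [hm]
          simp only
          rw [← Matrix.mulVec_mulVec, h1, Matrix.mulVec_smul, Matrix.mulVec_mulVec,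
            Matrix.nonsing_inv_mul _ (hunit t ht), Matrix.one_mulVec])
      exact ⟨h, fun _ => hh⟩
    · exact ⟨1, fun h => absurd h ht⟩
  choose h hh using hmem
  have hhs : ContDiffOn ℝ ∞ (fun t => ((h t : GL (Idx n) ℝ) : Mat n)) J' := hms.congr hh
  have hφ0 : φ t₀ = 0 := by rw [hφ]; simp only; rw [hb0, zero_div]
  refine ⟨J', φ, h, fun t ht => hIJ (hball t ht).1, hJ'o, ht₀', hφs, hφ0, ?_, hhs, ?_, ?_⟩
  -- Here b = 0 and b' = 1 at t₀, whence φ'(t₀) = 1/a₀.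
  · have hcomp := hasDerivAt_pi.mp (hyd t₀ ht₀I)
    rw [hyd0] at hcomp
    have hbd : HasDerivAt b 1 t₀ := by
      refine ((hcomp (Sum.inr i)).div_const (x (Sum.inr i))).congr_deriv ?_
      simp [firstVec_inr, hi]
    have had : HasDerivAt a _ t₀ := hcomp (Sum.inl ())
    have hφd := hbd.div had (by rw [ha0]; exact ha₀.ne')
    rw [hb0, ha0] at hφd
    have h1 : deriv φ t₀ = _ := hφd.deriv
    rw [h1]
    simp [ha₀.ne']
  · ext1
    ext1
    rw [hh t₀ ht₀', hm]
    simp only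
    rw [hφ0, zero_smul, add_zero, mul_one, hg0]
    rw [← Matrix.coe_units_inv, inv_inv]
  · intro t ht
    have hmd : HasDerivAt m (deriv m t) t :=
      ((hms.contDiffAt (hJ'o.mem_nhds ht)).differentiableAt (by simp)).hasDerivAt
    have hφd : HasDerivAt φ (deriv φ t) t :=
      ((hφs.contDiffAt (hJ'o.mem_nhds ht)).differentiableAt (by simp)).hasDerivAt
    have hev : (fun t => ((h t : GL (Idx n) ℝ) : Mat n)) =ᶠ[𝓝 t] m :=
      Filter.eventuallyEq_of_mem (hJ'o.mem_nhds ht) hh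
    -- Differentiate gm = 1 + φX, using g' = gA.
    have h1 : g t * A t * m t + g t * deriv m t = deriv φ t • X := by
      have h2 := (hgd t (hball t ht).1).mul hmd
      have h3 : HasDerivAt (fun s => 1 + φ s • X) (deriv φ t • X) t :=
        (hφd.smul_const X).const_add 1
      refine h2.unique (h3.congr_of_eventuallyEq ?_)
      filter_upwards [hJ'o.mem_nhds ht] with s hs
      simp only [Pi.mul_apply, hm]
      rw [← mul_assoc, Matrix.mul_nonsing_inv _ (hunit s hs), one_mul]
    rw [hev.deriv_eq, hh t ht]
    -- X² = 0 gives mX = g⁻¹(1 + φX)X = g⁻¹X.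
    have h4 : A t * m t + deriv m t = m t * (deriv φ t • X) := by
      have h5 : A t * m t + deriv m t = (g t)⁻¹ * (deriv φ t • X) := by
        rw [← h1, mul_assoc, ← mul_add]
        exact (Matrix.nonsing_inv_mul_cancel_left _ _ (hunit t ht)).symm
      rw [h5, hm]
      simp only
      have h6 : φ t • X * deriv φ t • X = 0 := by
        rw [smul_mul_assoc, mul_smul_comm, hX2, smul_zero, smul_zero]
      rw [mul_assoc, add_mul, one_mul, h6, add_zero]
    rw [h4, ← hh t ht, ← mul_assoc, ← Units.val_mul, inv_mul_cancel, Units.val_one, one_mul]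

/-! ## Projections of flow lines are paths -/

section FlowLines

variable {n : ℕ} {H : Subgroup (GL (Idx n) ℝ)} {𝔨 : Submodule ℝ (Mat n)}
  {EM ET : Type*} [NormedAddCommGroup EM] [NormedSpace ℝ EM]
  [NormedAddCommGroup ET] [NormedSpace ℝ ET]
  {M : Type*} [TopologicalSpace M] [ChartedSpace EM M]
  {T : Type*} [TopologicalSpace T] [ChartedSpace ET T] [IsManifold 𝓘(ℝ, ET) ∞ T]

theorem CartanGeometry.isMIntegralCurveAt_of_dev
    (C : CartanGeometry 𝔨 H (EM := EM) (ET := ET) M T) {X : Mat n} (hX : X ∈ 𝔨) {c : ℝ → T}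
    {I : Set ℝ} (hI : IsOpen I) (hc : ContMDiffOn 𝓘(ℝ, ℝ) 𝓘(ℝ, ET) ∞ c I)
    (hdev : ∀ t ∈ I, C.dev c t = X) {t₀ : ℝ} (ht₀ : t₀ ∈ I) :
    IsMIntegralCurveAt (I := 𝓘(ℝ, ET)) c (C.constantField X) t₀ := by
  refine isMIntegralCurveAt_of_velocity ?_
  filter_upwards [hI.mem_nhds ht₀] with t ht
  refine ⟨(hc.contMDiffAt (hI.mem_nhds ht)).mdifferentiableAt (by simp), ?_⟩
  exact C.injective_form (c t) ((hdev t ht).trans (C.form_constantField hX (c t)).symm)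

theorem CartanGeometry.exists_dev_of_isMIntegralCurveAt [FiniteDimensional ℝ ET]
    (C : CartanGeometry 𝔨 H (EM := EM) (ET := ET) M T) {X : Mat n} (hX : X ∈ 𝔨) {c : ℝ → T}
    {t₀ : ℝ} (hc : IsMIntegralCurveAt (I := 𝓘(ℝ, ET)) c (C.constantField X) t₀) :
    ∃ I : Set ℝ, IsOpen I ∧ t₀ ∈ I ∧ ContMDiffOn 𝓘(ℝ, ℝ) 𝓘(ℝ, ET) ∞ c I ∧
      ∀ t ∈ I, C.dev c t = X := by
  obtain ⟨I, hI, h0, hcs, hv⟩ :=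
    exists_contMDiffOn_of_isMIntegralCurveAt (C.contMDiff_constantField hX) hc
  refine ⟨I, hI, h0, hcs, fun t ht => ?_⟩
  unfold CartanGeometry.dev
  rw [hv t ht, C.form_constantField hX]

theorem coframe_velocity {C : CartanGeometry (slAlg n) (parSl n) (EM := EM) (ET := ET) M T}
    {s : M → T} {γ : ℝ → M} {t : ℝ} (hs : MDifferentiableAt 𝓘(ℝ, EM) 𝓘(ℝ, ET) s (γ t))
    (hγ : MDifferentiableAt 𝓘(ℝ, ℝ) 𝓘(ℝ, EM) γ t) :
    coframe C s (γ t) (velocity γ t) = gradedPart slLevel (-1) (C.dev (fun t => s (γ t)) t) := by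
  unfold CartanGeometry.dev
  rw [velocity_comp hs hγ]
  rfl

variable (C : CartanGeometry (slAlg n) (parSl n) (EM := EM) (ET := ET) M T)

/-- Projections of curves with constant transversal logarithmic derivative are regular. -/
theorem CartanGeometry.velocity_proj_ne_zero [FiniteDimensional ℝ ET] {c : ℝ → T} {t : ℝ}
    (hc : MDifferentiableAt 𝓘(ℝ, ℝ) 𝓘(ℝ, ET) c t)
    (hX : ∃ i, (C.dev c t).mulVec (firstVec n) (Sum.inr i) ≠ 0) :
    velocity (EM := EM) (fun t => C.proj (c t)) t ≠ 0 := by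
  intro h
  rw [velocity_comp (C.mdifferentiableAt_proj _) hc] at h
  obtain ⟨i, hi⟩ := hX
  exact hi ((mem_span_firstVec _).mp (C.form_of_mfderiv_proj_eq_zero h) i)

variable [IsManifold 𝓘(ℝ, EM) ∞ M]

/-- A curve in the Cartan bundle over a regular curve extends locally to a section. -/
theorem CartanGeometry.exists_section_extending {c : ℝ → T} {I : Set ℝ} (hI : IsOpen I)
    (hc : ContMDiffOn 𝓘(ℝ, ℝ) 𝓘(ℝ, ET) ∞ c I) {τ₀ : ℝ} (hτ₀ : τ₀ ∈ I)
    (hv : velocity (EM := EM) (fun t => C.proj (c t)) τ₀ ≠ 0) :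
    ∃ (U : Set M) (s : M → T) (r : M → ℝ), IsOpen U ∧ C.proj (c τ₀) ∈ U ∧
      ContMDiffOn 𝓘(ℝ, EM) 𝓘(ℝ, ET) ∞ s U ∧ (∀ x ∈ U, C.proj (s x) = x) ∧
      ContMDiffOn 𝓘(ℝ, EM) 𝓘(ℝ, ℝ) ∞ r U ∧
      ∀ᶠ τ in 𝓝 τ₀, r (C.proj (c τ)) = τ ∧ s (C.proj (c τ)) = c τ := by
  obtain ⟨U₀, s₀, hU₀, hx₀, hs₀, hps₀, hlift⟩ := C.exists_section (C.proj (c τ₀))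
  have hpc : ContMDiffOn 𝓘(ℝ, ℝ) 𝓘(ℝ, EM) ∞ (fun t => C.proj (c t)) I :=
    C.contMDiff_proj.comp_contMDiffOn hc
  set I' := I ∩ (fun t => C.proj (c t)) ⁻¹' U₀ with hI'
  have hI'o : IsOpen I' := hpc.continuousOn.isOpen_inter_preimage hI hU₀
  obtain ⟨h, hh, hact⟩ := hlift c I' (hc.mono Set.inter_subset_left) fun t ht => ht.2
  obtain ⟨r, V, hV, hV0, hr, hrI, hrc⟩ := exists_left_inverse_of_velocity_ne_zero hI'o
    (hpc.mono Set.inter_subset_left) ⟨hτ₀, hx₀⟩ hv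
  -- Along the projected curve c = s₀·h; composing h with the left inverse r extends this identity
  -- to a section.
  refine ⟨V ∩ U₀, fun x => C.act (s₀ x) (h (r x)), r, hV.inter hU₀, ⟨hV0, hx₀⟩, ?_, ?_,
    hr.mono Set.inter_subset_left, ?_⟩
  · exact C.contMDiffOn_act (h := fun x => h (r x)) (hs₀.mono Set.inter_subset_right)
      (hh.contMDiffOn.comp (hr.mono Set.inter_subset_left) fun x hx => hrI hx.1)
  · intro x hx
    rw [C.proj_act, hps₀ x hx.2]
  · filter_upwards [hrc, hI'o.mem_nhds ⟨hτ₀, hx₀⟩] with τ h1 h2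
    refine ⟨h1, ?_⟩
    rw [h1, hact τ h2]

/-- Reparametrized projections of flow lines of `X` with `X² = 0` are geodesics, up to
parametrization, of a connection in the projective class. -/
theorem CartanGeometry.exists_isUnparametrizedGeodesicAt [FiniteDimensional ℝ ET] {c : ℝ → T}
    {I : Set ℝ} (hI : IsOpen I)
    (hc : ContMDiffOn 𝓘(ℝ, ℝ) 𝓘(ℝ, ET) ∞ c I) {X : Mat n} (hdev : ∀ t ∈ I, C.dev c t = X)
    (hX2 : X * X = 0) (hX0 : X.mulVec (firstVec n) (Sum.inl ()) = 0)
    (hXi : ∃ i, X.mulVec (firstVec n) (Sum.inr i) ≠ 0)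
    {φ : ℝ → ℝ} {t₀ : ℝ} (hφ₀ : φ t₀ ∈ I) (hφ : ContinuousAt φ t₀)
    {γ : ℝ → M} {J : Set ℝ} (hJ : IsOpen J) (ht₀ : t₀ ∈ J)
    (hγ : ContMDiffOn 𝓘(ℝ, ℝ) 𝓘(ℝ, EM) ∞ γ J)
    (hreg : ∀ t ∈ J, velocity (EM := EM) γ t ≠ 0)
    (hγc : ∀ᶠ t in 𝓝 t₀, γ t = C.proj (c (φ t))) :
    ∃ U : Set M, IsOpen U ∧ γ t₀ ∈ U ∧
      ∃ cov ∈ projectiveClassOn C U, IsUnparametrizedGeodesicAt cov γ t₀ := by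
  have hcd : ∀ τ ∈ I, MDifferentiableAt 𝓘(ℝ, ℝ) 𝓘(ℝ, ET) c τ := fun τ hτ =>
    (hc.contMDiffAt (hI.mem_nhds hτ)).mdifferentiableAt (by simp)
  obtain ⟨U, s, r, hU, hxU, hs, hps, hr, hrs⟩ := C.exists_section_extending hI hc hφ₀
    (C.velocity_proj_ne_zero (hcd _ hφ₀) (by rw [hdev _ hφ₀]; exact hXi))
  have hγ₀ : γ t₀ = C.proj (c (φ t₀)) := hγc.self_of_nhds
  rw [← hγ₀] at hxU
  obtain ⟨cov, hcov, hform⟩ := exists_mem_projectiveClassOn hU hs hps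
  refine ⟨U, hU, hxU, cov, hcov, ?_⟩
  obtain ⟨V, Y, hV, hVt, hY, hYγ⟩ := exists_extension_velocity hJ hγ ht₀ (hreg t₀ ht₀)
  refine ⟨V, Y, hV, hVt, hY, ?_⟩
  have hγcont : ContinuousAt γ t₀ := (hγ.contMDiffAt (hJ.mem_nhds ht₀)).continuousAt
  obtain ⟨J₁, hJ₁, hJ₁o, ht₁⟩ := eventually_nhds_iff.mp
    ((hJ.eventually_mem ht₀).and (hγc.and (hYγ.and ((hφ.eventually hrs).and
      ((hφ.eventually (hI.eventually_mem hφ₀)).and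
      ((hγcont.eventually (hU.eventually_mem hxU)).and
      (hγcont.eventually (hV.eventually_mem hVt))))))))
  -- Only continuity of φ at t₀ is assumed; smoothness nearby follows from φ = r ∘ γ.
  have hφs : ContDiffOn ℝ ∞ φ J₁ := by
    refine contMDiffOn_iff_contDiffOn.mp ?_
    refine (hr.comp (hγ.mono fun t ht => (hJ₁ t ht).1)
      fun t ht => (hJ₁ t ht).2.2.2.2.2.1).congr fun t ht => ?_
    obtain ⟨-, h1, -, ⟨h2, -⟩, -⟩ := hJ₁ t ht
    rw [Function.comp_apply, h1, h2]
  have hφd : ∀ t ∈ J₁, HasDerivAt φ (deriv φ t) t := fun t ht =>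
    ((hφs.contDiffAt (hJ₁o.mem_nhds ht)).differentiableAt (by simp)).hasDerivAt
  have hsγ : ∀ t ∈ J₁, s (γ t) = c (φ t) := by
    intro t ht
    obtain ⟨-, h1, -, ⟨-, h2⟩, -⟩ := hJ₁ t ht
    rw [h1, h2]
  have hdevγ : ∀ t ∈ J₁, C.dev (fun t => s (γ t)) t = deriv φ t • X := by
    intro t ht
    have hφI : φ t ∈ I := (hJ₁ t ht).2.2.2.2.1
    rw [C.dev_congr (Filter.eventuallyEq_of_mem (hJ₁o.mem_nhds ht) hsγ),
      C.dev_comp_real (hcd _ hφI) (hφd t ht).differentiableAt, hdev _ hφI]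
  have hX00 : X (Sum.inl ()) (Sum.inl ()) = 0 :=
    (mulVec_firstVec X (Sum.inl ())).symm.trans hX0
  filter_upwards [hJ₁o.mem_nhds ht₁] with t ht
  obtain ⟨htJ, hγt, hYt, -, hφI, hγU, hγV⟩ := hJ₁ t ht
  -- The lift has logarithmic derivative A = φ'X, so only A' = φ''X survives in the acceleration,
  -- while γ' corresponds to φ'X.
  refine ⟨hYt, deriv (deriv φ) t / deriv φ t, ?_⟩
  have hacc := coframe_covariant_acceleration (C := C) hU hs hform hJ₁o
    (hγ.mono fun t ht => (hJ₁ t ht).1) (fun t ht => (hJ₁ t ht).2.2.2.2.2.1) ht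
    ((hY.contMDiffAt (hV.mem_nhds hγV)).mdifferentiableAt (by simp))
    (Filter.eventually_of_mem (hJ₁o.mem_nhds ht) fun t ht => (hJ₁ t ht).2.2.1)
  have hddev : deriv (C.dev fun t => s (γ t)) t = deriv (deriv φ) t • X := by
    rw [(Filter.eventuallyEq_of_mem (hJ₁o.mem_nhds ht) hdevγ).deriv_eq]
    have h1 : ContDiffOn ℝ ∞ (deriv φ) J₁ := hφs.deriv_of_isOpen hJ₁o (by simp)
    exact (((h1.contDiffAt (hJ₁o.mem_nhds ht)).differentiableAt
      (by simp)).hasDerivAt.smul_const X).deriv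
  have hvel : coframe C s (γ t) (velocity γ t) = deriv φ t • gradedPart slLevel (-1) X := by
    rw [← gradedPart_smul, ← hdevγ t ht]
    exact coframe_velocity ((hs.contMDiffAt (hU.mem_nhds hγU)).mdifferentiableAt (by simp))
      ((hγ.contMDiffAt (hJ.mem_nhds htJ)).mdifferentiableAt (by simp))
  have hφne : deriv φ t ≠ 0 := by
    intro h0
    rw [h0, zero_smul] at hvel
    exact hreg t htJ ((injective_iff_map_eq_zero _).mp (coframe_injective hU hs hps hγU) _ hvel)
  rw [hddev, hdevγ t ht, smul_mul_assoc, mul_smul_comm, hX2, smul_zero, smul_zero,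
    Matrix.smul_apply, hX00, smul_zero, mul_zero, zero_smul, sub_zero, add_zero,
    gradedPart_smul] at hacc
  refine coframe_injective hU hs hps hγU ?_
  rw [map_smul, coframeL_apply, coframeL_apply, hacc, hvel, smul_smul, div_mul_cancel₀ _ hφne]

end FlowLines

/-! ## Paths are projections of flow lines -/

section Paths

variable {n : ℕ}
  {EM ET : Type*} [NormedAddCommGroup EM] [NormedSpace ℝ EM]
  [NormedAddCommGroup ET] [NormedSpace ℝ ET]
  {M : Type*} [TopologicalSpace M] [ChartedSpace EM M]
  {T : Type*} [TopologicalSpace T] [ChartedSpace ET T] [IsManifold 𝓘(ℝ, ET) ∞ T]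
  {C : CartanGeometry (slAlg n) (parSl n) (EM := EM) (ET := ET) M T}
  {s : M → T} {U : Set M} {γ : ℝ → M} {J : Set ℝ} {t₀ : ℝ}

/-- Injectivity of the coframe makes regularity of γ visible in the first column of the logarithmic
derivative. -/
theorem exists_dev_mulVec_ne_zero (hU : IsOpen U)
    (hs : ContMDiffOn 𝓘(ℝ, EM) 𝓘(ℝ, ET) ∞ s U) (hps : ∀ x ∈ U, C.proj (s x) = x)
    (hγ : MDifferentiableAt 𝓘(ℝ, ℝ) 𝓘(ℝ, EM) γ t₀) (hγU : γ t₀ ∈ U)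
    (hreg : velocity (EM := EM) γ t₀ ≠ 0) :
    ∃ i, (C.dev (fun t => s (γ t)) t₀).mulVec (firstVec n) (Sum.inr i) ≠ 0 := by
  by_contra! h
  refine hreg ((injective_iff_map_eq_zero _).mp (coframe_injective hU hs hps hγU) _ ?_)
  refine (coframe_velocity ((hs.contMDiffAt (hU.mem_nhds hγU)).mdifferentiableAt
    (by simp)) hγ).trans ?_
  exact (gradedPart_neg_one_eq_zero_iff _).mpr ((mem_span_firstVec _).mpr h)

/-- The geodesic equation, in terms of the logarithmic derivative of a lift of the curve. -/
theorem exists_acceleration_of_isUnparametrizedGeodesicAt [IsManifold 𝓘(ℝ, EM) ∞ M] (hU : IsOpen U)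
    (hs : ContMDiffOn 𝓘(ℝ, EM) 𝓘(ℝ, ET) ∞ s U) (hps : ∀ x ∈ U, C.proj (s x) = x)
    {cov : (Π x : M, TangentSpace 𝓘(ℝ, EM) x) →
      (Π x : M, TangentSpace 𝓘(ℝ, EM) x →L[ℝ] TangentSpace 𝓘(ℝ, EM) x)}
    (hcov : ∀ x ∈ U, ∀ Y : Π x : M, TangentSpace 𝓘(ℝ, EM) x,
        MDifferentiableAt 𝓘(ℝ, EM) 𝓘(ℝ, EM).tangent
          (fun y => (⟨y, Y y⟩ : TangentBundle 𝓘(ℝ, EM) M)) x →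
        ∀ ξ : TangentSpace 𝓘(ℝ, EM) x,
          coframe C s x (cov Y x ξ) =
            mvfderiv 𝓘(ℝ, EM) (fun y => coframe C s y (Y y)) x ξ +
              (connForm C s x ξ * coframe C s x (Y x) -
                coframe C s x (Y x) * connForm C s x ξ))
    (hJ : IsOpen J) (hγ : ContMDiffOn 𝓘(ℝ, ℝ) 𝓘(ℝ, EM) ∞ γ J) (ht₀ : t₀ ∈ J)
    (hγU : ∀ t ∈ J, γ t ∈ U) (hreg : velocity (EM := EM) γ t₀ ≠ 0)
    (hgeo : IsUnparametrizedGeodesicAt cov γ t₀) :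
    ∃ α β : ℝ → ℝ, ContinuousAt α t₀ ∧ ContinuousAt β t₀ ∧ ∀ᶠ t in 𝓝 t₀,
      (deriv (C.dev fun t => s (γ t)) t +
        C.dev (fun t => s (γ t)) t * C.dev (fun t => s (γ t)) t).mulVec (firstVec n) =
      α t • firstVec n + β t • (C.dev (fun t => s (γ t)) t).mulVec (firstVec n) := by
  have hγd : ∀ t ∈ J, MDifferentiableAt 𝓘(ℝ, ℝ) 𝓘(ℝ, EM) γ t := fun t ht =>
    (hγ.contMDiffAt (hJ.mem_nhds ht)).mdifferentiableAt (by simp)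
  have hsd : ∀ t ∈ J, MDifferentiableAt 𝓘(ℝ, EM) 𝓘(ℝ, ET) s (γ t) := fun t ht =>
    (hs.contMDiffAt (hU.mem_nhds (hγU t ht))).mdifferentiableAt (by simp)
  obtain ⟨i, hi⟩ := exists_dev_mulVec_ne_zero hU hs hps (hγd t₀ ht₀) (hγU t₀ ht₀) hreg
  obtain ⟨V, Y, hV, hVt, hY, hYgeo⟩ := hgeo
  have hA : ContDiffOn ℝ ∞ (C.dev fun t => s (γ t)) J :=
    C.contDiffOn_dev hJ (hs.comp hγ hγU)
  set A := C.dev fun t => s (γ t) with hAdef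
  set B : ℝ → Mat n := fun t => deriv A t + A t * A t with hB
  have hAc : ContinuousAt A t₀ := (hA.contDiffAt (hJ.mem_nhds ht₀)).continuousAt
  have hBc : ContinuousAt B t₀ :=
    (((hA.deriv_of_isOpen (m := ∞) hJ (by simp)).contDiffAt (hJ.mem_nhds ht₀)).continuousAt).add
      (hAc.mul hAc)
  have hentry : ∀ (F : ℝ → Mat n) (k l : Idx n), ContinuousAt F t₀ →
      ContinuousAt (fun t => F t k l) t₀ := fun F k l hF =>
    (entryL k l).continuous.continuousAt.comp hF
  rw [mulVec_firstVec] at hi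
  -- The proportionality factor f in the geodesic condition is merely a number at each time. Solving
  -- for β from a nonvanishing row gives a continuous coefficient; α is then fixed by the
  -- e₀-component.
  set β : ℝ → ℝ := fun t => B t (Sum.inr i) (Sum.inl ()) / A t (Sum.inr i) (Sum.inl ()) with hβ
  have hβc : ContinuousAt β t₀ := (hentry B _ _ hBc).div (hentry A _ _ hAc) hi
  refine ⟨fun t => B t (Sum.inl ()) (Sum.inl ()) - β t * A t (Sum.inl ()) (Sum.inl ()), β,
    (hentry B _ _ hBc).sub (hβc.mul (hentry A _ _ hAc)), hβc, ?_⟩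
  obtain ⟨J₁, hJ₁, hJ₁o, ht₁⟩ := eventually_nhds_iff.mp
    ((hJ.eventually_mem ht₀).and (hYgeo.and
      ((((hγ.contMDiffAt (hJ.mem_nhds ht₀)).continuousAt).eventually (hV.eventually_mem hVt)).and
      ((hentry A _ _ hAc).eventually_ne hi))))
  filter_upwards [hJ₁o.mem_nhds ht₁] with t ht
  obtain ⟨htJ, ⟨hYt, f, hf⟩, hγV, hAi⟩ := hJ₁ t ht
  have hacc := coframe_covariant_acceleration (C := C) hU hs hcov hJ₁o
    (hγ.mono fun t ht => (hJ₁ t ht).1) (fun t ht => hγU t (hJ₁ t ht).1) ht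
    ((hY.contMDiffAt (hV.mem_nhds hγV)).mdifferentiableAt (by simp))
    (Filter.eventually_of_mem (hJ₁o.mem_nhds ht) fun t ht => (hJ₁ t ht).2.1.1)
  rw [hf, ← coframeL_apply, map_smul, coframeL_apply, coframe_velocity (hsd t htJ) (hγd t htJ),
    ← hAdef, ← gradedPart_smul] at hacc
  have hrow : ∀ k, B t (Sum.inr k) (Sum.inl ()) =
      (f + 2 * A t (Sum.inl ()) (Sum.inl ())) * A t (Sum.inr k) (Sum.inl ()) := by
    intro k
    have h1 := congrFun (congrFun hacc (Sum.inr k)) (Sum.inl ())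
    rw [gradedPart_neg_one_apply, gradedPart_neg_one_apply] at h1
    simp only [Matrix.add_apply, Matrix.sub_apply, Matrix.smul_apply, smul_eq_mul] at h1
    simp only [hB, Matrix.add_apply]
    linarith
  have hβt : β t = f + 2 * A t (Sum.inl ()) (Sum.inl ()) := by
    simp only [hβ]
    rw [hrow i, mul_div_cancel_right₀ _ hAi]
  change (B t).mulVec (firstVec n) = _
  ext (⟨⟩ | k)
  · simp [mulVec_firstVec, firstVec_inl]
  · simp [mulVec_firstVec, firstVec_inr, hrow k, hβt]

/-- A curve whose lift satisfies the geodesic equation is a reparametrized projection of a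
flow line. -/
theorem exists_eventually_eq_proj_flowLine [FiniteDimensional ℝ ET] (hJ : IsOpen J)
    (hps : ∀ x ∈ U, C.proj (s x) = x) (hγU : ∀ t ∈ J, γ t ∈ U)
    (hsγ : ContMDiffOn 𝓘(ℝ, ℝ) 𝓘(ℝ, ET) ∞ (fun t => s (γ t)) J) (ht₀ : t₀ ∈ J)
    {α β : ℝ → ℝ} (hα : ContinuousAt α t₀) (hβ : ContinuousAt β t₀)
    (hgeo : ∀ᶠ t in 𝓝 t₀, (deriv (C.dev fun t => s (γ t)) t +
        C.dev (fun t => s (γ t)) t * C.dev (fun t => s (γ t)) t).mulVec (firstVec n) =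
      α t • firstVec n + β t • (C.dev (fun t => s (γ t)) t).mulVec (firstVec n))
    {X : Mat n} (hX : X ∈ slAlg n) (hX2 : X * X = 0) (hXdet : ∀ s : ℝ, (1 + s • X).det = 1)
    (hX0 : X.mulVec (firstVec n) (Sum.inl ()) = 0)
    (hXi : ∃ i, X.mulVec (firstVec n) (Sum.inr i) ≠ 0) (h₀ : parSl n) {r : ℝ}
    (hinit : (((h₀ : GL (Idx n) ℝ)⁻¹ : GL (Idx n) ℝ) : Mat n).mulVec
      ((C.dev (fun t => s (γ t)) t₀).mulVec (firstVec n)) = X.mulVec (firstVec n) + r • firstVec n)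
    {c : ℝ → T} (hc : IsMIntegralCurveAt (I := 𝓘(ℝ, ET)) c (C.constantField X) 0)
    (hc0 : c 0 = C.act (s (γ t₀)) h₀) :
    ∃ φ : ℝ → ℝ, ContDiffAt ℝ ∞ φ t₀ ∧ φ t₀ = 0 ∧ deriv φ t₀ ≠ 0 ∧
      ∀ᶠ t in 𝓝 t₀, γ t = C.proj (c (φ t)) := by
  obtain ⟨J', φ, h, hJ'J, hJ', ht₀', hφ, hφ0, hφ', hh, hh0, hdev⟩ := exists_straightening hJ
    (C.contDiffOn_dev hJ hsγ) (fun t _ => C.dev_mem _ t) ht₀ hα hβ hgeo hX2 hXdet hX0 hXi h₀ hinit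
  obtain ⟨κ, W, hW, hW0, hκ, hκJ, hκ0, hφκ, hκφ⟩ := exists_local_inverse hJ' hφ ht₀' hφ'
  rw [hφ0] at hW0 hκ0
  refine ⟨φ, hφ.contDiffAt (hJ'.mem_nhds ht₀'), hφ0, hφ', ?_⟩
  set b : ℝ → T := fun t => C.act (s (γ t)) (h t) with hb
  have hbs : ContMDiffOn 𝓘(ℝ, ℝ) 𝓘(ℝ, ET) ∞ b J' :=
    C.contMDiffOn_act (hsγ.mono hJ'J) hh.contMDiffOn
  have hbdev : ∀ t ∈ J', C.dev b t = deriv φ t • X := fun t ht =>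
    (C.dev_act hJ' (hsγ.mono hJ'J) hh ht).trans (hdev t ht)
  -- The inverse parameter κ cancels φ', leaving a curve with constant logarithmic derivative X,
  -- that is, a flow line.
  have hbκ : ∀ τ ∈ W, C.dev (fun τ => b (κ τ)) τ = X := by
    intro τ hτ
    have hκd : DifferentiableAt ℝ κ τ :=
      (hκ.contDiffAt (hW.mem_nhds hτ)).differentiableAt (by simp)
    have hφd : DifferentiableAt ℝ φ (κ τ) :=
      (hφ.contDiffAt (hJ'.mem_nhds (hκJ hτ))).differentiableAt (by simp)
    have h1 : deriv φ (κ τ) * deriv κ τ = 1 := by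
      rw [← deriv_comp τ hφd hκd,
        (Filter.eventuallyEq_of_mem (hW.mem_nhds hτ) hφκ : φ ∘ κ =ᶠ[𝓝 τ] id).deriv_eq, deriv_id]
    rw [C.dev_comp_real ((hbs.contMDiffAt (hJ'.mem_nhds (hκJ hτ))).mdifferentiableAt (by simp))
      hκd, hbdev _ (hκJ hτ), smul_smul, mul_comm, h1, one_smul]
  have hint : IsMIntegralCurveAt (I := 𝓘(ℝ, ET)) (fun τ => b (κ τ)) (C.constantField X) 0 :=
    C.isMIntegralCurveAt_of_dev hX hW (hbs.comp hκ.contMDiffOn hκJ) hbκ hW0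
  have heq := isMIntegralCurveAt_eventuallyEq_of_contMDiffAt_boundaryless
    (γ := fun τ => b (κ τ)) (((C.contMDiff_constantField hX) (b (κ 0))).of_le (by simp)) hint hc
    (by rw [hc0, hκ0, ← hh0])
  have hφt : Filter.Tendsto φ (𝓝 t₀) (𝓝 0) :=
    hφ0 ▸ (hφ.contDiffAt (hJ'.mem_nhds ht₀')).continuousAt
  filter_upwards [hφt.eventually heq, hκφ, hJ'.mem_nhds ht₀'] with t h1 h2 h3
  rw [← h1, h2, hb]
  exact ((C.proj_act _ _).trans (hps _ (hγU t (hJ'J h3)))).symm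

end Paths

/-! ## The extension of the structure group -/

section Extension

variable {n : ℕ}
  {EM ET ET' : Type*} [NormedAddCommGroup EM] [NormedSpace ℝ EM]
  [NormedAddCommGroup ET] [NormedSpace ℝ ET] [NormedAddCommGroup ET'] [NormedSpace ℝ ET']
  {M : Type*} [TopologicalSpace M] [ChartedSpace EM M]
  {T : Type*} [TopologicalSpace T] [ChartedSpace ET T] [IsManifold 𝓘(ℝ, ET) ∞ T]
  {C : CartanGeometry (spAlg n) (parSp n) (EM := EM) (ET := ET) M T}
  [ChartedSpace ET' (C.Ext (parSp_le_parSl n))]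
  [IsManifold 𝓘(ℝ, ET') ∞ (C.Ext (parSp_le_parSl n))]
  {C' : CartanGeometry (slAlg n) (parSl n) (EM := EM) (ET := ET') M (C.Ext (parSp_le_parSl n))}

namespace IsFeffermanExtension

theorem proj_extIncl (hC' : IsFeffermanExtension C C') (u : T) :
    C'.proj (C.extIncl (parSp_le_parSl n) u) = C.proj u := by
  rw [hC'.proj_eq]
  rfl

/-- The relation [u, p] = [u·p, 1] in the quotient. -/
theorem act_extIncl (hC' : IsFeffermanExtension C C') (u : T) (p : parSp n) :
    C'.act (C.extIncl (parSp_le_parSl n) u) (Subgroup.inclusion (parSp_le_parSl n) p) =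
      C.extIncl (parSp_le_parSl n) (C.act u p) := by
  rw [hC'.act_eq]
  refine Quotient.sound (s := C.extSetoid (parSp_le_parSl n)) ⟨p, rfl, ?_⟩
  simp

theorem dev_extIncl (hC' : IsFeffermanExtension C C') {c : ℝ → T} {t : ℝ}
    (hc : MDifferentiableAt 𝓘(ℝ, ℝ) 𝓘(ℝ, ET) c t) :
    C'.dev (fun t => C.extIncl (parSp_le_parSl n) (c t)) t = C.dev c t := by
  unfold CartanGeometry.dev
  rw [velocity_comp ((hC'.contMDiff_incl _).mdifferentiableAt (by simp)) hc, hC'.pullback_form]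

/-- Because j^*ω̃ = ω, flow lines keep their logarithmic derivative under j. -/
theorem exists_lift_of_isMIntegralCurveAt [FiniteDimensional ℝ ET]
    (hC' : IsFeffermanExtension C C') {X : Mat n} (hX : X ∈ spAlg n)
    {c : ℝ → T} {t₀ : ℝ} (hc : IsMIntegralCurveAt (I := 𝓘(ℝ, ET)) c (C.constantField X) t₀) :
    ∃ I : Set ℝ, IsOpen I ∧ t₀ ∈ I ∧
      ContMDiffOn 𝓘(ℝ, ℝ) 𝓘(ℝ, ET') ∞ (fun t => C.extIncl (parSp_le_parSl n) (c t)) I ∧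
      ∀ t ∈ I, C'.dev (fun t => C.extIncl (parSp_le_parSl n) (c t)) t = X := by
  obtain ⟨I, hI, h0, hcs, hdev⟩ := C.exists_dev_of_isMIntegralCurveAt hX hc
  refine ⟨I, hI, h0, hC'.contMDiff_incl.comp_contMDiffOn hcs, fun t ht => ?_⟩
  rw [hC'.dev_extIncl ((hcs.contMDiffAt (hI.mem_nhds ht)).mdifferentiableAt (by simp)), hdev t ht]

theorem isProjectivePath_of_isFlowLineProjection [IsManifold 𝓘(ℝ, EM) ∞ M]
    [FiniteDimensional ℝ ET] [FiniteDimensional ℝ ET']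
    (hC' : IsFeffermanExtension C C') {J : Set ℝ} (hJ : IsOpen J) {γ : ℝ → M}
    (h : IsFlowLineProjection C (spGrade n (-1) ∪ spGrade n (-2)) γ J) :
    IsProjectivePath C' γ J := by
  have hlift : ∀ t₀ ∈ J, ∃ X ∈ spGrade n (-1) ∪ spGrade n (-2), X ≠ 0 ∧
      ∃ (c : ℝ → C.Ext (parSp_le_parSl n)) (I : Set ℝ) (φ : ℝ → ℝ), IsOpen I ∧ φ t₀ ∈ I ∧
        ContMDiffOn 𝓘(ℝ, ℝ) 𝓘(ℝ, ET') ∞ c I ∧ (∀ t ∈ I, C'.dev c t = X) ∧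
        ContDiffAt ℝ ∞ φ t₀ ∧ deriv φ t₀ ≠ 0 ∧ ∀ᶠ t in 𝓝 t₀, γ t = C'.proj (c (φ t)) := by
    intro t₀ ht₀
    obtain ⟨X, hX, hX0, c, φ, hφ, hφ', hc, hγ⟩ := h t₀ ht₀
    obtain ⟨I, hI, h0, hcs, hdev⟩ :=
      hC'.exists_lift_of_isMIntegralCurveAt (mem_spAlg_of_mem_spGrade hX) hc
    refine ⟨X, hX, hX0, _, I, φ, hI, h0, hcs, hdev, hφ, hφ', ?_⟩
    filter_upwards [hγ] with t ht
    rw [ht, hC'.proj_extIncl]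
  have hsmooth : ContMDiffOn 𝓘(ℝ, ℝ) 𝓘(ℝ, EM) ∞ γ J := by
    intro t₀ ht₀
    obtain ⟨X, -, -, c, I, φ, hI, h0, hcs, -, hφ, -, hγ⟩ := hlift t₀ ht₀
    refine ContMDiffAt.contMDiffWithinAt (ContMDiffAt.congr_of_eventuallyEq ?_ hγ)
    exact (C'.contMDiff_proj _).comp t₀
      ((hcs.contMDiffAt (hI.mem_nhds h0)).comp t₀ hφ.contMDiffAt)
  have hregular : ∀ t ∈ J, velocity (EM := EM) γ t ≠ 0 := by
    intro t₀ ht₀ hv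
    obtain ⟨X, hX, hX0, c, I, φ, hI, h0, hcs, hdev, hφ, hφ', hγ⟩ := hlift t₀ ht₀
    have hcd : MDifferentiableAt 𝓘(ℝ, ℝ) 𝓘(ℝ, ET') c (φ t₀) :=
      (hcs.contMDiffAt (hI.mem_nhds h0)).mdifferentiableAt (by simp)
    have hv' : (velocity (EM := EM) γ t₀ : EM) = 0 := hv
    rw [velocity_congr hγ, velocity_comp_real_of_eq (γ := fun τ => C'.proj (c τ)) rfl
      ((C'.mdifferentiableAt_proj _).comp (φ t₀) hcd)
      (hφ.differentiableAt (by simp)).hasDerivAt] at hv'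
    refine C'.velocity_proj_ne_zero hcd ?_ ((smul_eq_zero.mp hv').resolve_left hφ')
    rw [hdev _ h0]
    exact exists_mulVec_firstVec_ne_zero hX hX0
  refine ⟨hsmooth, hregular, fun t₀ ht₀ => ?_⟩
  obtain ⟨X, hX, hX0, c, I, φ, hI, h0, hcs, hdev, hφ, -, hγ⟩ := hlift t₀ ht₀
  exact C'.exists_isUnparametrizedGeodesicAt hI hcs hdev (mul_self_of_mem_spGrade hX)
    (mulVec_firstVec_inl_of_mem_spGrade hX) (exists_mulVec_firstVec_ne_zero hX hX0) h0
    hφ.continuousAt hJ ht₀ hsmooth hregular hγ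

theorem isFlowLineProjection_of_isProjectivePath [IsManifold 𝓘(ℝ, EM) ∞ M]
    [FiniteDimensional ℝ ET] [FiniteDimensional ℝ ET']
    (hC' : IsFeffermanExtension C C') {J : Set ℝ} (hJ : IsOpen J) {γ : ℝ → M}
    (h : IsProjectivePath C' γ J) :
    IsFlowLineProjection C (spGrade n (-1) ∪ spGrade n (-2)) γ J := by
  intro t₀ ht₀
  obtain ⟨U, hU, hγU, cov, ⟨-, s, hs, hps, hcov⟩, hgeo⟩ := h.geodesic t₀ ht₀
  set J₁ := J ∩ γ ⁻¹' U with hJ₁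
  have hJ₁o : IsOpen J₁ := h.smooth.continuousOn.isOpen_inter_preimage hJ hU
  have ht₁ : t₀ ∈ J₁ := ⟨ht₀, hγU⟩
  have hγs : ContMDiffOn 𝓘(ℝ, ℝ) 𝓘(ℝ, EM) ∞ γ J₁ := h.smooth.mono Set.inter_subset_left
  obtain ⟨α, β, hα, hβ, hacc⟩ := exists_acceleration_of_isUnparametrizedGeodesicAt hU hs hps hcov
    hJ₁o hγs ht₁ (fun t ht => ht.2) (h.regular t₀ ht₀) hgeo
  obtain ⟨i, hi⟩ := exists_dev_mulVec_ne_zero hU hs hps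
    ((hγs.contMDiffAt (hJ₁o.mem_nhds ht₁)).mdifferentiableAt (by simp)) hγU (h.regular t₀ ht₀)
  set a := (C'.dev (fun t => s (γ t)) t₀).mulVec (firstVec n) with ha
  obtain ⟨u, hu⟩ := C.surjective_proj (γ t₀)
  -- q carries the chosen section to a point in the image of j; v is the first column of the
  -- logarithmic derivative, seen from that point.
  obtain ⟨q, hq, -⟩ := C'.existsUnique_act (s (γ t₀)) (C.extIncl (parSp_le_parSl n) u)
    (by rw [hps _ hγU, hC'.proj_extIncl, hu])
  set v := (((q : GL (Idx n) ℝ)⁻¹ : GL (Idx n) ℝ) : Mat n).mulVec a with hv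
  have hav : a = ((q : GL (Idx n) ℝ) : Mat n).mulVec v := by
    rw [hv, Matrix.mulVec_mulVec, ← Units.val_mul, mul_inv_cancel, Units.val_one,
      Matrix.one_mulVec]
  have hvi : ∃ i, v (Sum.inr i) ≠ 0 := by
    by_contra! h0
    obtain ⟨b, hb⟩ := (mem_span_firstVec v).mpr h0
    obtain ⟨l, -, hl⟩ := parSl_mulVec_firstVec q
    rw [hb, Matrix.mulVec_smul, hl, smul_smul] at hav
    exact hi ((mem_span_firstVec a).mp ⟨_, hav⟩ i)
  -- p lies in P, so it moves u within the original bundle; relative to u·p the direction is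
  -- represented by X.
  obtain ⟨p, X, hX, hX0, hp, r, hpX⟩ := exists_parSp_spGrade hvi
  have hinv : (((p : GL (Idx n) ℝ)⁻¹ : GL (Idx n) ℝ) : Mat n) * ((p : GL (Idx n) ℝ) : Mat n) = 1 := by
    rw [← Units.val_mul, inv_mul_cancel, Units.val_one]
  have hpinv : (((p : GL (Idx n) ℝ)⁻¹ : GL (Idx n) ℝ) : Mat n).mulVec (firstVec n) =
      firstVec n := by
    conv_lhs => rw [← hp, Matrix.mulVec_mulVec, hinv, Matrix.one_mulVec]
  have hpv : (((p : GL (Idx n) ℝ)⁻¹ : GL (Idx n) ℝ) : Mat n).mulVec v =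
      X.mulVec (firstVec n) + (-r) • firstVec n := by
    rw [eq_sub_of_add_eq hpX.symm, Matrix.mulVec_sub, Matrix.mulVec_smul, hpinv,
      Matrix.mulVec_mulVec, hinv, Matrix.one_mulVec, neg_smul, sub_eq_add_neg]
  set p' := Subgroup.inclusion (parSp_le_parSl n) p with hp'
  have hXs := mem_spAlg_of_mem_spGrade hX
  have hX2 := mul_self_of_mem_spGrade hX
  have hXi := exists_mulVec_firstVec_ne_zero hX hX0
  obtain ⟨c, hc0, hc⟩ := exists_isMIntegralCurveAt_of_contMDiffAt_boundaryless 0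
    ((C.contMDiff_constantField hXs (C.act u p)).of_le (by simp : (1 : WithTop ℕ∞) ≤ ∞))
  obtain ⟨I, hI, hI0, hcs, hdev⟩ := hC'.exists_lift_of_isMIntegralCurveAt hXs hc
  -- The initial gauge q·p leads from the section to j(u·p), where the j-image of the flow line of
  -- ω⁻¹(X) starts.
  obtain ⟨φ, hφ, hφ0, hφ', hγc⟩ := exists_eventually_eq_proj_flowLine hJ₁o hps
    (fun t ht => ht.2) (hs.comp hγs fun t ht => ht.2) ht₁ hα hβ hacc
    (mem_slAlg_of_mem_spGrade hX) hX2 (det_one_add_smul_of_mem_spAlg hXs hX2)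
    (mulVec_firstVec_inl_of_mem_spGrade hX) hXi (q * p') (r := -r)
    (by
      rw [← hpv, hv, ← ha, Subgroup.coe_mul, mul_inv_rev, Units.val_mul, ← Matrix.mulVec_mulVec]
      rfl)
    (C'.isMIntegralCurveAt_of_dev (mem_slAlg_of_mem_spGrade hX) hI hcs hdev hI0)
    (by rw [hc0, C'.act_mul, hq, hC'.act_extIncl])
  refine ⟨X, hX, hX0, c, φ, hφ, hφ', hφ0 ▸ hc, ?_⟩
  filter_upwards [hγc] with t ht
  rw [ht, hC'.proj_extIncl]

end IsFeffermanExtension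

end Extension

end CartanPaths

theorem proposition3p1 (n : ℕ)
    {EM ET ET' : Type*}
    [NormedAddCommGroup EM] [NormedSpace ℝ EM] [FiniteDimensional ℝ EM]
    [NormedAddCommGroup ET] [NormedSpace ℝ ET] [FiniteDimensional ℝ ET]
    [NormedAddCommGroup ET'] [NormedSpace ℝ ET'] [FiniteDimensional ℝ ET']
    {M : Type*} [TopologicalSpace M] [T2Space M] [SecondCountableTopology M]
    [ChartedSpace EM M] [IsManifold 𝓘(ℝ, EM) ∞ M]
    {T : Type*} [TopologicalSpace T] [ChartedSpace ET T] [IsManifold 𝓘(ℝ, ET) ∞ T]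
    (C : CartanPaths.CartanGeometry (CartanPaths.spAlg n) (CartanPaths.parSp n)
      (EM := EM) (ET := ET) M T)
    [ChartedSpace ET' (C.Ext (CartanPaths.parSp_le_parSl n))]
    [IsManifold 𝓘(ℝ, ET') ∞ (C.Ext (CartanPaths.parSp_le_parSl n))]
    (C' : CartanPaths.CartanGeometry (CartanPaths.slAlg n) (CartanPaths.parSl n)
      (EM := EM) (ET := ET') M (C.Ext (CartanPaths.parSp_le_parSl n)))
    (hC' : CartanPaths.IsFeffermanExtension C C')
    (J : Set ℝ) (hJ : IsOpen J) (γ : ℝ → M) :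
    CartanPaths.IsProjectivePath C' γ J ↔
      CartanPaths.IsFlowLineProjection C
        (CartanPaths.spGrade n (-1) ∪ CartanPaths.spGrade n (-2)) γ J :=
  ⟨hC'.isFlowLineProjection_of_isProjectivePath hJ, hC'.isProjectivePath_of_isFlowLineProjection hJ⟩
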